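/- Theorem. Describe a packing of $\mathbb{R}^5$ by spheres of radius $\sqrt2/2$ by its set of centers, i.e., a set $\mathcal P\subset\mathbb{R}^5$ whose distinct points are at distance at least $\sqrt2$. Call a nonempty packing $\mathcal P$ uniform if the isometries of $\mathbb{R}^5$ preserving $\mathcal P$ act transitively on $\mathcal P$. The kissing configuration of $\mathcal P$ at $x\in\mathcal P$ is $\{v : x+v\in\mathcal P,\ |v|=\sqrt2\}$, and $\mathcal P$ has kissing configuration $K$ if for every $x\in\mathcal P$ its kissing configuration at $x$ is the image of $K$ under an orthogonal transformation. Consider the following four $40$-point configurations. - $D_5$: the permutations of $(\pm1,\pm1,0,0,0)$. - $L_5$: obtained from $D_5$ by replacing the points with fifth coordinate $1$ by the points $(\pm\frac12,\pm\frac12,\pm\frac12,\pm\frac12,1)$ with an odd number of minus signs. - $Q_5$ (resp. $R_5$): obtained from $D_5$ (resp. $L_5$) by replacing the points with coordinate sum $2$ by the reflections of the points with coordinate sum $-2$ across the hyperplane of coordinate sum $0$. Up to isometry there are exactly six uniform packings of $\mathbb{R}^5$ by spheres of radius $\sqrt2/2$ with kissing configuration $D_5$, $L_5$, $Q_5$ or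 $R_5$: 1. exactly one with $D_5$, namely the $D_5$ root lattice $\{v\in\mathbb{Z}^5 : \sum_i v_i \text{ even}\}$; 2. exactly three with $L_5$, namely Leech's three uniform packings. Let $D_4=\{v\in\mathbb{Z}^4:\sum_i v_i\text{ even}\}$ and $g_0=0$, $g_1=(1,0,0,0)$, $g_2=(\frac12,\frac12,\frac12,\frac12)$, $g_3=(\frac12,\frac12,\frac12,-\frac12)$; the three packings are $\bigcup_{k\in\mathbb{Z}}(D_4+g_{c(k)})\times\{k\}$, where $c:\mathbb{Z}\to\{0,1,2,3\}$ repeats periodically the pattern $0,1,2,3$, or $0,1,2$, or $0,1,2,0,3,2,1,3$, starting at $k=0$; 3. exactly one with $Q_5$, namely the union of the translates by $(0,0,0,0,0)$ and $(0,0,0,-1,-1)$ of the lattice with basis $(1,-1,0,0,0)$, $(0,1,-1,0,0)$, $(0,0,1,-1,0)$, $(0,0,0,1,-1)$, $(\frac45,\frac45,\frac45,\frac45,\frac45)$; 4. exactly one with $R_5$, namely the union of the translates by $(0,0,0,0,0)$, $(0,0,0,1,-1)$, $(0,0,-1,-1,0)$ and $(0,0,0,-1,-1)$ of the lattice with basis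 $(1,-1,0,0,0)$, $(0,1,-1,0,0)$, $(0,0,1,-1,0)$, $(-\frac12,-\frac12,-\frac12,-\frac12,2)$, $(\frac45,\frac45,\frac45,\frac45,\frac45)$. Moreover, the uniform packings with kissing configuration $Q_5$ are $2$-periodic and those with kissing configuration $R_5$ are $4$-periodic, where $\mathcal P$ is called $m$-periodic if $\Lambda=\{y\in\mathbb{R}^5 : \mathcal P=\mathcal P+y\}$ is a lattice of full rank and $\mathcal P$ consists of exactly $m$ translates of $\Lambda$. -/

import Mathlib

open scoped Pointwise

noncomputable section

namespace FiveDim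

/-- Five-dimensional Euclidean space. -/
abbrev E5 := EuclideanSpace ℝ (Fin 5)

/-! ### Sphere packings, described by their sets of centers

The common radius of the spheres is `√2 / 2`, so that centers of tangent spheres are at
distance `√2` from each other. -/

/-- `P` is the set of centers of a packing by spheres of radius `√2 / 2`. -/
def IsSpherePacking (P : Set E5) : Prop :=
  P.Pairwise fun x y => √2 ≤ dist x y

/-- The symmetry group of `P` (the isometries of space that preserve `P`) acts transitively on
the points of `P`. -/
def IsUniform (P : Set E5) : Prop :=
  ∀ x ∈ P, ∀ y ∈ P, ∃ g : E5 ≃ᵢ E5, g '' P = P ∧ g x = y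

/-- The kissing configuration of the packing `P` at the center `x`: the vectors from `x` to the
centers of the spheres tangent to the sphere at `x`. -/
def kissingConfig (P : Set E5) (x : E5) : Set E5 :=
  {v | x + v ∈ P ∧ ‖v‖ = √2}

/-- `P` is nonempty and its kissing configuration at each of its points is isometric to `K`
(by an orthogonal transformation). -/
def HasKissingConfig (P K : Set E5) : Prop :=
  P.Nonempty ∧ ∀ x ∈ P, ∃ L : E5 ≃ₗᵢ[ℝ] E5, L '' K = kissingConfig P x

/-- The (nonempty) uniform sphere packings with kissing configuration `K`. -/
def uniformPackings (K : Set E5) : Set (Set E5) :=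
  {P | IsSpherePacking P ∧ IsUniform P ∧ HasKissingConfig P K}

/-- Two subsets of space are isometric when an isometry of space carries one to the other. -/
def isometrySetoid : Setoid (Set E5) where
  r P Q := ∃ g : E5 ≃ᵢ E5, g '' P = Q
  iseqv :=
    { refl := fun P => ⟨IsometryEquiv.refl E5, Set.image_id P⟩
      symm := by
        rintro P Q ⟨g, rfl⟩
        exact ⟨g.symm, by ext x; simp⟩
      trans := by
        rintro P Q R ⟨g, rfl⟩ ⟨h, rfl⟩
        exact ⟨g.trans h, by rw [Set.image_image]; rfl⟩ }

/-- Subsets of space up to isometry. -/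
abbrev IsometryClass := Quotient isometrySetoid

/-- The isometry class of a subset of space. -/
def isometryClass (P : Set E5) : IsometryClass := Quotient.mk isometrySetoid P

/-- The translational symmetries of `P`: the vectors `y` with `P = P + y`. -/
def translationLattice (P : Set E5) : AddSubgroup E5 where
  carrier := {y | y +ᵥ P = P}
  zero_mem' := by simp
  add_mem' := by
    intro a b ha hb
    simp only [Set.mem_ofPred_eq] at ha hb ⊢
    rw [add_vadd, hb, ha]
  neg_mem' := by
    intro a ha
    simp only [Set.mem_ofPred_eq] at ha ⊢
    rw [neg_vadd_eq_iff, ha]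

/-- `P` is `m`-periodic: its translational symmetries form a lattice of full rank, and `P`
consists of `m` translates (cosets) of that lattice. -/
def IsPeriodicPacking (m : ℕ) (P : Set E5) : Prop :=
  DiscreteTopology (translationLattice P) ∧
  Submodule.span ℝ (translationLattice P : Set E5) = ⊤ ∧
  ((QuotientAddGroup.mk : E5 → E5 ⧸ translationLattice P) '' P).encard = m

/-! ### The four kissing configurations -/

/-- The permutations of `(±1, ±1, 0, 0, 0)`. -/
def kissD5 : Set E5 :=
  {v | (∀ i, v i = -1 ∨ v i = 0 ∨ v i = 1) ∧ ∑ i, v i ^ 2 = 2}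

/-- `kissD5` with the layer of fifth coordinate `1` replaced by the points
`(±1/2, ±1/2, ±1/2, ±1/2, 1)` with an odd number of minus signs. -/
def kissL5 : Set E5 :=
  {v ∈ kissD5 | v 4 ≠ 1} ∪
  {v | v 4 = 1 ∧ (∀ i : Fin 4, v i.castSucc = 1 / 2 ∨ v i.castSucc = -(1 / 2)) ∧
    ∏ i : Fin 4, v i.castSucc < 0}

/-- Reflection across the hyperplane of vectors with coordinate sum `0`: for a vector with
coordinate sum `s`, subtract `2 s / 5` from each coordinate. -/
def reflectSum (v : E5) : E5 :=
  WithLp.toLp 2 fun i => v i - 2 * (∑ j, v j) / 5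

/-- Replace the layer of `K` with coordinate sum `2` by the reflection of the layer with
coordinate sum `-2`. -/
def replaceLayer (K : Set E5) : Set E5 :=
  {v ∈ K | ∑ i, v i ≠ 2} ∪ reflectSum '' {v ∈ K | ∑ i, v i = -2}

/-- The kissing configuration `Q₅`. -/
def kissQ5 : Set E5 := replaceLayer kissD5

/-- The kissing configuration `R₅`. -/
def kissR5 : Set E5 := replaceLayer kissL5

/-! ### The six packings -/

/-- The root lattice `D₅`. -/
def packingD5 : Set E5 :=
  {v | (∀ i, ∃ k : ℤ, v i = k) ∧ ∃ k : ℤ, ∑ i, v i = 2 * k}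

/-- The root lattice `D₄`, placed in the hyperplane with fifth coordinate `0`. -/
def layerD4 : Set E5 := {v ∈ packingD5 | v 4 = 0}

/-- Representatives of the four cosets of `D₄` in its dual lattice. -/
def glueD4 : Fin 4 → E5 :=
  ![!₂[0, 0, 0, 0, 0], !₂[1, 0, 0, 0, 0], !₂[1 / 2, 1 / 2, 1 / 2, 1 / 2, 0],
    !₂[1 / 2, 1 / 2, 1 / 2, -(1 / 2), 0]]

/-- The periodic stacking of `D₄` layers at the integer heights, in which the layer at each
height congruent to `j` modulo `n` is the coset of `D₄` labelled by `c j`. -/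
def stackingD4 {n : ℕ} (c : Fin n → Fin 4) : Set E5 :=
  {v | ∃ (k : ℤ) (j : Fin n),
    v - glueD4 (c j) - EuclideanSpace.single 4 ((n * k + j : ℤ) : ℝ) ∈ layerD4}

/-- Leech's three uniform packings. -/
def packingL5 : Fin 3 → Set E5 :=
  ![stackingD4 ![0, 1, 2, 3], stackingD4 ![0, 1, 2], stackingD4 ![0, 1, 2, 0, 3, 2, 1, 3]]

/-- The union of the translates by the vectors `x i` of the lattice generated by the `b j`. -/
def translatesOf {m : ℕ} (b : Fin 5 → E5) (x : Fin m → E5) : Set E5 :=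
  {v | ∃ i, v - x i ∈ Submodule.span ℤ (Set.range b)}

/-- The uniform packing with kissing configuration `Q₅`. -/
def packingQ5 : Set E5 :=
  translatesOf
    ![!₂[1, -1, 0, 0, 0], !₂[0, 1, -1, 0, 0], !₂[0, 0, 1, -1, 0], !₂[0, 0, 0, 1, -1],
      !₂[4 / 5, 4 / 5, 4 / 5, 4 / 5, 4 / 5]]
    ![!₂[0, 0, 0, 0, 0], !₂[0, 0, 0, -1, -1]]

/-- The uniform packing with kissing configuration `R₅`. -/
def packingR5 : Set E5 :=
  translatesOf
    ![!₂[1, -1, 0, 0, 0], !₂[0, 1, -1, 0, 0], !₂[0, 0, 1, -1, 0],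
      !₂[-(1 / 2), -(1 / 2), -(1 / 2), -(1 / 2), 2], !₂[4 / 5, 4 / 5, 4 / 5, 4 / 5, 4 / 5]]
    ![!₂[0, 0, 0, 0, 0], !₂[0, 0, 0, 1, -1], !₂[0, 0, -1, -1, 0], !₂[0, 0, 0, -1, -1]]

end FiveDim

end

open FiveDim

/-! Contacts carry the whole packing. For each of the four configurations `K`, a vector `d` with
`⟪d, w⟫ ≤ 1` for all `w ∈ K` satisfies `⟪d, d⟫ < 2` (`KissingData.cover`): the cell cut out by the
neighbors of a center stays inside the open ball of radius `√2`. Hence a nonempty set of centers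
that contains the neighbors of its members is the entire packing (`eq_of_subset_of_closed`), and
information can be propagated from neighbor to neighbor.

The rigid part of a kissing configuration is its antipodal part, formed by the roots of `D₅`, `D₄`,
`A₄`, `A₃` for `D₅`, `L₅`, `Q₅`, `R₅` respectively. Whether `v` is antipodal can be read off from
the inner products among the vectors having product `1` with `v`. These lead to the common neighbors
of `x` and `x + v`, which look alike from both ends. So an antipodal `v` at `x` remains antipodal at
`x + v`, and the two configurations coincide (`kissingConfig_add_of_antipodal`). The antipodal part
is then the same at all centers, and its members are translations of the packing.

For `D₅`, `Q₅`, `R₅` the configuration at a center determines those at its neighbors (`rule_D5`,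
`rule_Q5`, `rule_R5`). The configuration at a neighbor is `L '' K` with `L` preserving the antipodal
roots; for `Q₅` this makes `L` act by `±1` on the normal line of `A₄`, so the mirror symmetry of `K`
survives and the vectors already known generate all 40. For `R₅` the complement of `A₃` is a plane,
whose axes `ones` and `nu` are recovered from pairs of known vectors with inner product `2/5` or
`-1/2`. Such a local rule leaves one packing up to isometry (`exists_isometry_of_local_rule`), and
the explicit packings realize it.

For `L₅` the `D₄` translations turn the packing into a stack of cosets of `D₄` in its dual,
described by labels `c : ℤ → Fin 4` (`exists_eq_stack`) with any three consecutive labels distinct.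
Isometries realize all permutations of the labels (`inducedPerms_eq_top`), so only the set of `j`
with `c j = c (j + 3)` matters. Uniformity supplies, for every `m`, a shift by `m` or a reflection
preserving this set; it is therefore empty, everything, or one parity class
(`constant_or_alternating`), and these are Leech's three packings.

The inner products `-1/2` and `2/5` tell the four kinds of packing apart, which gives the total of
six. Periodicity is read off from explicit coordinates of the translation classes. -/

namespace FiveDim

open scoped RealInnerProductSpace

/-! ### Isometries of space -/

/-- The linear part of an isometry of space. -/
noncomputable def linPart (g : E5 ≃ᵢ E5) : E5 ≃ₗᵢ[ℝ] E5 :=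
  g.toRealAffineIsometryEquiv.linearIsometryEquiv

theorem isometry_add (g : E5 ≃ᵢ E5) (x v : E5) : g (x + v) = g x + linPart g v := by
  have h := g.toRealAffineIsometryEquiv.map_vadd x v
  simp only [vadd_eq_add, IsometryEquiv.coeFn_toRealAffineIsometryEquiv] at h
  rw [add_comm x v, h, add_comm]
  rfl

theorem linPart_sub (g : E5 ≃ᵢ E5) (x y : E5) : linPart g (x - y) = g x - g y := by
  have := isometry_add g y (x - y)
  rw [add_sub_cancel] at this
  rw [this]; abel

/-- The isometry with linear part `L` that sends `x` to `y`. -/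
noncomputable def moveIsometry (L : E5 ≃ₗᵢ[ℝ] E5) (x y : E5) : E5 ≃ᵢ E5 :=
  ((IsometryEquiv.addRight (-x)).trans L.toIsometryEquiv).trans (IsometryEquiv.addRight y)

theorem moveIsometry_apply (L : E5 ≃ₗᵢ[ℝ] E5) (x y z : E5) :
    moveIsometry L x y z = L (z - x) + y := by
  simp [moveIsometry, sub_eq_add_neg]

theorem linPart_moveIsometry (L : E5 ≃ₗᵢ[ℝ] E5) (x y v : E5) :
    linPart (moveIsometry L x y) v = L v := by
  have := isometry_add (moveIsometry L x y) x v
  simp only [moveIsometry_apply] at this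
  simpa [add_comm] using this.symm

theorem mem_kissingConfig {P : Set E5} {x v : E5} :
    v ∈ kissingConfig P x ↔ x + v ∈ P ∧ ‖v‖ = √2 := Iff.rfl

theorem mem_isometry_image {g : E5 ≃ᵢ E5} {P : Set E5} {x : E5} : g x ∈ g '' P ↔ x ∈ P :=
  g.injective.mem_set_image

theorem kissingConfig_image (g : E5 ≃ᵢ E5) (P : Set E5) (x : E5) :
    kissingConfig (g '' P) (g x) = linPart g '' kissingConfig P x := by
  ext v
  obtain ⟨w, rfl⟩ := (linPart g).surjective v
  rw [(linPart g).injective.mem_set_image]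
  simp only [mem_kissingConfig, ← isometry_add, mem_isometry_image, LinearIsometryEquiv.norm_map]

theorem IsSpherePacking.image {P : Set E5} (hP : IsSpherePacking P) (g : E5 ≃ᵢ E5) :
    IsSpherePacking (g '' P) := by
  rintro _ ⟨x, hx, rfl⟩ _ ⟨y, hy, rfl⟩ hxy
  rw [g.dist_eq]
  exact hP hx hy fun h => hxy (h ▸ rfl)

theorem HasKissingConfig.image {P K : Set E5} (hP : HasKissingConfig P K) (g : E5 ≃ᵢ E5) :
    HasKissingConfig (g '' P) K := by
  refine ⟨hP.1.image g, ?_⟩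
  rintro _ ⟨x, hx, rfl⟩
  obtain ⟨L, hL⟩ := hP.2 x hx
  refine ⟨L.trans (linPart g), ?_⟩
  rw [kissingConfig_image, ← hL, Set.image_image]
  rfl

theorem IsUniform.image {P : Set E5} (hP : IsUniform P) (g : E5 ≃ᵢ E5) : IsUniform (g '' P) := by
  rintro _ ⟨x, hx, rfl⟩ _ ⟨y, hy, rfl⟩
  obtain ⟨f, hf, hxy⟩ := hP x hx y hy
  refine ⟨(g.symm.trans f).trans g, ?_, by simp [hxy]⟩
  rw [Set.image_image]
  simp only [IsometryEquiv.trans_apply, IsometryEquiv.symm_apply_apply]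
  rw [← Set.image_image g f, hf]

theorem isometryClass_eq_iff {P Q : Set E5} :
    isometryClass P = isometryClass Q ↔ ∃ g : E5 ≃ᵢ E5, g '' P = Q :=
  Quotient.eq (r := isometrySetoid)

theorem uniformPackings_image {K P : Set E5} (hP : P ∈ uniformPackings K) (g : E5 ≃ᵢ E5) :
    g '' P ∈ uniformPackings K :=
  ⟨hP.1.image g, hP.2.1.image g, hP.2.2.image g⟩

/-! ### Kissing configurations -/

/-- The properties of a kissing configuration `K` that force the antipodal part of the kissing
configurations of a packing to be the same at all points. -/
structure KissingData (K : Set E5) (S : Set ℝ) : Prop where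
  finite : K.Finite
  inner_self : ∀ v ∈ K, ⟪v, v⟫ = 2
  add_mem : ∀ v ∈ K, ∀ w ∈ K, ⟪v, w⟫ = -1 → v + w ∈ K
  antipodal_iff : ∀ v ∈ K, (∀ r ∈ S, ∃ a ∈ K, ∃ b ∈ K, ⟪a, v⟫ = 1 ∧ ⟪b, v⟫ = 1 ∧ ⟪a, b⟫ = r) ↔
    -v ∈ K
  inner_mem : ∀ v ∈ K, -v ∈ K → ∀ w ∈ K,
    ⟪w, v⟫ = -2 ∨ ⟪w, v⟫ = -1 ∨ ⟪w, v⟫ = 0 ∨ ⟪w, v⟫ = 1 ∨ ⟪w, v⟫ = 2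
  link : ∀ v ∈ K, -v ∈ K → ∀ w ∈ K, ⟪w, v⟫ = 0 →
    ∃ a ∈ K, -a ∈ K ∧ (⟪a, v⟫ = 1 ∨ ⟪a, v⟫ = -1) ∧ ⟪w, a⟫ = -1
  cover : ∀ d : E5, (∀ w ∈ K, ⟪d, w⟫ ≤ 1) → ⟪d, d⟫ < 2

theorem KissingData.image {K : Set E5} {S : Set ℝ} (hK : KissingData K S) (L : E5 ≃ₗᵢ[ℝ] E5) :
    KissingData (L '' K) S where
  finite := hK.finite.image L
  inner_self := by
    rintro _ ⟨v, hv, rfl⟩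
    simpa using hK.inner_self v hv
  add_mem := by
    rintro _ ⟨v, hv, rfl⟩ _ ⟨w, hw, rfl⟩ h
    rw [L.inner_map_map] at h
    exact ⟨v + w, hK.add_mem v hv w hw h, map_add L v w⟩
  antipodal_iff := by
    rintro _ ⟨v, hv, rfl⟩
    rw [← map_neg, L.injective.mem_set_image, ← hK.antipodal_iff v hv]
    simp only [Set.exists_mem_image, L.inner_map_map]
  inner_mem := by
    rintro _ ⟨v, hv, rfl⟩ h _ ⟨w, hw, rfl⟩
    rw [← map_neg, L.injective.mem_set_image] at h
    simpa only [L.inner_map_map] using hK.inner_mem v hv h w hw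
  link := by
    rintro _ ⟨v, hv, rfl⟩ h _ ⟨w, hw, rfl⟩ hwv
    rw [← map_neg, L.injective.mem_set_image] at h
    rw [L.inner_map_map] at hwv
    obtain ⟨a, ha, ha', h1, h2⟩ := hK.link v hv h w hw hwv
    exact ⟨L a, ⟨a, ha, rfl⟩, ⟨-a, ha', map_neg L a⟩, by simpa only [L.inner_map_map] using h1,
      by simpa only [L.inner_map_map] using h2⟩
  cover := by
    intro d hd
    obtain ⟨d, rfl⟩ := L.surjective d
    rw [L.inner_map_map]
    refine hK.cover d fun w hw => ?_
    rw [← L.inner_map_map]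
    exact hd _ ⟨w, hw, rfl⟩

/-- The vectors of `K` whose opposites are in `K` too. -/
def antipodalPart (K : Set E5) : Set E5 := {v | v ∈ K ∧ -v ∈ K}

theorem neg_mem_antipodalPart {K : Set E5} {v : E5} (hv : v ∈ antipodalPart K) :
    -v ∈ antipodalPart K := ⟨hv.2, by simpa using hv.1⟩

theorem antipodalPart_image (K : Set E5) (L : E5 ≃ₗᵢ[ℝ] E5) :
    antipodalPart (L '' K) = L '' antipodalPart K := by
  ext v
  obtain ⟨v, rfl⟩ := L.surjective v
  simp only [antipodalPart, Set.mem_ofPred_eq, ← map_neg, L.injective.mem_set_image]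

theorem norm_eq_sqrt_two {v : E5} : ‖v‖ = √2 ↔ ⟪v, v⟫ = 2 := by
  rw [real_inner_self_eq_norm_sq]
  exact ⟨fun h => by rw [h]; norm_num, fun h => by rw [← h, Real.sqrt_sq (norm_nonneg _)]⟩

theorem sqrt_two_le_norm {v : E5} : √2 ≤ ‖v‖ ↔ 2 ≤ ⟪v, v⟫ := by
  rw [real_inner_self_eq_norm_sq, Real.sqrt_le_left (norm_nonneg _)]

theorem eq_of_inner_eq_two {v w : E5} (hv : ⟪v, v⟫ = 2) (hw : ⟪w, w⟫ = 2) (h : ⟪w, v⟫ = 2) :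
    w = v := by
  rw [← sub_eq_zero, ← inner_self_eq_zero (𝕜 := ℝ)]
  simp only [inner_sub_left, inner_sub_right, real_inner_comm w v, hv, hw, h]
  norm_num

theorem eq_neg_of_inner_eq_neg_two {v w : E5} (hv : ⟪v, v⟫ = 2) (hw : ⟪w, w⟫ = 2)
    (h : ⟪w, v⟫ = -2) : w = -v :=
  eq_of_inner_eq_two (by simpa using hv) hw (by simp [h])

/-! ### Packings with a given kissing configuration -/

/-- A packing with kissing configuration `K`. -/
structure IsKissingPacking (P K : Set E5) : Prop where
  packing : IsSpherePacking P
  kissing : HasKissingConfig P K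

namespace IsKissingPacking

variable {P K : Set E5} {S : Set ℝ}

theorem image (hP : IsKissingPacking P K) (g : E5 ≃ᵢ E5) : IsKissingPacking (g '' P) K :=
  ⟨hP.packing.image g, hP.kissing.image g⟩

theorem data (hP : IsKissingPacking P K) (hK : KissingData K S) {x : E5} (hx : x ∈ P) :
    KissingData (kissingConfig P x) S := by
  obtain ⟨L, hL⟩ := hP.kissing.2 x hx
  rw [← hL]
  exact hK.image L

theorem ncard_kissingConfig (hP : IsKissingPacking P K) {x : E5} (hx : x ∈ P) :
    (kissingConfig P x).ncard = K.ncard := by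
  obtain ⟨L, hL⟩ := hP.kissing.2 x hx
  rw [← hL, Set.ncard_image_of_injective _ L.injective]

theorem kissingConfig_eq_of_subset (hP : IsKissingPacking P K) (hK : KissingData K S)
    {x : E5} (hx : x ∈ P) {T : Set E5} (hT : T.ncard = K.ncard) (h : T ⊆ kissingConfig P x) :
    kissingConfig P x = T :=
  (Set.eq_of_subset_of_ncard_le h (by rw [hT, hP.ncard_kissingConfig hx])
    (hP.data hK hx).finite).symm

/-- Connectedness of the contact graph. If `q` is a point of `X` nearest to a center `p`, no
neighbor `q + w` is nearer, which says `⟪p - q, w⟫ ≤ 1`. Then `cover` puts `p` at distance less than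
`√2` from `q`, and the packing condition gives `p = q`. The nearest point exists because a uniformly
separated set is closed. -/
theorem eq_of_subset_of_closed (hP : IsKissingPacking P K) (hK : KissingData K S) {X : Set E5}
    (hX : X ⊆ P) (hne : X.Nonempty) (h : ∀ x ∈ X, ∀ v ∈ kissingConfig P x, x + v ∈ X) :
    X = P := by
  refine hX.antisymm fun p hp => ?_
  have hclosed : IsClosed X :=
    Metric.isClosed_of_pairwise_le_dist (ε := √2) (by positivity) (hP.packing.mono hX)
  obtain ⟨q, hq, hpq⟩ := hclosed.exists_infDist_eq_dist hne p
  have hle : ∀ y ∈ X, dist p q ≤ dist p y := fun y hy => hpq ▸ Metric.infDist_le_dist_of_mem hy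
  have hd := (hP.data hK (hX hq)).cover (p - q) fun w hw => by
    have h1 := hle _ (h q hq w hw)
    rw [dist_eq_norm, dist_eq_norm] at h1
    have h2 : ‖p - q‖ ^ 2 ≤ ‖p - (q + w)‖ ^ 2 := by gcongr
    rw [← sub_sub, norm_sub_sq_real (p - q) w, ← real_inner_self_eq_norm_sq w,
      (hP.data hK (hX hq)).inner_self w hw] at h2
    linarith
  by_contra hpX
  have hne : p ≠ q := fun h => hpX (h ▸ hq)
  have : √2 ≤ dist p q := hP.packing hp (hX hq) hne
  rw [dist_eq_norm, sqrt_two_le_norm] at this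
  linarith

/-! ### Propagation along antipodal kissing vectors -/

theorem sub_mem_kissingConfig {x v w : E5} (hv : ‖v‖ = √2)
    (hw : w ∈ kissingConfig P x) (h : ⟪w, v⟫ = 1) :
    w - v ∈ kissingConfig P (x + v) := by
  refine ⟨by simpa using hw.1, ?_⟩
  rw [norm_eq_sqrt_two] at hv ⊢
  have h2 := norm_eq_sqrt_two.1 hw.2
  simp only [inner_sub_left, inner_sub_right, real_inner_comm w v, hv, h2, h]
  norm_num

theorem neg_mem_kissingConfig {x v : E5} (hx : x ∈ P) (hv : v ∈ kissingConfig P x) :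
    -v ∈ kissingConfig P (x + v) :=
  ⟨by simpa using hx, by simpa using hv.2⟩

/-- The map `w ↦ w - v` sends the vectors having product `1` with `v` to vectors at `x + v` having
product `1` with `-v`, and it keeps their mutual inner products. So the antipodality test passed by
`v` at `x` is passed by `-v` at `x + v`, which puts `v` there. The remaining vectors are transported
according to their product with `v`. -/
theorem kissingConfig_subset_of_antipodal (hP : IsKissingPacking P K) (hK : KissingData K S)
    {x v : E5} (hx : x ∈ P) (hv : v ∈ kissingConfig P x) (hv' : -v ∈ kissingConfig P x) :
    v ∈ kissingConfig P (x + v) ∧ kissingConfig P x ⊆ kissingConfig P (x + v) := by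
  have hy : x + v ∈ P := hv.1
  have dx := hP.data hK hx
  have dy := hP.data hK hy
  have hvv := dx.inner_self v hv
  have hneg : -v ∈ kissingConfig P (x + v) := neg_mem_kissingConfig hx hv
  have hpos : v ∈ kissingConfig P (x + v) := by
    have h := (dy.antipodal_iff _ hneg).1 ?_
    · rwa [neg_neg] at h
    intro r hr
    obtain ⟨a, ha, b, hb, h1, h2, h3⟩ := (dx.antipodal_iff v hv).2 hv' r hr
    refine ⟨_, sub_mem_kissingConfig hv.2 ha h1, _, sub_mem_kissingConfig hv.2 hb h2, ?_⟩
    have h2' := real_inner_comm b v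
    simp only [inner_sub_left, inner_sub_right, inner_neg_right, hvv, h1, h2, h3]
    rw [h2', h2]; norm_num
  have hone : ∀ w ∈ kissingConfig P x, ⟪w, v⟫ = 1 → w ∈ kissingConfig P (x + v) := by
    intro w hw h
    have := dy.add_mem _ (sub_mem_kissingConfig hv.2 hw h) v hpos
      (by rw [inner_sub_left, h, hvv]; norm_num)
    simpa using this
  have hnegone : ∀ w ∈ kissingConfig P x, ⟪w, v⟫ = -1 → w ∈ kissingConfig P (x + v) := by
    intro w hw h
    have := dx.add_mem w hw v hv h
    exact ⟨by rw [add_assoc, add_comm v w]; exact this.1, hw.2⟩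
  refine ⟨hpos, fun w hw => ?_⟩
  have hww := dx.inner_self w hw
  rcases dx.inner_mem v hv hv' w hw with h | h | h | h | h
  · rw [eq_neg_of_inner_eq_neg_two hvv hww h]; exact hneg
  · exact hnegone w hw h
  -- Here `w = (w + a) + (-a)`: both summands have product `±1` with `v`, hence are already
  -- transported, and their mutual product is `-1`.
  · obtain ⟨a, ha, ha', hav, hwa⟩ := dx.link v hv hv' w hw h
    have h1 := dx.add_mem w hw a ha hwa
    have haa := dx.inner_self a ha
    have h2 : w + a ∈ kissingConfig P (x + v) ∧ -a ∈ kissingConfig P (x + v) := by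
      rcases hav with hav | hav
      · exact ⟨hone _ h1 (by rw [inner_add_left, h, hav]; norm_num),
          hnegone _ ha' (by rw [inner_neg_left, hav])⟩
      · exact ⟨hnegone _ h1 (by rw [inner_add_left, h, hav]; norm_num),
          hone _ ha' (by rw [inner_neg_left, hav]; norm_num)⟩
    have := dy.add_mem _ h2.1 _ h2.2
      (by rw [inner_neg_right, inner_add_left, hwa, haa]; norm_num)
    simpa using this
  · exact hone w hw h
  · rw [eq_of_inner_eq_two hvv hww h]; exact hpos

theorem kissingConfig_add_of_antipodal (hP : IsKissingPacking P K) (hK : KissingData K S)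
    {x v : E5} (hx : x ∈ P) (hv : v ∈ antipodalPart (kissingConfig P x)) :
    kissingConfig P (x + v) = kissingConfig P x :=
  hP.kissingConfig_eq_of_subset hK hv.1.1 (hP.ncard_kissingConfig hx)
    (hP.kissingConfig_subset_of_antipodal hK hx hv.1 hv.2).2

/-- For `a` antipodal at `x`, the configuration at `x + a` is the one at `x` and so contains `v`.
Thus `x + a + v` is a center and `a` is a kissing vector at `x + v`. The same holds for `-a`, and
the cardinalities of the antipodal parts agree. -/
theorem antipodalPart_add (hP : IsKissingPacking P K) (hK : KissingData K S)
    {x v : E5} (hx : x ∈ P) (hv : v ∈ kissingConfig P x) :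
    antipodalPart (kissingConfig P (x + v)) = antipodalPart (kissingConfig P x) := by
  have hsub : antipodalPart (kissingConfig P x) ⊆ kissingConfig P (x + v) := by
    intro a ha
    have h1 : v ∈ kissingConfig P (x + a) := hP.kissingConfig_add_of_antipodal hK hx ha ▸ hv
    exact ⟨by rw [add_right_comm]; exact h1.1, ha.1.2⟩
  have hsub' : antipodalPart (kissingConfig P x) ⊆ antipodalPart (kissingConfig P (x + v)) :=
    fun a ha => ⟨hsub ha, hsub (neg_mem_antipodalPart ha)⟩
  have hcard : ∀ y ∈ P, (antipodalPart (kissingConfig P y)).ncard = (antipodalPart K).ncard := by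
    intro y hy
    obtain ⟨L, hL⟩ := hP.kissing.2 y hy
    rw [← hL, antipodalPart_image, Set.ncard_image_of_injective _ L.injective]
  exact (Set.eq_of_subset_of_ncard_le hsub' (by rw [hcard _ hx, hcard _ hv.1])
    ((hP.data hK hv.1).finite.subset fun a ha => ha.1)).symm

theorem antipodalPart_const (hP : IsKissingPacking P K) (hK : KissingData K S)
    {x y : E5} (hx : x ∈ P) (hy : y ∈ P) :
    antipodalPart (kissingConfig P y) = antipodalPart (kissingConfig P x) := by
  have := hP.eq_of_subset_of_closed hK
    (X := {y | y ∈ P ∧ antipodalPart (kissingConfig P y) = antipodalPart (kissingConfig P x)})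
    (fun _ h => h.1) ⟨x, hx, rfl⟩
    fun z hz v hv => ⟨hv.1, (hP.antipodalPart_add hK hz.1 hv).trans hz.2⟩
  rw [← this] at hy
  exact hy.2

/-! ### Translations of a packing -/

theorem mem_translationLattice_iff {P : Set E5} {y : E5} :
    y ∈ translationLattice P ↔ y +ᵥ P = P := Iff.rfl

theorem add_mem_of_mem_translationLattice {x y : E5} (hy : y ∈ translationLattice P)
    (hx : x ∈ P) : x + y ∈ P := by
  rw [mem_translationLattice_iff] at hy
  rw [← hy, add_comm]
  exact Set.vadd_mem_vadd_set hx

theorem mem_translationLattice_of_forall {y : E5} (h1 : ∀ x ∈ P, x + y ∈ P)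
    (h2 : ∀ x ∈ P, x - y ∈ P) : y ∈ translationLattice P := by
  rw [mem_translationLattice_iff]
  refine Set.Subset.antisymm ?_ fun x hx => ⟨x - y, h2 x hx, by simp⟩
  rintro _ ⟨x, hx, rfl⟩
  simpa [add_comm] using h1 x hx

theorem antipodal_mem_translationLattice (hP : IsKissingPacking P K) (hK : KissingData K S)
    {x a : E5} (hx : x ∈ P) (ha : a ∈ antipodalPart (kissingConfig P x)) :
    a ∈ translationLattice P := by
  refine mem_translationLattice_of_forall (fun y hy => ?_) fun y hy => ?_
  · rw [← hP.antipodalPart_const hK hx hy] at ha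
    exact ha.1.1
  · rw [← hP.antipodalPart_const hK hx hy] at ha
    rw [sub_eq_add_neg]
    exact ha.2.1

/-- A packing whose kissing configuration at a point determines the kissing configurations at the
neighboring points is determined by one of its kissing configurations. -/
theorem eq_of_propagate {P' : Set E5} (hP : IsKissingPacking P K) (hP' : IsKissingPacking P' K)
    (hK : KissingData K S) {o : E5} (ho : o ∈ P) (ho' : o ∈ P')
    (h0 : kissingConfig P o = kissingConfig P' o)
    (h : ∀ x, x ∈ P → x ∈ P' → kissingConfig P x = kissingConfig P' x →
      ∀ v ∈ kissingConfig P x, kissingConfig P (x + v) = kissingConfig P' (x + v)) :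
    P = P' := by
  let X : Set E5 := {x | x ∈ P ∧ x ∈ P' ∧ kissingConfig P x = kissingConfig P' x}
  have h1 : X = P := hP.eq_of_subset_of_closed hK (fun _ h => h.1) ⟨o, ho, ho', h0⟩
    fun x hx v hv => ⟨hv.1, (hx.2.2 ▸ hv : v ∈ kissingConfig P' x).1, h x hx.1 hx.2.1 hx.2.2 v hv⟩
  have h2 : X = P' := hP'.eq_of_subset_of_closed hK (fun _ h => h.2.1) ⟨o, ho, ho', h0⟩
    fun x hx v hv => by
      rw [← hx.2.2] at hv
      exact ⟨hv.1, (hx.2.2 ▸ hv : v ∈ kissingConfig P' x).1, h x hx.1 hx.2.1 hx.2.2 v hv⟩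
  exact h1.symm.trans h2

/-- Every packing with kissing configuration `K` can be moved so that its kissing configuration
at the origin is `K`. -/
theorem exists_normalized (hP : IsKissingPacking P K) {x : E5} (hx : x ∈ P) :
    ∃ g : E5 ≃ᵢ E5, g x = 0 ∧ 0 ∈ g '' P ∧ kissingConfig (g '' P) 0 = K := by
  obtain ⟨L, hL⟩ := hP.kissing.2 x hx
  have h0 : moveIsometry L.symm x 0 x = 0 := by simp [moveIsometry_apply]
  refine ⟨moveIsometry L.symm x 0, h0, ⟨x, hx, h0⟩, ?_⟩
  have := kissingConfig_image (moveIsometry L.symm x 0) P x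
  rw [h0] at this
  rw [this, ← hL, Set.image_image]
  simp [linPart_moveIsometry]

/-- `Φ` speaks only about the origin; it is transported to `x` by the isometry that takes `x` to `0`
and its configuration to `K`. Both packings have the same configuration at `x`, so one `L`
normalizes both and the rule returns the same answer at `x + v`. -/
theorem eq_of_local_rule (hK : KissingData K S) {Φ : E5 → Set E5}
    (hΦ : ∀ P, IsKissingPacking P K → 0 ∈ P → kissingConfig P 0 = K →
      ∀ r ∈ K, kissingConfig P r = Φ r)
    {P' : Set E5} (hP : IsKissingPacking P K) (hP' : IsKissingPacking P' K)
    (ho : 0 ∈ P) (ho' : 0 ∈ P') (h0 : kissingConfig P 0 = K) (h0' : kissingConfig P' 0 = K) :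
    P = P' := by
  refine hP.eq_of_propagate hP' hK ho ho' (h0.trans h0'.symm) fun x hx hx' hxx v hv => ?_
  obtain ⟨L, hL⟩ := hP.kissing.2 x hx
  have hgx : moveIsometry L.symm x 0 x = 0 := by simp [moveIsometry_apply]
  have hmain : ∀ R : Set E5, IsKissingPacking R K → x ∈ R → L '' K = kissingConfig R x →
      linPart (moveIsometry L.symm x 0) '' kissingConfig R (x + v) = Φ (L.symm v) := by
    intro R hR hxR hLR
    have hv' : v ∈ L '' K := hL ▸ hv
    obtain ⟨r, hr, rfl⟩ := hv'
    have h1 := kissingConfig_image (moveIsometry L.symm x 0) R (x + L r)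
    have h2 : moveIsometry L.symm x 0 (x + L r) = r := by simp [moveIsometry_apply]
    rw [← h1, h2, L.symm_apply_apply]
    refine hΦ _ (hR.image _) ⟨x, hxR, hgx⟩ ?_ r hr
    have := kissingConfig_image (moveIsometry L.symm x 0) R x
    rw [hgx] at this
    rw [this, ← hLR, Set.image_image]
    simp [linPart_moveIsometry]
  have := (hmain P hP hx hL).trans (hmain P' hP' hx' (hL.trans hxx)).symm
  exact (linPart _).injective.image_injective this

/-- When kissing configurations propagate by a fixed rule, the packings with kissing
configuration `K` are all isometric. -/
theorem exists_isometry_of_local_rule (hK : KissingData K S) {Φ : E5 → Set E5}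
    (hΦ : ∀ P, IsKissingPacking P K → 0 ∈ P → kissingConfig P 0 = K →
      ∀ r ∈ K, kissingConfig P r = Φ r)
    {P' : Set E5} (hP : IsKissingPacking P K) (hP' : IsKissingPacking P' K) :
    ∃ g : E5 ≃ᵢ E5, g '' P = P' := by
  obtain ⟨x, hx⟩ := hP.kissing.1
  obtain ⟨y, hy⟩ := hP'.kissing.1
  obtain ⟨g, -, hg, hgK⟩ := hP.exists_normalized hx
  obtain ⟨f, -, hf, hfK⟩ := hP'.exists_normalized hy
  have := eq_of_local_rule hK hΦ (hP.image g) (hP'.image f) hg hf hgK hfK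
  refine ⟨g.trans f.symm, ?_⟩
  have h1 : (g.trans f.symm) '' P = f.symm '' (g '' P) := by rw [Set.image_image]; rfl
  rw [h1, this, Set.image_image]
  simp

end IsKissingPacking

/-! ### Vectors with coordinates in `ℤ / 10` -/

/-- Five integers, standing for the vector with a tenth of them as coordinates. -/
abbrev IVec := ℤ × ℤ × ℤ × ℤ × ℤ

/-- The dot product of two integer vectors. -/
def idot (p q : IVec) : ℤ :=
  p.1 * q.1 + p.2.1 * q.2.1 + p.2.2.1 * q.2.2.1 + p.2.2.2.1 * q.2.2.2.1 + p.2.2.2.2 * q.2.2.2.2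

theorem idot_self_nonneg (p : IVec) : 0 ≤ idot p p := by
  have h0 := mul_self_nonneg p.1
  have h1 := mul_self_nonneg p.2.1
  have h2 := mul_self_nonneg p.2.2.1
  have h3 := mul_self_nonneg p.2.2.2.1
  have h4 := mul_self_nonneg p.2.2.2.2
  unfold idot
  linarith

/-- The coordinate sum of an integer vector. -/
def isum (p : IVec) : ℤ := p.1 + p.2.1 + p.2.2.1 + p.2.2.2.1 + p.2.2.2.2

/-- The vector whose coordinates are a tenth of given integers. -/
noncomputable def toE (p : IVec) : E5 :=
  !₂[(p.1 : ℝ) / 10, (p.2.1 : ℝ) / 10, (p.2.2.1 : ℝ) / 10, (p.2.2.2.1 : ℝ) / 10,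
    (p.2.2.2.2 : ℝ) / 10]

theorem inner_eq (x y : E5) :
    ⟪x, y⟫ = x 0 * y 0 + x 1 * y 1 + x 2 * y 2 + x 3 * y 3 + x 4 * y 4 := by
  simp only [PiLp.inner_apply, Fin.sum_univ_five]
  simp [mul_comm]

theorem ext_five {x y : E5} (h0 : x 0 = y 0) (h1 : x 1 = y 1) (h2 : x 2 = y 2) (h3 : x 3 = y 3)
    (h4 : x 4 = y 4) : x = y := by
  ext i
  fin_cases i <;> assumption

@[simp] theorem toE_zero_coord (p : IVec) : toE p 0 = (p.1 : ℝ) / (10 : ℝ) := rfl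
@[simp] theorem toE_one_coord (p : IVec) : toE p 1 = (p.2.1 : ℝ) / (10 : ℝ) := rfl
@[simp] theorem toE_two_coord (p : IVec) : toE p 2 = (p.2.2.1 : ℝ) / (10 : ℝ) := rfl
@[simp] theorem toE_three_coord (p : IVec) : toE p 3 = (p.2.2.2.1 : ℝ) / (10 : ℝ) := rfl
@[simp] theorem toE_four_coord (p : IVec) : toE p 4 = (p.2.2.2.2 : ℝ) / (10 : ℝ) := rfl

theorem inner_toE (p q : IVec) : ⟪toE p, toE q⟫ = (idot p q : ℝ) / 100 := by
  rw [inner_eq]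
  simp [idot]
  ring

theorem inner_toE_eq_iff {p q : IVec} {n : ℤ} : ⟪toE p, toE q⟫ = (n : ℝ) / 100 ↔ idot p q = n := by
  rw [inner_toE, div_left_inj' (by norm_num)]
  norm_cast

theorem toE_add (p q : IVec) : toE (p + q) = toE p + toE q := by
  apply ext_five <;> simp <;> ring

theorem toE_neg (p : IVec) : toE (-p) = -toE p := by
  apply ext_five <;> simp <;> ring

theorem toE_sub (p q : IVec) : toE (p - q) = toE p - toE q := by
  rw [sub_eq_add_neg, toE_add, toE_neg, sub_eq_add_neg]

theorem toE_zero : toE 0 = 0 := by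
  apply ext_five <;> simp

theorem toE_injective : Function.Injective toE := by
  intro p q h
  have h0 := congrArg (fun v : E5 => v 0) h
  have h1 := congrArg (fun v : E5 => v 1) h
  have h2 := congrArg (fun v : E5 => v 2) h
  have h3 := congrArg (fun v : E5 => v 3) h
  have h4 := congrArg (fun v : E5 => v 4) h
  simp only [toE_zero_coord, toE_one_coord, toE_two_coord, toE_three_coord, toE_four_coord,
    div_left_inj' (by norm_num : (10 : ℝ) ≠ 0), Int.cast_inj] at h0 h1 h2 h3 h4
  simp only [Prod.ext_iff]
  exact ⟨h0, h1, h2, h3, h4⟩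

/-- The set of vectors given by a list of integer vectors. -/
def realize (l : List IVec) : Set E5 := toE '' {p | p ∈ l}

theorem toE_mem_realize {l : List IVec} {p : IVec} : toE p ∈ realize l ↔ p ∈ l :=
  toE_injective.mem_set_image

theorem finite_realize (l : List IVec) : (realize l).Finite := l.finite_toSet.image _

/-- Inner products are hundredths of integers, so every clause except `cover` becomes a finite check
on lists. -/
theorem kissingData_realize {l : List IVec} {S : List ℤ}
    (hself : ∀ v ∈ l, idot v v = 200)
    (hadd : ∀ v ∈ l, ∀ w ∈ l, idot v w = -100 → v + w ∈ l)
    (hanti : ∀ v ∈ l,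
      (∀ r ∈ S, ∃ a ∈ l, idot a v = 100 ∧ ∃ b ∈ l, idot b v = 100 ∧ idot a b = r) ↔ -v ∈ l)
    (hmem : ∀ v ∈ l, -v ∈ l → ∀ w ∈ l, 100 ∣ idot w v)
    (hlink : ∀ v ∈ l, -v ∈ l → ∀ w ∈ l, idot w v = 0 →
      ∃ a ∈ l, idot w a = -100 ∧ (idot a v = 100 ∨ idot a v = -100) ∧ -a ∈ l)
    (hcover : ∀ d : E5, (∀ w ∈ realize l, ⟪d, w⟫ ≤ 1) → ⟪d, d⟫ < 2) :
    KissingData (realize l) ((fun n : ℤ => (n : ℝ) / 100) '' {n | n ∈ S}) := by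
  have e1 : (1 : ℝ) = ((100 : ℤ) : ℝ) / 100 := by norm_num
  have em1 : (-1 : ℝ) = ((-100 : ℤ) : ℝ) / 100 := by norm_num
  have e0 : (0 : ℝ) = ((0 : ℤ) : ℝ) / 100 := by norm_num
  have e2 : (2 : ℝ) = ((200 : ℤ) : ℝ) / 100 := by norm_num
  have em2 : (-2 : ℝ) = ((-200 : ℤ) : ℝ) / 100 := by norm_num
  refine ⟨finite_realize l, ?_, ?_, ?_, ?_, ?_, hcover⟩
  · rintro _ ⟨v, hv, rfl⟩
    rw [e2, inner_toE_eq_iff]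
    exact hself v hv
  · rintro _ ⟨v, hv, rfl⟩ _ ⟨w, hw, rfl⟩ h
    rw [em1, inner_toE_eq_iff] at h
    exact ⟨v + w, hadd v hv w hw h, toE_add v w⟩
  · rintro _ ⟨v, hv, rfl⟩
    rw [← toE_neg, toE_mem_realize, ← hanti v hv]
    simp only [realize, Set.forall_mem_image, Set.exists_mem_image, e1, inner_toE_eq_iff,
      Set.mem_ofPred_eq]
    refine forall₂_congr fun r _ => exists_congr fun a => and_congr_right fun _ => ?_
    exact ⟨fun ⟨b, h1, h2, h3, h4⟩ => ⟨h2, b, h1, h3, h4⟩,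
      fun ⟨h2, b, h1, h3, h4⟩ => ⟨b, h1, h2, h3, h4⟩⟩
  · rintro _ ⟨v, hv, rfl⟩ h _ ⟨w, hw, rfl⟩
    rw [← toE_neg, toE_mem_realize] at h
    obtain ⟨n, hn⟩ := hmem v hv h w hw
    have hv2 := hself v hv
    have hw2 := hself w hw
    -- Cauchy–Schwarz in the form `|w ± v|² ≥ 0` confines `idot w v` to `[-200, 200]`; divisibility
    -- by `100` then leaves five values.
    have h1 : 0 ≤ idot (w + v) (w + v) := idot_self_nonneg _
    have h2 : 0 ≤ idot (w - v) (w - v) := idot_self_nonneg _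
    have h3 : idot (w + v) (w + v) = idot w w + 2 * idot w v + idot v v := by
      simp only [idot, Prod.fst_add, Prod.snd_add]; ring
    have h4 : idot (w - v) (w - v) = idot w w - 2 * idot w v + idot v v := by
      simp only [idot, Prod.fst_sub, Prod.snd_sub]; ring
    rw [em2, em1, e0, e1, e2]
    simp only [inner_toE_eq_iff]
    omega
  · rintro _ ⟨v, hv, rfl⟩ h _ ⟨w, hw, rfl⟩ h0
    rw [← toE_neg, toE_mem_realize] at h
    rw [e0, inner_toE_eq_iff] at h0
    obtain ⟨a, ha, h1, h2, h3⟩ := hlink v hv h w hw h0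
    refine ⟨toE a, ⟨a, ha, rfl⟩, ⟨-a, h3, toE_neg a⟩, ?_, ?_⟩
    · rw [em1, e1, inner_toE_eq_iff, inner_toE_eq_iff]
      exact h2
    · rw [em1, inner_toE_eq_iff]
      exact h1

/-! ### The four kissing configurations as lists -/

/-- The points of `kissD5`, computed from its definition. -/
def calcD5 : List IVec :=
  let c : List ℤ := [-10, 0, 10]
  (c.flatMap fun x => c.flatMap fun y => c.flatMap fun z => c.flatMap fun t =>
    c.map fun u => (x, y, z, t, u)).filter fun p => idot p p = 200

/-- The reflection across the hyperplane of vectors with coordinate sum `0`. -/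
def ireflect (p : IVec) : IVec :=
  let c := 2 * isum p / 5
  (p.1 - c, p.2.1 - c, p.2.2.1 - c, p.2.2.2.1 - c, p.2.2.2.2 - c)

/-- The points of `kissL5`, computed from its definition. -/
def calcL5 : List IVec :=
  let c : List ℤ := [-5, 5]
  (calcD5.filter fun p => p.2.2.2.2 ≠ 10) ++
  (c.flatMap fun x => c.flatMap fun y => c.flatMap fun z =>
    c.map fun t => (x, y, z, t, 10)).filter fun p => p.1 * p.2.1 * p.2.2.1 * p.2.2.2.1 < 0

/-- The construction `replaceLayer` for lists. -/
def ireplace (l : List IVec) : List IVec :=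
  (l.filter fun p => isum p ≠ 20) ++ (l.filter fun p => isum p = -20).map ireflect

/-- The points of `kissQ5`, computed from its definition. -/
def calcQ5 : List IVec := ireplace calcD5

/-- The points of `kissR5`, computed from its definition. -/
def calcR5 : List IVec := ireplace calcL5

/-- The points of `kissD5`. -/
def intD5 : List IVec :=
  [(-10, -10, 0, 0, 0), (-10, 0, -10, 0, 0), (-10, 0, 0, -10, 0), (-10, 0, 0, 0, -10),
   (-10, 0, 0, 0, 10), (-10, 0, 0, 10, 0), (-10, 0, 10, 0, 0), (-10, 10, 0, 0, 0),
   (0, -10, -10, 0, 0), (0, -10, 0, -10, 0), (0, -10, 0, 0, -10), (0, -10, 0, 0, 10),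
   (0, -10, 0, 10, 0), (0, -10, 10, 0, 0), (0, 0, -10, -10, 0), (0, 0, -10, 0, -10),
   (0, 0, -10, 0, 10), (0, 0, -10, 10, 0), (0, 0, 0, -10, -10), (0, 0, 0, -10, 10),
   (0, 0, 0, 10, -10), (0, 0, 0, 10, 10), (0, 0, 10, -10, 0), (0, 0, 10, 0, -10),
   (0, 0, 10, 0, 10), (0, 0, 10, 10, 0), (0, 10, -10, 0, 0), (0, 10, 0, -10, 0),
   (0, 10, 0, 0, -10), (0, 10, 0, 0, 10), (0, 10, 0, 10, 0), (0, 10, 10, 0, 0),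
   (10, -10, 0, 0, 0), (10, 0, -10, 0, 0), (10, 0, 0, -10, 0), (10, 0, 0, 0, -10),
   (10, 0, 0, 0, 10), (10, 0, 0, 10, 0), (10, 0, 10, 0, 0), (10, 10, 0, 0, 0)]

/-- The points of `kissL5`. -/
def intL5 : List IVec :=
  [(-10, -10, 0, 0, 0), (-10, 0, -10, 0, 0), (-10, 0, 0, -10, 0), (-10, 0, 0, 0, -10),
   (-10, 0, 0, 10, 0), (-10, 0, 10, 0, 0), (-10, 10, 0, 0, 0), (0, -10, -10, 0, 0),
   (0, -10, 0, -10, 0), (0, -10, 0, 0, -10), (0, -10, 0, 10, 0), (0, -10, 10, 0, 0),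
   (0, 0, -10, -10, 0), (0, 0, -10, 0, -10), (0, 0, -10, 10, 0), (0, 0, 0, -10, -10),
   (0, 0, 0, 10, -10), (0, 0, 10, -10, 0), (0, 0, 10, 0, -10), (0, 0, 10, 10, 0),
   (0, 10, -10, 0, 0), (0, 10, 0, -10, 0), (0, 10, 0, 0, -10), (0, 10, 0, 10, 0),
   (0, 10, 10, 0, 0), (10, -10, 0, 0, 0), (10, 0, -10, 0, 0), (10, 0, 0, -10, 0),
   (10, 0, 0, 0, -10), (10, 0, 0, 10, 0), (10, 0, 10, 0, 0), (10, 10, 0, 0, 0),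
   (-5, -5, -5, 5, 10), (-5, -5, 5, -5, 10), (-5, 5, -5, -5, 10), (-5, 5, 5, 5, 10),
   (5, -5, -5, -5, 10), (5, -5, 5, 5, 10), (5, 5, -5, 5, 10), (5, 5, 5, -5, 10)]

/-- The points of `kissQ5`. -/
def intQ5 : List IVec :=
  [(-10, -10, 0, 0, 0), (-10, 0, -10, 0, 0), (-10, 0, 0, -10, 0), (-10, 0, 0, 0, -10),
   (-10, 0, 0, 0, 10), (-10, 0, 0, 10, 0), (-10, 0, 10, 0, 0), (-10, 10, 0, 0, 0),
   (0, -10, -10, 0, 0), (0, -10, 0, -10, 0), (0, -10, 0, 0, -10), (0, -10, 0, 0, 10),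
   (0, -10, 0, 10, 0), (0, -10, 10, 0, 0), (0, 0, -10, -10, 0), (0, 0, -10, 0, -10),
   (0, 0, -10, 0, 10), (0, 0, -10, 10, 0), (0, 0, 0, -10, -10), (0, 0, 0, -10, 10),
   (0, 0, 0, 10, -10), (0, 0, 10, -10, 0), (0, 0, 10, 0, -10), (0, 10, -10, 0, 0),
   (0, 10, 0, -10, 0), (0, 10, 0, 0, -10), (10, -10, 0, 0, 0), (10, 0, -10, 0, 0),
   (10, 0, 0, -10, 0), (10, 0, 0, 0, -10), (-2, -2, 8, 8, 8), (-2, 8, -2, 8, 8),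
   (-2, 8, 8, -2, 8), (-2, 8, 8, 8, -2), (8, -2, -2, 8, 8), (8, -2, 8, -2, 8), (8, -2, 8, 8, -2),
   (8, 8, -2, -2, 8), (8, 8, -2, 8, -2), (8, 8, 8, -2, -2)]

/-- The points of `kissR5`. -/
def intR5 : List IVec :=
  [(-10, -10, 0, 0, 0), (-10, 0, -10, 0, 0), (-10, 0, 0, -10, 0), (-10, 0, 0, 0, -10),
   (-10, 0, 0, 10, 0), (-10, 0, 10, 0, 0), (-10, 10, 0, 0, 0), (0, -10, -10, 0, 0),
   (0, -10, 0, -10, 0), (0, -10, 0, 0, -10), (0, -10, 0, 10, 0), (0, -10, 10, 0, 0),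
   (0, 0, -10, -10, 0), (0, 0, -10, 0, -10), (0, 0, -10, 10, 0), (0, 0, 0, -10, -10),
   (0, 0, 0, 10, -10), (0, 0, 10, -10, 0), (0, 0, 10, 0, -10), (0, 10, -10, 0, 0),
   (0, 10, 0, -10, 0), (0, 10, 0, 0, -10), (10, -10, 0, 0, 0), (10, 0, -10, 0, 0),
   (10, 0, 0, -10, 0), (10, 0, 0, 0, -10), (-5, -5, -5, 5, 10), (-5, -5, 5, -5, 10),
   (-5, 5, -5, -5, 10), (5, -5, -5, -5, 10), (-2, -2, 8, 8, 8), (-2, 8, -2, 8, 8),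
   (-2, 8, 8, -2, 8), (-2, 8, 8, 8, -2), (8, -2, -2, 8, 8), (8, -2, 8, -2, 8), (8, -2, 8, 8, -2),
   (8, 8, -2, -2, 8), (8, 8, -2, 8, -2), (8, 8, 8, -2, -2)]

theorem calcD5_eq : calcD5 = intD5 := by decide +kernel

theorem calcL5_eq : calcL5 = intL5 := by decide +kernel

theorem calcQ5_eq : calcQ5 = intQ5 := by decide +kernel

theorem calcR5_eq : calcR5 = intR5 := by decide +kernel

theorem sum_five (v : E5) : ∑ i, v i = v 0 + v 1 + v 2 + v 3 + v 4 := Fin.sum_univ_five _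

theorem sum_toE (p : IVec) : ∑ i, toE p i = (isum p : ℝ) / 10 := by
  rw [sum_five]
  simp [isum]
  ring

theorem mem_calcD5 {p : IVec} : p ∈ calcD5 ↔
    ((p.1 = -10 ∨ p.1 = 0 ∨ p.1 = 10) ∧ (p.2.1 = -10 ∨ p.2.1 = 0 ∨ p.2.1 = 10) ∧
      (p.2.2.1 = -10 ∨ p.2.2.1 = 0 ∨ p.2.2.1 = 10) ∧
      (p.2.2.2.1 = -10 ∨ p.2.2.2.1 = 0 ∨ p.2.2.2.1 = 10) ∧
      (p.2.2.2.2 = -10 ∨ p.2.2.2.2 = 0 ∨ p.2.2.2.2 = 10)) ∧ idot p p = 200 := by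
  obtain ⟨x, y, z, t, u⟩ := p
  simp only [calcD5, List.mem_filter, List.mem_flatMap, List.mem_map, decide_eq_true_eq,
    Prod.mk.injEq, List.mem_cons, List.not_mem_nil, or_false]
  refine and_congr_left fun _ => ⟨?_, ?_⟩
  · rintro ⟨x, hx, y, hy, z, hz, t, ht, u, hu, rfl, rfl, rfl, rfl, rfl⟩
    exact ⟨hx, hy, hz, ht, hu⟩
  · rintro ⟨hx, hy, hz, ht, hu⟩
    exact ⟨x, hx, y, hy, z, hz, t, ht, u, hu, rfl, rfl, rfl, rfl, rfl⟩

theorem kissD5_eq : kissD5 = realize intD5 := by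
  rw [← calcD5_eq]
  ext v
  constructor
  · rintro ⟨hv, hsum⟩
    have : ∀ i, ∃ n : ℤ, v i = n ∧ (n = -1 ∨ n = 0 ∨ n = 1) := by
      intro i
      rcases hv i with h | h | h
      · exact ⟨-1, by simp [h], by simp⟩
      · exact ⟨0, by simp [h], by simp⟩
      · exact ⟨1, by simp [h], by simp⟩
    choose n hn hn' using this
    refine ⟨(10 * n 0, 10 * n 1, 10 * n 2, 10 * n 3, 10 * n 4), ?_, ?_⟩
    · simp only [Set.mem_ofPred_eq, mem_calcD5]
      refine ⟨⟨by grind, by grind, by grind, by grind, by grind⟩, ?_⟩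
      simp only [Fin.sum_univ_five, hn] at hsum
      norm_cast at hsum
      simp only [idot]
      linarith
    · apply ext_five <;> simp [hn]
  · rintro ⟨p, hp, rfl⟩
    simp only [Set.mem_ofPred_eq, mem_calcD5] at hp
    obtain ⟨⟨h0, h1, h2, h3, h4⟩, h⟩ := hp
    have key : ∀ n : ℤ, (n = -10 ∨ n = 0 ∨ n = 10) →
        (n : ℝ) / 10 = -1 ∨ (n : ℝ) / 10 = 0 ∨ (n : ℝ) / 10 = 1 := by
      rintro n (rfl | rfl | rfl) <;> norm_num
    refine ⟨fun i => ?_, ?_⟩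
    · fin_cases i
      exacts [key _ h0, key _ h1, key _ h2, key _ h3, key _ h4]
    · have h' : (idot p p : ℝ) = 200 := by exact_mod_cast h
      simp only [Fin.sum_univ_five, toE_zero_coord, toE_one_coord, toE_two_coord, toE_three_coord,
        toE_four_coord]
      simp only [idot] at h'
      push_cast at h'
      linarith

theorem mem_calcL5 {p : IVec} : p ∈ calcL5 ↔ (p ∈ calcD5 ∧ p.2.2.2.2 ≠ 10) ∨
    (p.2.2.2.2 = 10 ∧ ((p.1 = -5 ∨ p.1 = 5) ∧ (p.2.1 = -5 ∨ p.2.1 = 5) ∧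
      (p.2.2.1 = -5 ∨ p.2.2.1 = 5) ∧ (p.2.2.2.1 = -5 ∨ p.2.2.2.1 = 5)) ∧
      p.1 * p.2.1 * p.2.2.1 * p.2.2.2.1 < 0) := by
  obtain ⟨x, y, z, t, u⟩ := p
  simp only [calcL5, List.mem_append, List.mem_filter, List.mem_flatMap, List.mem_map,
    decide_eq_true_eq, Prod.mk.injEq, List.mem_cons, List.not_mem_nil, or_false]
  refine or_congr_right ⟨?_, ?_⟩
  · rintro ⟨⟨x, hx, y, hy, z, hz, t, ht, rfl, rfl, rfl, rfl, rfl⟩, h⟩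
    exact ⟨rfl, ⟨hx, hy, hz, ht⟩, h⟩
  · rintro ⟨rfl, ⟨hx, hy, hz, ht⟩, h⟩
    exact ⟨⟨x, hx, y, hy, z, hz, t, ht, rfl, rfl, rfl, rfl, rfl⟩, h⟩

theorem kissL5_eq : kissL5 = realize intL5 := by
  rw [← calcL5_eq]
  ext v
  have hfour : ∀ p : IVec, (toE p 4 : ℝ) = (1 : ℝ) ↔ p.2.2.2.2 = 10 := by
    intro p
    have h10 : ((p.2.2.2.2 : ℤ) : ℝ) = (10 : ℝ) ↔ p.2.2.2.2 = 10 := by norm_cast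
    rw [← h10]
    change (p.2.2.2.2 : ℝ) / 10 = 1 ↔ _
    constructor <;> intro h <;> linarith
  constructor
  · rintro (⟨hv, hv4⟩ | ⟨hv4, hv, hprod⟩)
    · rw [kissD5_eq, ← calcD5_eq] at hv
      obtain ⟨p, hp, rfl⟩ := hv
      rw [Ne, hfour] at hv4
      exact ⟨p, mem_calcL5.2 (Or.inl ⟨hp, hv4⟩), rfl⟩
    · have : ∀ i : Fin 4, ∃ n : ℤ, v i.castSucc = n / 10 ∧ (n = -5 ∨ n = 5) := by
        intro i
        rcases hv i with h | h
        · exact ⟨5, by rw [h]; norm_num, by simp⟩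
        · exact ⟨-5, by rw [h]; norm_num, by simp⟩
      choose n hn hn' using this
      refine ⟨(n 0, n 1, n 2, n 3, 10), ?_, ?_⟩
      · refine mem_calcL5.2 (Or.inr ⟨rfl, ⟨hn' 0, hn' 1, hn' 2, hn' 3⟩, ?_⟩)
        simp only [Fin.prod_univ_four, hn] at hprod
        have : ((n 0 * n 1 * n 2 * n 3 : ℤ) : ℝ) < 0 := by push_cast; linarith
        exact_mod_cast this
      · apply ext_five
        exacts [(hn 0).symm, (hn 1).symm, (hn 2).symm, (hn 3).symm, by simp [hv4]]
  · rintro ⟨p, hp, rfl⟩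
    rcases mem_calcL5.1 hp with ⟨h1, h2⟩ | ⟨h4, ⟨h0, h1, h2, h3⟩, h⟩
    · refine Or.inl ⟨?_, (hfour p).not.2 h2⟩
      rw [kissD5_eq, ← calcD5_eq]
      exact ⟨p, h1, rfl⟩
    · have key : ∀ n : ℤ, (n = -5 ∨ n = 5) → (n : ℝ) / 10 = 1 / 2 ∨ (n : ℝ) / 10 = -(1 / 2) := by
        rintro n (rfl | rfl) <;> norm_num
      refine Or.inr ⟨(hfour p).2 h4, fun i => ?_, ?_⟩
      · fin_cases i
        exacts [key _ h0, key _ h1, key _ h2, key _ h3]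
      · have h' : ((p.1 * p.2.1 * p.2.2.1 * p.2.2.2.1 : ℤ) : ℝ) < 0 := by exact_mod_cast h
        rw [Fin.prod_univ_four]
        change (p.1 : ℝ) / 10 * (p.2.1 / 10) * (p.2.2.1 / 10) * (p.2.2.2.1 / 10) < 0
        push_cast at h'
        linarith

/-- `ireflect` uses integer division, which is exact when `5` divides the sum. -/
theorem reflectSum_toE {p : IVec} (h : 5 ∣ isum p) : reflectSum (toE p) = toE (ireflect p) := by
  obtain ⟨c, hc⟩ := h
  have h1 : 2 * isum p / 5 = 2 * c := by omega
  apply ext_five <;>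
  · simp only [reflectSum, sum_toE, ireflect, h1, toE_zero_coord, toE_one_coord, toE_two_coord,
      toE_three_coord, toE_four_coord]
    rw [hc]
    push_cast
    ring

theorem replaceLayer_realize (l : List IVec) : replaceLayer (realize l) = realize (ireplace l) := by
  have hs2 : ∀ p : IVec, ∑ i, toE p i = 2 ↔ isum p = 20 := by
    intro p
    rw [sum_toE, div_eq_iff (by norm_num)]
    norm_num
    constructor <;> intro h <;> exact_mod_cast h
  have hsm2 : ∀ p : IVec, ∑ i, toE p i = -2 ↔ isum p = -20 := by
    intro p
    rw [sum_toE, div_eq_iff (by norm_num)]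
    norm_num
    constructor <;> intro h <;> exact_mod_cast h
  ext v
  simp only [replaceLayer, realize, ireplace, List.mem_append, List.mem_filter, List.mem_map,
    decide_eq_true_eq]
  constructor
  · rintro (⟨⟨p, hp, rfl⟩, h⟩ | ⟨_, ⟨⟨p, hp, rfl⟩, h⟩, rfl⟩)
    · exact ⟨p, Or.inl ⟨hp, (hs2 p).not.1 h⟩, rfl⟩
    · rw [hsm2] at h
      exact ⟨ireflect p, Or.inr ⟨p, ⟨hp, h⟩, rfl⟩, (reflectSum_toE (by rw [h]; norm_num)).symm⟩
  · rintro ⟨p, ⟨hp, h⟩ | ⟨q, ⟨hq, h⟩, rfl⟩, rfl⟩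
    · exact Or.inl ⟨⟨p, hp, rfl⟩, (hs2 p).not.2 h⟩
    · exact Or.inr ⟨toE q, ⟨⟨q, hq, rfl⟩, (hsm2 q).2 h⟩, reflectSum_toE (by rw [h]; norm_num)⟩

theorem kissQ5_eq : kissQ5 = realize intQ5 := by
  rw [kissQ5, kissD5_eq, replaceLayer_realize, ← calcQ5_eq, calcQ5, calcD5_eq]

theorem kissR5_eq : kissR5 = realize intR5 := by
  rw [kissR5, kissL5_eq, replaceLayer_realize, ← calcR5_eq, calcR5, calcL5_eq]

/-! ### Vectors with small inner products with a kissing configuration are short -/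

/-- With `m = d i`, all values lie in `[m, m + 1]`, where the parabola is below its chord: `d j ^ 2
≤ (2m + 1) d j - m(m + 1)`. Summing, the first term contributes at most `0`, and `-m(m + 1) ≤ 1/4`.
-/
theorem sum_sq_le_of_min {ι : Type*} [Fintype ι] {d : ι → ℝ} {i : ι}
    (hmin : ∀ j, d i ≤ d j) (hdiff : ∀ j, d j - d i ≤ 1) (hs : ∑ j, d j ≤ 0)
    (hi : -(1 / 2) ≤ d i) : ∑ j, d j ^ 2 ≤ Fintype.card ι / 4 := by
  have h1 : ∀ j, d j ^ 2 ≤ (2 * d i + 1) * d j - (d i ^ 2 + d i) := by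
    intro j
    nlinarith [mul_nonneg (sub_nonneg.2 (hmin j)) (sub_nonneg.2 (hdiff j))]
  have h2 : ∑ j, d j ^ 2 ≤ ∑ j, ((2 * d i + 1) * d j - (d i ^ 2 + d i)) :=
    Finset.sum_le_sum fun j _ => h1 j
  rw [Finset.sum_sub_distrib, ← Finset.mul_sum, Finset.sum_const, Finset.card_univ,
    nsmul_eq_mul] at h2
  have h3 : (2 * d i + 1) * ∑ j, d j ≤ 0 := mul_nonpos_of_nonneg_of_nonpos (by linarith) hs
  have h4 : (0 : ℝ) ≤ Fintype.card ι * (d i + 1 / 2) ^ 2 := by positivity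
  linarith

/-- The two hypotheses together say `|d j| ≤ d i + 1` for every other `j`. -/
theorem sum_sq_le_of_min' {ι : Type*} [Fintype ι] {d : ι → ℝ} {i : ι}
    (hdiff : ∀ j, d j - d i ≤ 1) (hpair : ∀ j, j ≠ i → -d i - d j ≤ 1) :
    ∑ j, d j ^ 2 ≤ d i ^ 2 + (Fintype.card ι - 1) * (d i + 1) ^ 2 := by
  classical
  rw [← Finset.add_sum_erase _ _ (Finset.mem_univ i)]
  gcongr
  have : ∑ j ∈ Finset.univ.erase i, d j ^ 2 ≤ (Finset.univ.erase i).card • (d i + 1) ^ 2 := by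
    refine Finset.sum_le_card_nsmul _ _ _ fun j hj => ?_
    apply sq_le_sq'
    · linarith [hpair j (Finset.ne_of_mem_erase hj)]
    · linarith [hdiff j]
  rw [Finset.card_erase_of_mem (Finset.mem_univ i), nsmul_eq_mul, Finset.card_univ,
    Nat.cast_sub (Fintype.card_pos_iff.2 ⟨i⟩), Nat.cast_one] at this
  exact this

/-- If the minimum `m` is at least `-1/2`, the chord estimate gives `5/4`. Otherwise `-1 ≤ m <
-1/2`, and the bound `m² + 4(m + 1)²` is convex with values `1` and `5/4` at the ends. -/
theorem sum_sq_le_five_fourths {d : Fin 5 → ℝ} (hdiff : ∀ i j, i ≠ j → d i - d j ≤ 1)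
    (hpair : ∀ i j, i ≠ j → -d i - d j ≤ 1) (hs : ∑ j, d j ≤ 0) : ∑ j, d j ^ 2 ≤ 5 / 4 := by
  obtain ⟨i, hmin⟩ := Finite.exists_min d
  have hdiff' : ∀ j, d j - d i ≤ 1 := by
    intro j
    rcases eq_or_ne j i with rfl | h
    · simp
    · exact hdiff j i h
  rcases le_or_gt (-(1 / 2)) (d i) with h | h
  · simpa using sum_sq_le_of_min hmin hdiff' hs h
  · have h1 := sum_sq_le_of_min' hdiff' fun j hj => hpair i j hj.symm
    obtain ⟨j, hj⟩ := exists_ne i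
    have h2 := hdiff' j
    have h3 := hpair i j hj.symm
    norm_num at h1
    nlinarith

/-- Estimate for `R₅`, whose last coordinate satisfies fewer inequalities than the others. The
replacement is `∑ f ≤ t ≤ -(∑ f) / 4`, which forces `∑ f ≤ 0` and keeps `t` small. -/
theorem sum_sq_add_sq_lt_two {f : Fin 4 → ℝ} {t : ℝ} (hdiff : ∀ i j, i ≠ j → f i - f j ≤ 1)
    (hpair : ∀ i j, i ≠ j → -f i - f j ≤ 1) (ht : ∀ i, -f i - t ≤ 1) (hs : ∑ j, f j ≤ t)
    (hs' : 4 * t ≤ -∑ j, f j) : ∑ j, f j ^ 2 + t ^ 2 < 2 := by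
  obtain ⟨i, hmin⟩ := Finite.exists_min f
  have hdiff' : ∀ j, f j - f i ≤ 1 := by
    intro j
    rcases eq_or_ne j i with rfl | h
    · simp
    · exact hdiff j i h
  have hsum : 4 * f i ≤ ∑ j, f j := by
    have := Finset.card_nsmul_le_sum Finset.univ f (f i) fun j _ => hmin j
    simpa using this
  have h01 := hpair 0 1 (by decide)
  have h23 := hpair 2 3 (by decide)
  have hle : -2 ≤ ∑ j, f j := by rw [Fin.sum_univ_four]; linarith
  have hti := ht i
  rcases le_or_gt (-(1 / 2)) (f i) with h | h
  · have h1 := sum_sq_le_of_min hmin hdiff' (by linarith) h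
    norm_num at h1
    nlinarith
  · have h1 := sum_sq_le_of_min' hdiff' fun j hj => hpair i j hj.symm
    obtain ⟨j, hj⟩ := exists_ne i
    have h2 := hdiff' j
    have h3 := hpair i j hj.symm
    norm_num at h1
    nlinarith

/-- The cell of `D₄` is a 24-cell of circumradius `1`. At most one `|x i|` exceeds `1/2`; if it
equals `u`, the others are at most `1 - u`, and `u² + 3(1 - u)² ≤ 1` on `[1/2, 1]`. -/
theorem sum_sq_le_one {x : Fin 4 → ℝ} (h : ∀ i j, i ≠ j → |x i| + |x j| ≤ 1) :
    ∑ i, x i ^ 2 ≤ 1 := by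
  have h01 := h 0 1 (by decide)
  have h02 := h 0 2 (by decide)
  have h03 := h 0 3 (by decide)
  have h12 := h 1 2 (by decide)
  have h13 := h 1 3 (by decide)
  have h23 := h 2 3 (by decide)
  simp only [Fin.sum_univ_four, ← sq_abs (x _)]
  have h0 := abs_nonneg (x 0)
  have h1 := abs_nonneg (x 1)
  have h2 := abs_nonneg (x 2)
  have h3 := abs_nonneg (x 3)
  generalize |x 0| = a at *
  generalize |x 1| = b at *
  generalize |x 2| = c at *
  generalize |x 3| = e at *
  have key : ∀ u v w z : ℝ, 0 ≤ v → 0 ≤ w → 0 ≤ z → u + v ≤ 1 → u + w ≤ 1 → u + z ≤ 1 →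
      1 / 2 ≤ u → u ^ 2 + v ^ 2 + w ^ 2 + z ^ 2 ≤ 1 := by
    intro u v w z hv hw hz h1 h2 h3 hu
    have e1 : v ^ 2 ≤ (1 - u) ^ 2 := by gcongr; linarith
    have e2 : w ^ 2 ≤ (1 - u) ^ 2 := by gcongr; linarith
    have e3 : z ^ 2 ≤ (1 - u) ^ 2 := by gcongr; linarith
    nlinarith
  by_cases ha : 1 / 2 ≤ a
  · exact key a b c e h1 h2 h3 h01 h02 h03 ha
  by_cases hb : 1 / 2 ≤ b
  · linarith [key b a c e h0 h2 h3 (by linarith) h12 h13 hb]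
  by_cases hc : 1 / 2 ≤ c
  · linarith [key c a b e h0 h1 h3 (by linarith) (by linarith) h23 hc]
  by_cases he : 1 / 2 ≤ e
  · linarith [key e a b c h0 h1 h2 (by linarith) (by linarith) (by linarith) he]
  push Not at ha hb hc he
  nlinarith

/-- The integer vector with given coordinates. -/
def ofFun (f : Fin 5 → ℤ) : IVec := (f 0, f 1, f 2, f 3, f 4)

theorem inner_toE_ofFun (d : E5) (f : Fin 5 → ℤ) :
    ⟪d, toE (ofFun f)⟫ = ∑ k, d k * ((f k : ℝ) / 10) := by
  rw [inner_eq, Fin.sum_univ_five]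
  rfl

theorem inner_single_sub_single (d : E5) (i j : Fin 5) :
    ⟪d, toE (ofFun fun k => (if k = i then 10 else 0) - if k = j then 10 else 0)⟫ =
      d i - d j := by
  rw [inner_toE_ofFun]
  simp [sub_div, mul_sub, ite_div]

theorem inner_neg_single_sub_single (d : E5) (c : ℤ) (i j : Fin 5) :
    ⟪d, toE (ofFun fun k => c - (if k = i then 10 else 0) - if k = j then 10 else 0)⟫ =
      (c : ℝ) / 10 * (∑ k, d k) - d i - d j := by
  rw [inner_toE_ofFun]
  simp only [Int.cast_sub, sub_div, mul_sub, Finset.sum_sub_distrib, ← Finset.sum_mul]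
  simp [ite_div, mul_comm]

theorem inner_self_eq_sum (d : E5) : ⟪d, d⟫ = ∑ i, d i ^ 2 := by
  rw [inner_eq, Fin.sum_univ_five]; ring

theorem sum_reflectSum (d : E5) : ∑ i, reflectSum d i = -∑ i, d i := by
  simp only [reflectSum, Finset.sum_sub_distrib]
  simp
  ring

theorem inner_reflectSum (d : E5) : ∑ i, reflectSum d i ^ 2 = ∑ i, d i ^ 2 := by
  simp only [reflectSum, Fin.sum_univ_five]
  ring

section

variable {d : E5}

/-- The central symmetry of `D₅` reduces to nonpositive coordinate sum. -/
theorem cover_D5 (hd : ∀ w ∈ realize intD5, ⟪d, w⟫ ≤ 1) : ⟪d, d⟫ < 2 := by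
  have hdiff : ∀ i j, i ≠ j → d i - d j ≤ 1 := by
    intro i j hij
    rw [← inner_single_sub_single]
    exact hd _ ⟨_, by revert i j; decide +kernel, rfl⟩
  have hneg : ∀ i j, i ≠ j → -d i - d j ≤ 1 := by
    intro i j hij
    have h1 : toE (ofFun fun k => 0 - (if k = i then 10 else 0) - if k = j then 10 else 0) ∈
      realize intD5 := ⟨_, by revert i j; decide +kernel, rfl⟩
    have h2 := hd _ h1
    rw [inner_neg_single_sub_single] at h2
    simpa using h2
  have hpos : ∀ i j, i ≠ j → d i + d j ≤ 1 := by
    intro i j hij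
    have h1 : toE (ofFun fun k => (if k = i then 10 else 0) + if k = j then 10 else 0) ∈
      realize intD5 := ⟨_, by revert i j; decide +kernel, rfl⟩
    have h2 := hd _ h1
    rw [inner_toE_ofFun] at h2
    simpa [add_div, mul_add, ite_div, Finset.sum_add_distrib] using h2
  rw [inner_self_eq_sum]
  rcases le_total (∑ i, d i) 0 with h | h
  · exact (sum_sq_le_five_fourths hdiff hneg h).trans_lt (by norm_num)
  · have := sum_sq_le_five_fourths (d := fun i => -d i)
      (fun i j hij => by linarith [hdiff j i hij.symm]) (fun i j hij => by linarith [hpos i j hij])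
      (by simpa using h)
    simp only [neg_sq] at this
    linarith

theorem cover_L5 (hd : ∀ w ∈ realize intL5, ⟪d, w⟫ ≤ 1) : ⟪d, d⟫ < 2 := by
  have key : ∀ x y z t u : ℤ, (x, y, z, t, u) ∈ intL5 →
      d 0 * (x / 10) + d 1 * (y / 10) + d 2 * (z / 10) + d 3 * (t / 10) + d 4 * (u / 10) ≤ 1 := by
    intro x y z t u h
    have := hd _ ⟨_, h, rfl⟩
    rw [inner_eq] at this
    exact this
  have hsum : ∑ i : Fin 4, d i.castSucc ^ 2 ≤ 1 := by
    refine sum_sq_le_one fun i j hij => ?_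
    have h1 : ∀ s t : ℤ, (s = 1 ∨ s = -1) → (t = 1 ∨ t = -1) →
        d i.castSucc * s + d j.castSucc * t ≤ 1 := by
      intro s t hs ht
      have h1 : toE (ofFun fun k =>
          (if k = i.castSucc then 10 * s else 0) + if k = j.castSucc then 10 * t else 0) ∈
          realize intL5 := by
        refine ⟨_, ?_, rfl⟩
        rcases hs with rfl | rfl <;> rcases ht with rfl | rfl <;> revert i j <;> decide +kernel
      have h2 := hd _ h1
      rw [inner_toE_ofFun] at h2
      simpa [add_div, mul_add, ite_div, Finset.sum_add_distrib] using h2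
    have h2 := h1 1 1 (by simp) (by simp)
    have h3 := h1 1 (-1) (by simp) (by simp)
    have h4 := h1 (-1) 1 (by simp) (by simp)
    have h5 := h1 (-1) (-1) (by simp) (by simp)
    push_cast at h2 h3 h4 h5
    rcases abs_cases (d i.castSucc) with ⟨h, -⟩ | ⟨h, -⟩ <;>
      rcases abs_cases (d j.castSucc) with ⟨h', -⟩ | ⟨h', -⟩ <;> rw [h, h'] <;> linarith
  simp only [Fin.sum_univ_four] at hsum
  change d 0 ^ 2 + d 1 ^ 2 + d 2 ^ 2 + d 3 ^ 2 ≤ 1 at hsum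
  have b0 := key 10 0 0 0 (-10) (by decide +kernel)
  have b0' := key (-10) 0 0 0 (-10) (by decide +kernel)
  have b1 := key 0 10 0 0 (-10) (by decide +kernel)
  have b1' := key 0 (-10) 0 0 (-10) (by decide +kernel)
  have b2 := key 0 0 10 0 (-10) (by decide +kernel)
  have b2' := key 0 0 (-10) 0 (-10) (by decide +kernel)
  have b3 := key 0 0 0 10 (-10) (by decide +kernel)
  have b3' := key 0 0 0 (-10) (-10) (by decide +kernel)
  have t0 := key (-5) 5 5 5 10 (by decide +kernel)
  have t0' := key 5 (-5) (-5) (-5) 10 (by decide +kernel)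
  have t1 := key 5 (-5) 5 5 10 (by decide +kernel)
  have t1' := key (-5) 5 (-5) (-5) 10 (by decide +kernel)
  have t2 := key 5 5 (-5) 5 10 (by decide +kernel)
  have t2' := key (-5) (-5) 5 (-5) 10 (by decide +kernel)
  have t3 := key 5 5 5 (-5) 10 (by decide +kernel)
  have t3' := key (-5) (-5) (-5) 5 10 (by decide +kernel)
  norm_num at b0 b0' b1 b1' b2 b2' b3 b3' t0 t0' t1 t1' t2 t2' t3 t3'
  rw [inner_self_eq_sum, Fin.sum_univ_five]
  -- Opposite horizontal parts cancel in pairs of constraints from the bottom layer, and likewise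
  -- from the top layer, leaving `|d 4| ≤ 1`. At either extreme those constraints force the first
  -- four coordinates to vanish, so the value `2` is never reached.
  have hlo : -1 ≤ d 4 := by linarith
  have hhi : d 4 ≤ 1 := by linarith
  rcases hlo.eq_or_lt with h | hlo
  · have e0 : d 0 = 0 := by linarith
    have e1 : d 1 = 0 := by linarith
    have e2 : d 2 = 0 := by linarith
    have e3 : d 3 = 0 := by linarith
    rw [e0, e1, e2, e3, ← h]; norm_num
  rcases hhi.eq_or_lt with h | hhi
  · have e0 : d 0 = 0 := by linarith
    have e1 : d 1 = 0 := by linarith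
    have e2 : d 2 = 0 := by linarith
    have e3 : d 3 = 0 := by linarith
    rw [e0, e1, e2, e3, h]; norm_num
  · have : d 4 ^ 2 < 1 := by rw [sq_lt_one_iff_abs_lt_one, abs_lt]; exact ⟨hlo, hhi⟩
    linarith

/-- The reflection `reflectSum`, which preserves `Q₅`, takes the place of the central symmetry of
`D₅`. -/
theorem cover_Q5 (hd : ∀ w ∈ realize intQ5, ⟪d, w⟫ ≤ 1) : ⟪d, d⟫ < 2 := by
  have hdiff : ∀ i j, i ≠ j → d i - d j ≤ 1 := by
    intro i j hij
    rw [← inner_single_sub_single]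
    exact hd _ ⟨_, by revert i j; decide +kernel, rfl⟩
  have hneg : ∀ i j, i ≠ j → -d i - d j ≤ 1 := by
    intro i j hij
    have h1 : toE (ofFun fun k => 0 - (if k = i then 10 else 0) - if k = j then 10 else 0) ∈
      realize intQ5 := ⟨_, by revert i j; decide +kernel, rfl⟩
    have h2 := hd _ h1
    rw [inner_neg_single_sub_single] at h2
    simpa using h2
  have hpos : ∀ i j, i ≠ j → 4 / 5 * ∑ k, d k - d i - d j ≤ 1 := by
    intro i j hij
    have h1 : toE (ofFun fun k => 8 - (if k = i then 10 else 0) - if k = j then 10 else 0) ∈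
      realize intQ5 := ⟨_, by revert i j; decide +kernel, rfl⟩
    have h2 := hd _ h1
    rw [inner_neg_single_sub_single] at h2
    norm_num at h2 ⊢
    linarith
  rw [inner_self_eq_sum]
  rcases le_total (∑ i, d i) 0 with h | h
  · exact (sum_sq_le_five_fourths hdiff hneg h).trans_lt (by norm_num)
  · have := sum_sq_le_five_fourths (d := reflectSum d)
      (fun i j hij => by simp only [reflectSum]; linarith [hdiff i j hij])
      (fun i j hij => by simp only [reflectSum]; linarith [hpos i j hij])
      (by rw [sum_reflectSum]; simpa using h)
    rw [inner_reflectSum] at this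
    linarith

/-- When `4 * d 4` is at most the sum `S` of the other coordinates, averaging their difference
bounds supplies the missing inequalities `d 4 - d j ≤ 1`, and `sum_sq_le_five_fourths` applies.
Otherwise the norm-preserving substitution `f i = S / 2 - d i`, `t = -d 4` leads to
`sum_sq_add_sq_lt_two`. -/
theorem sum_sq_lt_two_of_sum_nonpos {d : Fin 5 → ℝ} 
    (hdiff : ∀ i j : Fin 4, i ≠ j → d i.castSucc - d j.castSucc ≤ 1)
    (hlast : ∀ i : Fin 4, d i.castSucc - d 4 ≤ 1)
    (hlast' : ∀ i : Fin 4, d i.castSucc - (∑ j : Fin 4, d j.castSucc) / 2 + d 4 ≤ 1)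
    (hneg : ∀ i j, i ≠ j → -d i - d j ≤ 1) (hs : ∑ i, d i ≤ 0) : ∑ i, d i ^ 2 < 2 := by
  have hs4 := Fin.sum_univ_castSucc d
  have hq4 := Fin.sum_univ_castSucc fun i => d i ^ 2
  rw [show Fin.last 4 = 4 from rfl] at hs4 hq4
  rcases le_or_gt (4 * d 4) (∑ j : Fin 4, d j.castSucc) with h | h
  · refine (sum_sq_le_five_fourths (fun i j hij => ?_) hneg hs).trans_lt (by norm_num)
    induction i using Fin.lastCases with
    | last =>
      induction j using Fin.lastCases with
      | last => exact absurd rfl hij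
      | cast j =>
        have h1 : ∀ k : Fin 4, d k.castSucc ≤ d j.castSucc + if k = j then 0 else 1 := by
          intro k
          split_ifs with hk
          · simp [hk]
          · linarith [hdiff k j hk]
        have h2 := Finset.sum_le_sum fun k (_ : k ∈ Finset.univ) => h1 k
        rw [Finset.sum_add_distrib] at h2
        have h3 : ∑ k : Fin 4, (if k = j then (0 : ℝ) else 1) = 3 := by
          fin_cases j <;> simp [Fin.sum_univ_four] <;> norm_num
        rw [h3] at h2
        simp only [Finset.sum_const, Finset.card_univ, Fintype.card_fin, nsmul_eq_mul] at h2
        rw [show Fin.last 4 = 4 from rfl]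
        push_cast at h2
        linarith
    | cast i =>
      induction j using Fin.lastCases with
      | last => exact hlast i
      | cast j => exact hdiff i j fun h => hij (h ▸ rfl)
  · have hpair : ∀ i j : Fin 4, i ≠ j →
        d i.castSucc + d j.castSucc - ∑ k : Fin 4, d k.castSucc ≤ 1 := by
      have h01 : -d 0 - d 1 ≤ 1 := hneg 0 1 (by decide)
      have h02 : -d 0 - d 2 ≤ 1 := hneg 0 2 (by decide)
      have h03 : -d 0 - d 3 ≤ 1 := hneg 0 3 (by decide)
      have h12 : -d 1 - d 2 ≤ 1 := hneg 1 2 (by decide)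
      have h13 : -d 1 - d 3 ≤ 1 := hneg 1 3 (by decide)
      have h23 : -d 2 - d 3 ≤ 1 := hneg 2 3 (by decide)
      rw [Fin.sum_univ_four]
      intro i j hij
      fin_cases i <;> fin_cases j <;> first | exact absurd rfl hij | (simp only [Fin.castSucc] at *; dsimp at *; linarith)
    have := sum_sq_add_sq_lt_two
      (f := fun i => (∑ j : Fin 4, d j.castSucc) / 2 - d i.castSucc) (t := -d 4)
      (fun i j hij => by linarith [hdiff j i hij.symm]) (fun i j hij => by linarith [hpair i j hij])
      (fun i => by linarith [hlast' i])
      (by simp only [Fin.sum_univ_four] at hs4 ⊢; linarith)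
      (by simp only [Fin.sum_univ_four] at h ⊢; linarith)
    rw [hq4]
    refine lt_of_eq_of_lt ?_ this
    simp only [Fin.sum_univ_four]
    ring

theorem cover_R5 (hd : ∀ w ∈ realize intR5, ⟪d, w⟫ ≤ 1) : ⟪d, d⟫ < 2 := by
  have hdiff : ∀ i j : Fin 4, i ≠ j → d i.castSucc - d j.castSucc ≤ 1 := by
    intro i j hij
    rw [← inner_single_sub_single]
    exact hd _ ⟨_, by revert i j; decide +kernel, rfl⟩
  have hlast : ∀ i : Fin 4, d i.castSucc - d 4 ≤ 1 := by
    intro i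
    rw [← inner_single_sub_single]
    exact hd _ ⟨_, by revert i; decide +kernel, rfl⟩
  have hlast' : ∀ i : Fin 4, d i.castSucc - (∑ j : Fin 4, d j.castSucc) / 2 + d 4 ≤ 1 := by
    intro i
    have h1 : toE (ofFun fun k => if k = 4 then 10 else if k = i.castSucc then 5 else -5) ∈
      realize intR5 := ⟨_, by revert i; decide +kernel, rfl⟩
    have h2 := hd _ h1
    rw [inner_toE_ofFun, Fin.sum_univ_five] at h2
    rw [Fin.sum_univ_four]
    fin_cases i <;> simp [Fin.ext_iff] at h2 ⊢ <;> linarith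
  have hneg : ∀ i j, i ≠ j → -d i - d j ≤ 1 := by
    intro i j hij
    have h1 : toE (ofFun fun k => 0 - (if k = i then 10 else 0) - if k = j then 10 else 0) ∈
      realize intR5 := ⟨_, by revert i j; decide +kernel, rfl⟩
    have h2 := hd _ h1
    rw [inner_neg_single_sub_single] at h2
    simpa using h2
  have hpos : ∀ i j, i ≠ j → 4 / 5 * ∑ k, d k - d i - d j ≤ 1 := by
    intro i j hij
    have h1 : toE (ofFun fun k => 8 - (if k = i then 10 else 0) - if k = j then 10 else 0) ∈
      realize intR5 := ⟨_, by revert i j; decide +kernel, rfl⟩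
    have h2 := hd _ h1
    rw [inner_neg_single_sub_single] at h2
    norm_num at h2 ⊢
    linarith
  rw [inner_self_eq_sum]
  rcases le_total (∑ i, d i) 0 with h | h
  · exact sum_sq_lt_two_of_sum_nonpos hdiff hlast hlast' hneg h
  · rw [← inner_reflectSum]
    refine sum_sq_lt_two_of_sum_nonpos (d := reflectSum d)
      (fun i j hij => ?_) (fun i => ?_) (fun i => ?_) (fun i j hij => ?_) ?_
    · simp only [reflectSum]; linarith [hdiff i j hij]
    · simp only [reflectSum]; linarith [hlast i]
    · have := hlast' i
      simp only [reflectSum, Fin.sum_univ_four] at this ⊢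
      linarith
    · simp only [reflectSum]; linarith [hpos i j hij]
    · rw [sum_reflectSum]; simpa using h

end

/-! ### The four kissing configurations have the required properties -/

/-- The inner products that single out the antipodal part of a kissing configuration. -/
def innerSet (l : List ℤ) : Set ℝ := (fun n : ℤ => (n : ℝ) / 100) '' {n | n ∈ l}

/-- The test values in `innerSet`, in hundredths, detect antipodality. All of `D₅` is antipodal, so
none is needed. Pairs with product `-1/2` single out the `D₄` roots in `L₅`, pairs with product
`2/5` the `A₄` roots in `Q₅`, and both kinds together the `A₃` roots in `R₅`. -/
theorem kissingData_D5 : KissingData kissD5 (innerSet []) := by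
  rw [kissD5_eq]
  exact kissingData_realize (by decide +kernel) (by decide +kernel) (by decide +kernel)
    (by decide +kernel) (by decide +kernel) fun d => cover_D5

theorem kissingData_L5 : KissingData kissL5 (innerSet [-50]) := by
  rw [kissL5_eq]
  exact kissingData_realize (by decide +kernel) (by decide +kernel) (by decide +kernel)
    (by decide +kernel) (by decide +kernel) fun d => cover_L5

theorem kissingData_Q5 : KissingData kissQ5 (innerSet [40]) := by
  rw [kissQ5_eq]
  exact kissingData_realize (by decide +kernel) (by decide +kernel) (by decide +kernel)
    (by decide +kernel) (by decide +kernel) fun d => cover_Q5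

theorem kissingData_R5 : KissingData kissR5 (innerSet [-50, 40]) := by
  rw [kissR5_eq]
  exact kissingData_realize (by decide +kernel) (by decide +kernel) (by decide +kernel)
    (by decide +kernel) (by decide +kernel) fun d => cover_R5

/-! ### Propagation of kissing configurations given by lists -/

theorem ncard_realize {l : List IVec} (h : l.Nodup) : (realize l).ncard = l.length := by
  classical
  rw [realize, Set.ncard_image_of_injective _ toE_injective]
  have : {p | p ∈ l} = (l.toFinset : Set IVec) := by ext; simp
  rw [this, Set.ncard_coe_finset, List.toFinset_card_of_nodup h]

/-- The map that sends the vector given by `p ∈ l` to the set given by the list `f p`. -/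
def ruleSet (l : List IVec) (f : IVec → List IVec) (v : E5) : Set E5 :=
  {w | ∃ p ∈ l, toE p = v ∧ w ∈ realize (f p)}

theorem ruleSet_toE {l : List IVec} {f : IVec → List IVec} {p : IVec} (hp : p ∈ l) :
    ruleSet l f (toE p) = realize (f p) := by
  ext w
  constructor
  · rintro ⟨q, -, hqp, hw⟩
    rwa [toE_injective hqp] at hw
  · exact fun hw => ⟨p, hp, rfl, hw⟩

/-- The antipodal part of a list. -/
def iantipodal (l : List IVec) : List IVec := l.filter fun p => -p ∈ l

/-- The vectors from `r` to the points of `l` (or to the origin) tangent to it, and the antipodal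
part of `l`. -/
def knownFrom (l : List IVec) (r : IVec) : List IVec :=
  (((0 : IVec) :: l).map fun w => w - r).filter (fun w => idot w w = 200) ++ iantipodal l

theorem antipodalPart_realize (l : List IVec) :
    antipodalPart (realize l) = realize (iantipodal l) := by
  ext v
  constructor
  · rintro ⟨⟨p, hp, rfl⟩, h⟩
    rw [← toE_neg, toE_mem_realize] at h
    exact ⟨p, by simpa [iantipodal] using ⟨hp, h⟩, rfl⟩
  · rintro ⟨p, hp, rfl⟩
    simp only [iantipodal, Set.mem_ofPred_eq, List.mem_filter, decide_eq_true_eq] at hp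
    exact ⟨⟨p, hp.1, rfl⟩, ⟨-p, hp.2, toE_neg p⟩⟩

theorem toE_mem_kissingConfig {P : Set E5} {r w : IVec} (h : toE (r + w) ∈ P)
    (hw : idot w w = 200) : toE w ∈ kissingConfig P (toE r) := by
  refine ⟨by rwa [← toE_add], ?_⟩
  rw [norm_eq_sqrt_two, inner_toE, hw]
  norm_num

namespace IsKissingPacking

variable {P : Set E5} {l : List IVec} {S : Set ℝ}

theorem antipodalPart_eq (hP : IsKissingPacking P (realize l)) (hK : KissingData (realize l) S)
    (h0 : 0 ∈ P) (h0' : kissingConfig P 0 = realize l) {x : E5} (hx : x ∈ P) :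
    antipodalPart (kissingConfig P x) = realize (iantipodal l) := by
  rw [hP.antipodalPart_const hK h0 hx, h0', antipodalPart_realize]

theorem toE_mem_of_mem (h0' : kissingConfig P 0 = realize l) {p : IVec} (hp : p ∈ l) :
    toE p ∈ P := by
  have : toE p ∈ kissingConfig P 0 := h0' ▸ ⟨p, hp, rfl⟩
  simpa using this.1

theorem knownFrom_mem (hP : IsKissingPacking P (realize l)) (hK : KissingData (realize l) S)
    (h0 : 0 ∈ P) (h0' : kissingConfig P 0 = realize l) {r w : IVec} (hr : toE r ∈ P)
    (hw : w ∈ knownFrom l r) : toE w ∈ kissingConfig P (toE r) := by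
  simp only [knownFrom, List.mem_append, List.mem_filter, List.mem_map, List.mem_cons,
    decide_eq_true_eq] at hw
  rcases hw with ⟨⟨z, hz, rfl⟩, hw⟩ | hw
  · refine toE_mem_kissingConfig ?_ hw
    rw [add_sub_cancel]
    rcases hz with rfl | hz
    · rwa [toE_zero]
    · exact toE_mem_of_mem h0' hz
  · have : toE w ∈ antipodalPart (kissingConfig P (toE r)) := by
      rw [hP.antipodalPart_eq hK h0 h0' hr]
      exact ⟨w, hw, rfl⟩
    exact this.1

theorem kissingConfig_eq_realize (hP : IsKissingPacking P (realize l))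
    (hK : KissingData (realize l) S) {x : E5} (hx : x ∈ P) {t : List IVec} (hl : l.Nodup)
    (ht : t.Nodup) (hlt : t.length = l.length) (h : ∀ p ∈ t, toE p ∈ kissingConfig P x) :
    kissingConfig P x = realize t := by
  refine hP.kissingConfig_eq_of_subset hK hx ?_ ?_
  · rw [ncard_realize hl, ncard_realize ht, hlt]
  · rintro _ ⟨p, hp, rfl⟩
    exact h p hp

theorem kissingConfig_of_antipodal (hP : IsKissingPacking P (realize l))
    (hK : KissingData (realize l) S) (h0 : 0 ∈ P) (h0' : kissingConfig P 0 = realize l)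
    {r : IVec} (hr : r ∈ l) (hr' : -r ∈ l) : kissingConfig P (toE r) = realize l := by
  have h := hP.kissingConfig_add_of_antipodal hK h0 (v := toE r)
    ⟨h0' ▸ ⟨r, hr, rfl⟩, h0' ▸ ⟨-r, hr', toE_neg r⟩⟩
  rw [zero_add] at h
  rw [h, h0']

/-- At every point, the kissing configuration is the image of the one at the origin by a linear
isometry that preserves its antipodal part. -/
theorem exists_linearIsometryEquiv (hP : IsKissingPacking P (realize l))
    (hK : KissingData (realize l) S) (h0 : 0 ∈ P) (h0' : kissingConfig P 0 = realize l)
    {x : E5} (hx : x ∈ P) : ∃ L : E5 ≃ₗᵢ[ℝ] E5, kissingConfig P x = L '' realize l ∧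
      L '' realize (iantipodal l) = realize (iantipodal l) := by
  obtain ⟨L, hL⟩ := hP.kissing.2 x hx
  refine ⟨L, hL.symm, ?_⟩
  rw [← antipodalPart_realize, ← antipodalPart_image, hL,
    hP.antipodalPart_eq hK h0 h0' hx, antipodalPart_realize]

end IsKissingPacking

/-! ### Packings with kissing configuration `D₅` -/

theorem rule_D5 (P : Set E5) (hP : IsKissingPacking P kissD5) (h0 : 0 ∈ P)
    (h0' : kissingConfig P 0 = kissD5) (r : E5) (hr : r ∈ kissD5) :
    kissingConfig P r = kissD5 := by
  have hK := kissingData_D5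
  rw [kissD5_eq] at *
  obtain ⟨r, hr, rfl⟩ := hr
  have hneg : ∀ p ∈ intD5, -p ∈ intD5 := by decide +kernel
  exact hP.kissingConfig_of_antipodal hK h0 h0' hr (hneg r hr)

/-! ### Reflections that preserve kissing configurations -/

/-- The vector `(1, 1, 1, 1, 1)`. -/
noncomputable def ones : E5 := toE (10, 10, 10, 10, 10)

/-- The vector `(1, 1, 1, 1, -4)`. -/
noncomputable def nu : E5 := toE (10, 10, 10, 10, -40)

/-- Ten times the inner product with `(1, 1, 1, 1, -4)`. -/
def inu (p : IVec) : ℤ := p.1 + p.2.1 + p.2.2.1 + p.2.2.2.1 - 4 * p.2.2.2.2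

theorem inner_toE_ones (p : IVec) : ⟪toE p, ones⟫ = (isum p : ℝ) / 10 := by
  rw [ones, inner_toE]
  simp [idot, isum]
  ring

theorem inner_toE_nu (p : IVec) : ⟪toE p, nu⟫ = (inu p : ℝ) / 10 := by
  rw [nu, inner_toE]
  simp [idot, inu]
  ring

/-- `t` is the mirror image of `a` in the hyperplane orthogonal to `(1, 1, 1, 1, 1)`. -/
def IsMirror (a t : IVec) : Prop :=
  5 * t.1 = 5 * a.1 - 2 * isum a ∧ 5 * t.2.1 = 5 * a.2.1 - 2 * isum a ∧
  5 * t.2.2.1 = 5 * a.2.2.1 - 2 * isum a ∧ 5 * t.2.2.2.1 = 5 * a.2.2.2.1 - 2 * isum a ∧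
  5 * t.2.2.2.2 = 5 * a.2.2.2.2 - 2 * isum a

instance (a t : IVec) : Decidable (IsMirror a t) := by unfold IsMirror; infer_instance

/-- `t` is the mirror image of `a` in the hyperplane orthogonal to `(1, 1, 1, 1, -4)`. -/
def IsNuMirror (a t : IVec) : Prop :=
  10 * t.1 = 10 * a.1 - inu a ∧ 10 * t.2.1 = 10 * a.2.1 - inu a ∧
  10 * t.2.2.1 = 10 * a.2.2.1 - inu a ∧ 10 * t.2.2.2.1 = 10 * a.2.2.2.1 - inu a ∧
  10 * t.2.2.2.2 = 10 * a.2.2.2.2 + 4 * inu a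

instance (a t : IVec) : Decidable (IsNuMirror a t) := by unfold IsNuMirror; infer_instance

theorem IsMirror.toE_eq {a t : IVec} (h : IsMirror a t) :
    toE t = toE a - (2 / 5 * ⟪toE a, ones⟫) • ones := by
  obtain ⟨h0, h1, h2, h3, h4⟩ := h
  rify at h0 h1 h2 h3 h4
  rw [inner_toE_ones]
  apply ext_five <;> simp [ones] <;> linarith

theorem IsNuMirror.toE_eq {a t : IVec} (h : IsNuMirror a t) :
    toE t = toE a - (⟪toE a, nu⟫ / 10) • nu := by
  obtain ⟨h0, h1, h2, h3, h4⟩ := h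
  rify at h0 h1 h2 h3 h4
  rw [inner_toE_nu]
  apply ext_five <;> simp [nu] <;> linarith

/-- The closure properties of the kissing configurations `Q₅` and `R₅` used to reconstruct them
from some of their points. -/
structure MirrorClosed (X : Set E5) : Prop where
  add_mem : ∀ v ∈ X, ∀ w ∈ X, ⟪v, w⟫ = -1 → v + w ∈ X
  mirror_mem : ∀ w ∈ X, w - (2 / 5 * ⟪w, ones⟫) • ones ∈ X

/-- Further closure properties of the kissing configuration `R₅`. -/
structure NuMirrorClosed (X : Set E5) : Prop extends MirrorClosed X where
  sub_mem : ∀ w ∈ X, ∀ u ∈ X, ⟪w, nu⟫ ^ 2 = 9 → ⟪u, ones⟫ = 0 → ⟪w, u⟫ = 1 → w - u ∈ X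
  nuMirror_mem : ∀ w ∈ X, ⟪w, ones⟫ = 0 → w - (⟪w, nu⟫ / 10) • nu ∈ X

theorem inner_map_of_eq_or_neg {L : E5 ≃ₗᵢ[ℝ] E5} {n : E5} (hn : L n = n ∨ L n = -n) (w : E5) :
    ∃ c : ℝ, c ^ 2 = 1 ∧ ⟪L w, n⟫ = c * ⟪w, n⟫ ∧ L n = c • n := by
  have h := L.inner_map_map w n
  rcases hn with hn | hn
  · exact ⟨1, by norm_num, by rw [← h, hn, one_mul], by rw [hn, one_smul]⟩
  · exact ⟨-1, by norm_num, by rw [← h, hn, inner_neg_right]; ring, by rw [hn]; simp⟩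

theorem map_sub_smul {L : E5 ≃ₗᵢ[ℝ] E5} {n : E5} (hn : L n = n ∨ L n = -n) (w : E5) (k : ℝ) :
    L (w - (k * ⟪w, n⟫) • n) = L w - (k * ⟪L w, n⟫) • n := by
  obtain ⟨c, hc, h1, h2⟩ := inner_map_of_eq_or_neg hn w
  rw [map_sub, map_smul, h1, h2, smul_smul]
  congr 2
  ring

theorem MirrorClosed.image {X : Set E5} (hX : MirrorClosed X) {L : E5 ≃ₗᵢ[ℝ] E5}
    (hL : L ones = ones ∨ L ones = -ones) : MirrorClosed (L '' X) where
  add_mem := by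
    rintro _ ⟨v, hv, rfl⟩ _ ⟨w, hw, rfl⟩ h
    rw [L.inner_map_map] at h
    exact ⟨v + w, hX.add_mem v hv w hw h, map_add L v w⟩
  mirror_mem := by
    rintro _ ⟨w, hw, rfl⟩
    rw [← map_sub_smul hL]
    exact ⟨_, hX.mirror_mem w hw, rfl⟩

theorem NuMirrorClosed.image {X : Set E5} (hX : NuMirrorClosed X) {L : E5 ≃ₗᵢ[ℝ] E5}
    (hL : L ones = ones ∨ L ones = -ones) (hL' : L nu = nu ∨ L nu = -nu) :
    NuMirrorClosed (L '' X) where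
  toMirrorClosed := hX.toMirrorClosed.image hL
  sub_mem := by
    rintro _ ⟨w, hw, rfl⟩ _ ⟨u, hu, rfl⟩ h1 h2 h3
    obtain ⟨c, hc, hc1, -⟩ := inner_map_of_eq_or_neg hL' w
    obtain ⟨e, he, he1, -⟩ := inner_map_of_eq_or_neg hL u
    rw [hc1, mul_pow, hc, one_mul] at h1
    have he0 : e ≠ 0 := by rintro rfl; norm_num at he
    rw [he1, mul_eq_zero, or_iff_right he0] at h2
    rw [L.inner_map_map] at h3
    exact ⟨w - u, hX.sub_mem w hw u hu h1 h2 h3, map_sub L w u⟩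
  nuMirror_mem := by
    rintro _ ⟨w, hw, rfl⟩ h
    obtain ⟨e, he, he1, -⟩ := inner_map_of_eq_or_neg hL w
    have he0 : e ≠ 0 := by rintro rfl; norm_num at he
    rw [he1, mul_eq_zero, or_iff_right he0] at h
    have := map_sub_smul hL' w (1 / 10)
    simp only [one_div_mul_eq_div] at this
    rw [← this]
    exact ⟨_, hX.nuMirror_mem w hw h, rfl⟩

theorem mirrorClosed_realize {l : List IVec}
    (hadd : ∀ v ∈ l, ∀ w ∈ l, idot v w = -100 → v + w ∈ l)
    (hmirror : ∀ a ∈ l, ∃ t ∈ l, IsMirror a t) : MirrorClosed (realize l) where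
  add_mem := by
    rintro _ ⟨v, hv, rfl⟩ _ ⟨w, hw, rfl⟩ h
    rw [show (-1 : ℝ) = ((-100 : ℤ) : ℝ) / 100 by norm_num, inner_toE_eq_iff] at h
    exact ⟨v + w, hadd v hv w hw h, toE_add v w⟩
  mirror_mem := by
    rintro _ ⟨a, ha, rfl⟩
    obtain ⟨t, ht, hat⟩ := hmirror a ha
    exact ⟨t, ht, hat.toE_eq⟩

theorem mirrorClosed_Q5 : MirrorClosed (realize intQ5) :=
  mirrorClosed_realize (by decide +kernel) (by decide +kernel)

theorem nuMirrorClosed_R5 : NuMirrorClosed (realize intR5) where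
  toMirrorClosed := mirrorClosed_realize (by decide +kernel) (by decide +kernel)
  sub_mem := by
    have key : ∀ w ∈ intR5, inu w ^ 2 = 900 → ∀ u ∈ intR5, isum u = 0 → idot w u = 100 →
        w - u ∈ intR5 := by decide +kernel
    rintro _ ⟨w, hw, rfl⟩ _ ⟨u, hu, rfl⟩ h1 h2 h3
    rw [inner_toE_nu] at h1
    rw [inner_toE_ones, div_eq_zero_iff, or_iff_left (by norm_num)] at h2
    rw [show (1 : ℝ) = ((100 : ℤ) : ℝ) / 100 by norm_num, inner_toE_eq_iff] at h3
    refine ⟨w - u, key w hw ?_ u hu (by exact_mod_cast h2) h3, toE_sub w u⟩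
    have : ((inu w ^ 2 : ℤ) : ℝ) = 900 := by push_cast; linarith
    exact_mod_cast this
  nuMirror_mem := by
    have key : ∀ a ∈ intR5, isum a = 0 → ∃ t ∈ intR5, IsNuMirror a t := by decide +kernel
    rintro _ ⟨a, ha, rfl⟩ h
    rw [inner_toE_ones, div_eq_zero_iff, or_iff_left (by norm_num)] at h
    obtain ⟨t, ht, hat⟩ := key a ha (by exact_mod_cast h)
    exact ⟨t, ht, hat.toE_eq⟩

/-- `t` can be obtained from the list `k` by the operations of `MirrorClosed`. -/
def MirrorDerives (k : List IVec) (t : IVec) : Prop :=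
  t ∈ k ∨ (∃ a ∈ k, idot a (t - a) = -100 ∧ t - a ∈ k) ∨ ∃ a ∈ k, IsMirror a t

instance (k : List IVec) (t : IVec) : Decidable (MirrorDerives k t) := by
  unfold MirrorDerives; infer_instance

/-- `t` can be obtained from the list `k` by the operations of `NuMirrorClosed`. -/
def NuMirrorDerives (k : List IVec) (t : IVec) : Prop :=
  MirrorDerives k t ∨
  (∃ w ∈ k, inu w ^ 2 = 900 ∧ idot w (w - t) = 100 ∧ isum (w - t) = 0 ∧ w - t ∈ k) ∨
  ∃ a ∈ k, isum a = 0 ∧ IsNuMirror a t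

instance (k : List IVec) (t : IVec) : Decidable (NuMirrorDerives k t) := by
  unfold NuMirrorDerives; infer_instance

theorem MirrorDerives.mem {X : Set E5} (hX : MirrorClosed X) {k : List IVec}
    (hk : ∀ p ∈ k, toE p ∈ X) {t : IVec} (ht : MirrorDerives k t) : toE t ∈ X := by
  rcases ht with ht | ⟨a, ha, h, hta⟩ | ⟨a, ha, h⟩
  · exact hk t ht
  · rw [← add_sub_cancel a t, toE_add]
    refine hX.add_mem _ (hk a ha) _ (hk _ hta) ?_
    rw [inner_toE, h]; norm_num
  · rw [h.toE_eq]
    exact hX.mirror_mem _ (hk a ha)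

theorem NuMirrorDerives.mem {X : Set E5} (hX : NuMirrorClosed X) {k : List IVec}
    (hk : ∀ p ∈ k, toE p ∈ X) {t : IVec} (ht : NuMirrorDerives k t) : toE t ∈ X := by
  rcases ht with ht | ⟨w, hw, h1, h2, h3, h4⟩ | ⟨a, ha, h1, h2⟩
  · exact ht.mem hX.toMirrorClosed hk
  · have := hX.sub_mem _ (hk w hw) _ (hk _ h4)
      (by
        have h1' : (inu w : ℝ) ^ 2 = 900 := by exact_mod_cast h1
        rw [inner_toE_nu, div_pow, h1']; norm_num)
      (by rw [inner_toE_ones, h3]; norm_num) (by rw [inner_toE, h2]; norm_num)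
    rwa [← toE_sub, sub_sub_cancel] at this
  · rw [h2.toE_eq]
    exact hX.nuMirror_mem _ (hk a ha) (by rw [inner_toE_ones, h1]; norm_num)

/-! ### Linear isometries that preserve the antipodal part -/

theorem inner_map_eq_zero_of_image_eq {L : E5 ≃ₗᵢ[ℝ] E5} {l : List IVec}
    (hL : L '' realize l = realize l) {n : E5} (hn : ∀ p ∈ l, ⟪toE p, n⟫ = 0) {p : IVec}
    (hp : p ∈ l) : ⟪toE p, L n⟫ = 0 := by
  have : toE p ∈ L '' realize l := by rw [hL]; exact ⟨p, hp, rfl⟩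
  obtain ⟨_, ⟨q, hq, rfl⟩, h⟩ := this
  rw [← h, L.inner_map_map]
  exact hn q hq

theorem eq_or_eq_neg_of_eq_smul {L : E5 ≃ₗᵢ[ℝ] E5} {n : E5} (hn : n ≠ 0) {c : ℝ}
    (h : L n = c • n) : L n = n ∨ L n = -n := by
  have h1 := L.norm_map n
  rw [h, norm_smul, mul_eq_right₀ (norm_ne_zero_iff.2 hn), Real.norm_eq_abs] at h1
  rcases eq_or_eq_neg_of_abs_eq h1 with rfl | rfl
  · left; simpa using h
  · right; simpa using h

theorem ones_ne_zero : ones ≠ 0 := by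
  intro h
  have := congrArg (fun v : E5 => v 0) h
  simp [ones] at this

theorem nu_ne_zero : nu ≠ 0 := by
  intro h
  have := congrArg (fun v : E5 => v 0) h
  simp [nu] at this

/-- The `A₄` roots span the hyperplane of coordinate sum `0`, so `L` preserves its normal line,
spanned by `ones`. -/
theorem map_ones_of_preserves_Q5 {L : E5 ≃ₗᵢ[ℝ] E5}
    (hL : L '' realize (iantipodal intQ5) = realize (iantipodal intQ5)) :
    L ones = ones ∨ L ones = -ones := by
  have hsum : ∀ p ∈ iantipodal intQ5, isum p = 0 := by decide +kernel
  have key := fun p hp => inner_map_eq_zero_of_image_eq hL (n := ones) (p := p)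
    (fun q hq => by rw [inner_toE_ones, hsum q hq]; norm_num) hp
  have h0 := key (10, -10, 0, 0, 0) (by decide +kernel)
  have h1 := key (0, 10, -10, 0, 0) (by decide +kernel)
  have h2 := key (0, 0, 10, -10, 0) (by decide +kernel)
  have h3 := key (0, 0, 0, 10, -10) (by decide +kernel)
  refine eq_or_eq_neg_of_eq_smul (c := L ones 0) ones_ne_zero ?_
  rw [inner_eq] at h0 h1 h2 h3
  simp at h0 h1 h2 h3
  apply ext_five <;> simp [ones] at * <;> linarith

/-- The image of a vector orthogonal to the antipodal part of `R₅` has its first four coordinates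
equal. -/
theorem coords_of_orthogonal_R5 {L : E5 ≃ₗᵢ[ℝ] E5}
    (hL : L '' realize (iantipodal intR5) = realize (iantipodal intR5)) {n : E5}
    (hn : ∀ p ∈ iantipodal intR5, ⟪toE p, n⟫ = 0) :
    L n 0 = L n 1 ∧ L n 1 = L n 2 ∧ L n 2 = L n 3 := by
  have key := fun p hp => inner_map_eq_zero_of_image_eq hL (n := n) (p := p) hn hp
  have h0 := key (10, -10, 0, 0, 0) (by decide +kernel)
  have h1 := key (0, 10, -10, 0, 0) (by decide +kernel)
  have h2 := key (0, 0, 10, -10, 0) (by decide +kernel)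
  rw [inner_eq] at h0 h1 h2
  simp at h0 h1 h2
  exact ⟨by linarith, by linarith, by linarith⟩

theorem inner_iantipodal_R5_ones {p : IVec} (hp : p ∈ iantipodal intR5) : ⟪toE p, ones⟫ = 0 := by
  have hsum : ∀ p ∈ iantipodal intR5, isum p = 0 := by decide +kernel
  rw [inner_toE_ones, hsum p hp]; norm_num

theorem inner_iantipodal_R5_nu {p : IVec} (hp : p ∈ iantipodal intR5) : ⟪toE p, nu⟫ = 0 := by
  have hsum : ∀ p ∈ iantipodal intR5, inu p = 0 := by decide +kernel
  rw [inner_toE_nu, hsum p hp]; norm_num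

theorem inner_ones_nu : ⟪ones, nu⟫ = 0 := by
  rw [ones, nu, inner_toE]; simp [idot]

/-- In the plane orthogonal to `A₃`, the vectors orthogonal to `ones` are the multiples of `nu`;
preserving one axis up to sign preserves the other. -/
theorem map_nu_of_map_ones {L : E5 ≃ₗᵢ[ℝ] E5}
    (hL : L '' realize (iantipodal intR5) = realize (iantipodal intR5))
    (h : L ones = ones ∨ L ones = -ones) : L nu = nu ∨ L nu = -nu := by
  obtain ⟨h0, h1, h2⟩ := coords_of_orthogonal_R5 hL fun p => inner_iantipodal_R5_nu (p := p)
  have h3 : ⟪ones, L nu⟫ = 0 := by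
    have h4 := L.inner_map_map ones nu
    rw [inner_ones_nu] at h4
    rcases h with h | h <;> rw [h] at h4
    · exact h4
    · simpa using h4
  refine eq_or_eq_neg_of_eq_smul (c := L nu 0) nu_ne_zero ?_
  rw [inner_eq] at h3
  simp [ones] at h3
  apply ext_five <;> simp [nu] at * <;> linarith

theorem map_ones_of_map_nu {L : E5 ≃ₗᵢ[ℝ] E5}
    (hL : L '' realize (iantipodal intR5) = realize (iantipodal intR5))
    (h : L nu = nu ∨ L nu = -nu) : L ones = ones ∨ L ones = -ones := by
  obtain ⟨h0, h1, h2⟩ := coords_of_orthogonal_R5 hL fun p => inner_iantipodal_R5_ones (p := p)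
  have h3 : ⟪nu, L ones⟫ = 0 := by
    have h4 : ⟪L nu, L ones⟫ = 0 := by rw [L.inner_map_map, real_inner_comm, inner_ones_nu]
    rcases h with h | h <;> rw [h] at h4
    · exact h4
    · simpa using h4
  refine eq_or_eq_neg_of_eq_smul (c := L ones 0) ones_ne_zero ?_
  rw [inner_eq] at h3
  simp [nu] at h3
  apply ext_five <;> simp [ones] at * <;> linarith

/-! ### Packings with kissing configuration `Q₅` -/

/-- The kissing configurations at the neighbors of the origin, when that at the origin is `Q₅`. -/
def ruleQ5 (p : IVec) : List IVec := if -p ∈ intQ5 then intQ5 else intQ5.map fun q => -q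

/-- One round of derivation of the elements of `t` from the list `k`. -/
def mirrorStep (t k : List IVec) : List IVec := t.filter fun p => MirrorDerives k p

/-- Two rounds of the closure rules suffice: `mirrorStep` keeps the target vectors reached in one
round, and the second round reaches the rest. -/
theorem mirrorDerives_Q5 : ∀ r ∈ intQ5, -r ∉ intQ5 → ∀ p ∈ intQ5.map fun q => -q,
    MirrorDerives (mirrorStep (intQ5.map fun q => -q) (knownFrom intQ5 r)) p := by
  decide +kernel

/-- At a neighbor that is not antipodal, the known vectors are those leading to the origin and to
common neighbors, together with the `A₄` roots. Closure under the mirror of `ones` and under sums of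
vectors with product `-1` produces all of `-Q₅`, and the count of 40 turns inclusion into equality.
-/
theorem rule_Q5 (P : Set E5) (hP : IsKissingPacking P kissQ5) (h0 : 0 ∈ P)
    (h0' : kissingConfig P 0 = kissQ5) (r : E5) (hr : r ∈ kissQ5) :
    kissingConfig P r = ruleSet intQ5 ruleQ5 r := by
  have hK := kissingData_Q5
  rw [kissQ5_eq] at *
  obtain ⟨r, hr, rfl⟩ := hr
  have hr : r ∈ intQ5 := hr
  rw [ruleSet_toE hr, ruleQ5]
  split_ifs with hneg
  · exact hP.kissingConfig_of_antipodal hK h0 h0' hr hneg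
  have hrP := IsKissingPacking.toE_mem_of_mem h0' hr
  obtain ⟨L, hL, hLA⟩ := hP.exists_linearIsometryEquiv hK h0 h0' hrP
  have hX : MirrorClosed (kissingConfig P (toE r)) :=
    hL ▸ mirrorClosed_Q5.image (map_ones_of_preserves_Q5 hLA)
  refine hP.kissingConfig_eq_realize hK hrP (by decide +kernel) (by decide +kernel)
    (by decide +kernel) fun p hp => ?_
  refine (mirrorDerives_Q5 r hr hneg p hp).mem hX fun q hq => ?_
  simp only [mirrorStep, List.mem_filter, decide_eq_true_eq] at hq
  exact hq.2.mem hX fun z hz => hP.knownFrom_mem hK h0 h0' hrP hz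

/-! ### Packings with kissing configuration `R₅` -/

/-- The isometry that is `-1` on the span of the antipodal part of `R₅` and `1` on its orthogonal
complement. -/
def isigma (p : IVec) : IVec :=
  let c := (p.1 + p.2.1 + p.2.2.1 + p.2.2.2.1) / 2
  (c - p.1, c - p.2.1, c - p.2.2.1, c - p.2.2.2.1, p.2.2.2.2)

/-- The kissing configurations at the neighbors of the origin, when that at the origin is `R₅`. -/
def ruleR5 (p : IVec) : List IVec :=
  if -p ∈ intR5 then intR5
  else if isum p = 0 then intR5.map isigma
  else if inu p = 30 then intR5.map fun q => -q
  else intR5.map fun q => -isigma q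

/-- One round of derivation of the elements of `t` from the list `k`. -/
def nuMirrorStep (t k : List IVec) : List IVec := t.filter fun p => NuMirrorDerives k p

theorem NuMirrorDerives.mem_of_step {X : Set E5} (hX : NuMirrorClosed X) {t k : List IVec}
    (hk : ∀ p ∈ k, toE p ∈ X) {p : IVec} (hp : NuMirrorDerives (nuMirrorStep t k) p) :
    toE p ∈ X := by
  refine hp.mem hX fun q hq => ?_
  simp only [nuMirrorStep, List.mem_filter, decide_eq_true_eq] at hq
  exact hq.2.mem hX hk

theorem ruleR5_length_nodup (r : IVec) :
    (ruleR5 r).Nodup ∧ (ruleR5 r).length = intR5.length := by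
  have h0 : intR5.Nodup := by decide +kernel
  have h1 : (intR5.map isigma).Nodup := by decide +kernel
  have h2 : (intR5.map fun q => -q).Nodup := by decide +kernel
  have h3 : (intR5.map fun q => -isigma q).Nodup := by decide +kernel
  unfold ruleR5
  split_ifs
  · exact ⟨h0, rfl⟩
  · exact ⟨h1, by simp⟩
  · exact ⟨h2, by simp⟩
  · exact ⟨h3, by simp⟩

/-- Preserving `A₃` still allows `L` to rotate the plane of `ones` and `nu`. A known pair with
product `2/5` and difference `(4/5) • ones` excludes this, since `sub_eq_of_idot_eq_forty` forces
its preimage under `L` to have difference `±(4/5) • ones`. -/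
theorem exists_mirror_pair_of_isum_eq_zero : ∀ r ∈ intR5, isum r = 0 → -r ∉ intR5 →
    ∃ a ∈ knownFrom intR5 r, idot a (a - (8, 8, 8, 8, 8)) = 40 ∧
      a - (8, 8, 8, 8, 8) ∈ knownFrom intR5 r := by
  decide +kernel

theorem sub_eq_of_idot_eq_forty : ∀ a ∈ intR5, ∀ b ∈ intR5, idot a b = 40 →
    a - b = (8, 8, 8, 8, 8) ∨ a - b = (-8, -8, -8, -8, -8) := by
  decide +kernel

theorem nuMirrorDerives_of_isum_eq_zero : ∀ r ∈ intR5, isum r = 0 → -r ∉ intR5 →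
    ∀ p ∈ ruleR5 r, NuMirrorDerives (nuMirrorStep (ruleR5 r) (knownFrom intR5 r)) p := by
  decide +kernel

theorem rule_R5_of_isum_eq_zero {P : Set E5} (hP : IsKissingPacking P (realize intR5))
    (hK : KissingData (realize intR5) (innerSet [-50, 40]))
    (h0 : 0 ∈ P) (h0' : kissingConfig P 0 = realize intR5) {r : IVec} (hr : r ∈ intR5)
    (hs : isum r = 0) : kissingConfig P (toE r) = realize (ruleR5 r) := by
  by_cases hneg : -r ∈ intR5
  · rw [ruleR5, if_pos hneg]
    exact hP.kissingConfig_of_antipodal hK h0 h0' hr hneg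
  have hrP := IsKissingPacking.toE_mem_of_mem h0' hr
  obtain ⟨L, hL, hLA⟩ := hP.exists_linearIsometryEquiv hK h0 h0' hrP
  have hones : L ones = ones ∨ L ones = -ones := by
    obtain ⟨a, ha, hab, hb⟩ := exists_mirror_pair_of_isum_eq_zero r hr hs hneg
    have ha' := hP.knownFrom_mem hK h0 h0' hrP ha
    have hb' := hP.knownFrom_mem hK h0 h0' hrP hb
    rw [hL] at ha' hb'
    obtain ⟨_, ⟨a', ha', rfl⟩, h1⟩ := ha'
    obtain ⟨_, ⟨b', hb', rfl⟩, h2⟩ := hb'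
    have h3 : ⟪L (toE a'), L (toE b')⟫ = ((40 : ℤ) : ℝ) / 100 := by
      rw [h1, h2, inner_toE_eq_iff, hab]
    rw [L.inner_map_map, inner_toE_eq_iff] at h3
    have h4 : L (toE (a' - b')) = toE (8, 8, 8, 8, 8) := by
      rw [toE_sub, map_sub, h1, h2, ← toE_sub, sub_sub_cancel]
    have e1 : toE (8, 8, 8, 8, 8) = (4 / 5 : ℝ) • ones := by
      apply ext_five <;> simp [ones] <;> norm_num
    have e2 : toE (-8, -8, -8, -8, -8) = (-(4 / 5) : ℝ) • ones := by
      apply ext_five <;> simp [ones] <;> norm_num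
    rcases sub_eq_of_idot_eq_forty a' ha' b' hb' h3 with h | h
    · rw [h, e1, map_smul, (smul_right_injective E5 (by norm_num : (4 / 5 : ℝ) ≠ 0)).eq_iff] at h4
      exact Or.inl h4
    · rw [h, e1, e2, map_smul, neg_smul, ← smul_neg,
        (smul_right_injective E5 (by norm_num : (4 / 5 : ℝ) ≠ 0)).eq_iff] at h4
      exact Or.inr (neg_eq_iff_eq_neg.1 h4)
  have hX : NuMirrorClosed (kissingConfig P (toE r)) :=
    hL ▸ nuMirrorClosed_R5.image hones (map_nu_of_map_ones hLA hones)
  refine hP.kissingConfig_eq_realize hK hrP (by decide +kernel) (ruleR5_length_nodup r).1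
    (ruleR5_length_nodup r).2 fun p hp => ?_
  exact (nuMirrorDerives_of_isum_eq_zero r hr hs hneg p hp).mem_of_step hX fun z hz =>
    hP.knownFrom_mem hK h0 h0' hrP hz

/-- The elements of `ruleR5 r` that lead from `r` to neighbors of the origin or of the neighbors of
the origin with coordinate sum `0`. -/
def knownFromR5 (r : IVec) : List IVec :=
  (ruleR5 r).filter fun p => p ∈ knownFrom intR5 r ∨
    idot p p = 200 ∧ ∃ u ∈ intR5.filter fun u => isum u = 0 ∧ inu u ≠ 0, r + p - u ∈ ruleR5 u

theorem knownFromR5_mem {P : Set E5} (hP : IsKissingPacking P (realize intR5))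
    (hK : KissingData (realize intR5) (innerSet [-50, 40]))
    (h0 : 0 ∈ P) (h0' : kissingConfig P 0 = realize intR5) {r w : IVec} (hr : toE r ∈ P)
    (hw : w ∈ knownFromR5 r) : toE w ∈ kissingConfig P (toE r) := by
  simp only [knownFromR5, List.mem_filter, decide_eq_true_eq] at hw
  rcases hw.2 with hw | ⟨hw, u, ⟨hu, hs, -⟩, hz⟩
  · exact hP.knownFrom_mem hK h0 h0' hr hw
  refine toE_mem_kissingConfig ?_ hw
  have : toE (r + w - u) ∈ kissingConfig P (toE u) := by
    rw [rule_R5_of_isum_eq_zero hP hK h0 h0' hu hs]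
    exact ⟨_, hz, rfl⟩
  have := this.1
  rwa [← toE_add, add_sub_cancel] at this

/-- The counterpart of `exists_mirror_pair_of_isum_eq_zero` for the axis `nu`, using also the points
found around the neighbors of coordinate sum `0`. Product `-1/2` does not determine the difference
by itself, so `sub_eq_of_idot_eq_neg_fifty` requires in addition orthogonality to `A₃`. -/
theorem exists_nuMirror_pair : ∀ r ∈ intR5, isum r ≠ 0 → ∃ a ∈ knownFromR5 r,
    idot a (a - (5, 5, 5, 5, -20)) = -50 ∧ a - (5, 5, 5, 5, -20) ∈ knownFromR5 r := by
  decide +kernel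

theorem sub_eq_of_idot_eq_neg_fifty : ∀ a ∈ intR5, ∀ b ∈ intR5, idot a b = -50 →
    (∀ c ∈ iantipodal intR5, idot c (a - b) = 0) →
    a - b = (5, 5, 5, 5, -20) ∨ a - b = (-5, -5, -5, -5, 20) := by
  decide +kernel

theorem nuMirrorDerives_of_isum_ne_zero : ∀ r ∈ intR5, isum r ≠ 0 →
    ∀ p ∈ ruleR5 r, NuMirrorDerives (nuMirrorStep (ruleR5 r) (knownFromR5 r)) p := by
  decide +kernel

theorem rule_R5 (P : Set E5) (hP : IsKissingPacking P kissR5) (h0 : 0 ∈ P)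
    (h0' : kissingConfig P 0 = kissR5) (r : E5) (hr : r ∈ kissR5) :
    kissingConfig P r = ruleSet intR5 ruleR5 r := by
  have hK := kissingData_R5
  rw [kissR5_eq] at *
  obtain ⟨r, hr, rfl⟩ := hr
  have hr : r ∈ intR5 := hr
  rw [ruleSet_toE hr]
  by_cases hs : isum r = 0
  · exact rule_R5_of_isum_eq_zero hP hK h0 h0' hr hs
  have hrP := IsKissingPacking.toE_mem_of_mem h0' hr
  obtain ⟨L, hL, hLA⟩ := hP.exists_linearIsometryEquiv hK h0 h0' hrP
  have hnu : L nu = nu ∨ L nu = -nu := by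
    obtain ⟨a, ha, hab, hb⟩ := exists_nuMirror_pair r hr hs
    have ha' := knownFromR5_mem hP hK h0 h0' hrP ha
    have hb' := knownFromR5_mem hP hK h0 h0' hrP hb
    rw [hL] at ha' hb'
    obtain ⟨_, ⟨a', ha', rfl⟩, h1⟩ := ha'
    obtain ⟨_, ⟨b', hb', rfl⟩, h2⟩ := hb'
    have h3 : ⟪L (toE a'), L (toE b')⟫ = ((-50 : ℤ) : ℝ) / 100 := by
      rw [h1, h2, inner_toE_eq_iff, hab]
    rw [L.inner_map_map, inner_toE_eq_iff] at h3
    have h4 : L (toE (a' - b')) = toE (5, 5, 5, 5, -20) := by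
      rw [toE_sub, map_sub, h1, h2, ← toE_sub, sub_sub_cancel]
    have e1 : toE (5, 5, 5, 5, -20) = (1 / 2 : ℝ) • nu := by
      apply ext_five <;> simp [nu] <;> norm_num
    have e2 : toE (-5, -5, -5, -5, 20) = (-(1 / 2) : ℝ) • nu := by
      apply ext_five <;> simp [nu] <;> norm_num
    -- The image `(1/2) • nu` is orthogonal to `A₃`, and `L` permutes the `A₃` roots, so the
    -- original difference is orthogonal to them too.
    have h5 : ∀ c ∈ iantipodal intR5, idot c (a' - b') = 0 := by
      intro c hc
      have h6 : L (toE c) ∈ realize (iantipodal intR5) := hLA ▸ ⟨_, ⟨c, hc, rfl⟩, rfl⟩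
      obtain ⟨c', hc', h7⟩ := h6
      have h8 := L.inner_map_map (toE c) (toE (a' - b'))
      rw [h4, ← h7, e1, inner_smul_right, inner_iantipodal_R5_nu hc', mul_zero, inner_toE] at h8
      have h9 : (idot c (a' - b') : ℝ) = 0 := by linarith
      exact_mod_cast h9
    rcases sub_eq_of_idot_eq_neg_fifty a' ha' b' hb' h3 h5 with h | h
    · rw [h, e1, map_smul, (smul_right_injective E5 (by norm_num : (1 / 2 : ℝ) ≠ 0)).eq_iff] at h4
      exact Or.inl h4
    · rw [h, e1, e2, map_smul, neg_smul, ← smul_neg,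
        (smul_right_injective E5 (by norm_num : (1 / 2 : ℝ) ≠ 0)).eq_iff] at h4
      exact Or.inr (neg_eq_iff_eq_neg.1 h4)
  have hX : NuMirrorClosed (kissingConfig P (toE r)) :=
    hL ▸ nuMirrorClosed_R5.image (map_ones_of_map_nu hLA hnu) hnu
  refine hP.kissingConfig_eq_realize hK hrP (by decide +kernel) (ruleR5_length_nodup r).1
    (ruleR5_length_nodup r).2 fun p hp => ?_
  exact (nuMirrorDerives_of_isum_ne_zero r hr hs p hp).mem_of_step hX fun z hz =>
    knownFromR5_mem hP hK h0 h0' hrP hz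

/-! ### Uniform packings from their shape around the origin -/

theorem image_eq_of_forall {P : Set E5} {g : E5 ≃ᵢ E5} (h : ∀ v ∈ P, g v ∈ P)
    (h' : ∀ v ∈ P, ∃ w ∈ P, g w = v) : g '' P = P := by
  refine Set.Subset.antisymm ?_ fun v hv => h' v hv
  rintro _ ⟨v, hv, rfl⟩
  exact h v hv

theorem isUniform_of_origin {P : Set E5}
    (hu : ∀ x ∈ P, ∃ g : E5 ≃ᵢ E5, g '' P = P ∧ g 0 = x) : IsUniform P := by
  intro x hx y hy
  obtain ⟨f, hf, hfx⟩ := hu x hx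
  obtain ⟨g, hg, hgy⟩ := hu y hy
  refine ⟨f.symm.trans g, ?_, ?_⟩
  · have h1 : f.symm '' P = P := by
      conv_lhs => rw [← hf]
      rw [Set.image_image]; simp
    have h2 : (f.symm.trans g) '' P = g '' (f.symm '' P) := by rw [Set.image_image]; rfl
    rw [h2, h1, hg]
  · rw [IsometryEquiv.trans_apply, ← hfx, f.symm_apply_apply, hgy]

/-- Symmetries carry the origin to every center, so separation and contacts need checking only
there. -/
theorem mem_uniformPackings_of_origin {P K : Set E5} (h0 : 0 ∈ P)
    (hu : ∀ x ∈ P, ∃ g : E5 ≃ᵢ E5, g '' P = P ∧ g 0 = x)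
    (h2 : ∀ v ∈ P, v ≠ 0 → 2 ≤ ⟪v, v⟫) (hK : ∀ v, v ∈ K ↔ v ∈ P ∧ ⟪v, v⟫ = 2) :
    P ∈ uniformPackings K := by
  refine ⟨?_, isUniform_of_origin hu, ⟨0, h0⟩, fun x hx => ?_⟩
  · intro x hx y hy hxy
    obtain ⟨g, hg, rfl⟩ := hu x hx
    rw [← hg] at hy
    obtain ⟨z, hz, rfl⟩ := hy
    have hz0 : z ≠ 0 := by rintro rfl; exact hxy rfl
    change √2 ≤ dist _ _
    rw [g.dist_eq, dist_comm, dist_zero_right, sqrt_two_le_norm]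
    exact h2 z hz hz0
  · obtain ⟨g, hg, rfl⟩ := hu x hx
    refine ⟨linPart g, ?_⟩
    have h := kissingConfig_image g P 0
    rw [hg] at h
    rw [h]
    congr 1
    ext v
    rw [hK, mem_kissingConfig, zero_add, norm_eq_sqrt_two]

/-! ### The lattice `D₅` -/

/-- Since `n² ≡ n` modulo `2`, an integral vector has even squared norm exactly when its coordinate
sum is even. Translations by lattice vectors give uniformity. -/
theorem packingD5_mem_uniformPackings : packingD5 ∈ uniformPackings kissD5 := by
  have hadd : ∀ x ∈ packingD5, ∀ y ∈ packingD5, x + y ∈ packingD5 := by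
    rintro x ⟨hx, a, ha⟩ y ⟨hy, b, hb⟩
    refine ⟨fun i => ?_, a + b, ?_⟩
    · obtain ⟨m, hm⟩ := hx i
      obtain ⟨n, hn⟩ := hy i
      exact ⟨m + n, by simp [hm, hn]⟩
    · simp only [PiLp.add_apply, Finset.sum_add_distrib, ha, hb]
      push_cast; ring
  have hneg : ∀ x ∈ packingD5, -x ∈ packingD5 := by
    rintro x ⟨hx, a, ha⟩
    refine ⟨fun i => ?_, -a, ?_⟩
    · obtain ⟨m, hm⟩ := hx i
      exact ⟨-m, by simp [hm]⟩
    · simp only [PiLp.neg_apply, Finset.sum_neg_distrib, ha]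
      push_cast; ring
  have hnorm : ∀ v ∈ packingD5, ∃ n : Fin 5 → ℤ, (∀ i, v i = n i) ∧
      ⟪v, v⟫ = ((∑ i, n i ^ 2 : ℤ) : ℝ) ∧ ∃ k, ∑ i, n i ^ 2 = 2 * k := by
    rintro v ⟨hv, k, hk⟩
    choose n hn using hv
    refine ⟨n, hn, ?_, ?_⟩
    · rw [inner_self_eq_sum]
      simp [hn]
    · simp only [hn] at hk
      have hk' : ∑ i, n i = 2 * k := by exact_mod_cast hk
      have hpar : ∀ i, ∃ c, n i ^ 2 = n i + 2 * c := by
        intro i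
        obtain ⟨c, hc⟩ := Int.even_mul_pred_self (n i)
        exact ⟨c, by linarith [sq (n i)]⟩
      choose c hc using hpar
      exact ⟨k + ∑ i, c i, by simp only [hc, Finset.sum_add_distrib, ← Finset.mul_sum, hk']; ring⟩
  refine mem_uniformPackings_of_origin ⟨fun i => ⟨0, by simp⟩, 0, by simp⟩ ?_ ?_ ?_
  · intro x hx
    refine ⟨moveIsometry (LinearIsometryEquiv.refl ℝ E5) 0 x, image_eq_of_forall ?_ ?_, ?_⟩
    · intro v hv
      rw [moveIsometry_apply]
      simpa using hadd v hv x hx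
    · intro v hv
      exact ⟨v + -x, hadd v hv _ (hneg x hx), by simp [moveIsometry_apply]⟩
    · simp [moveIsometry_apply]
  · intro v hv hv0
    obtain ⟨n, -, hn, k, hk⟩ := hnorm v hv
    have hpos : 0 < ⟪v, v⟫ := real_inner_self_pos.2 hv0
    rw [hn] at hpos ⊢
    norm_cast at hpos ⊢
    omega
  · intro v
    constructor
    · rintro ⟨hv, hsum⟩
      have hv' : ∀ i, ∃ n : ℤ, v i = n := by
        intro i
        rcases hv i with h | h | h
        exacts [⟨-1, by simp [h]⟩, ⟨0, by simp [h]⟩, ⟨1, by simp [h]⟩]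
      refine ⟨⟨hv', ?_⟩, by rw [inner_self_eq_sum, hsum]⟩
      choose n hn using hv'
      have hpar : ∀ i, ∃ c, n i = n i ^ 2 + 2 * c := by
        intro i
        obtain ⟨c, hc⟩ := Int.even_mul_pred_self (n i)
        exact ⟨-c, by linarith [sq (n i)]⟩
      choose c hc using hpar
      simp only [hn] at hsum ⊢
      have hsum' : ∑ i, n i ^ 2 = 2 := by exact_mod_cast hsum
      refine ⟨1 + ∑ i, c i, ?_⟩
      have : ∑ i, n i = 2 * (1 + ∑ i, c i) := by
        rw [Finset.sum_congr rfl fun i _ => hc i, Finset.sum_add_distrib, hsum', ← Finset.mul_sum]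
        ring
      exact_mod_cast this
    · rintro ⟨hv, h2⟩
      obtain ⟨n, hn, hnn, -⟩ := hnorm v hv
      rw [hnn] at h2
      have h2' : ∑ i, n i ^ 2 = 2 := by exact_mod_cast h2
      refine ⟨fun i => ?_, by simp only [hn]; exact_mod_cast h2'⟩
      have h3 : n i ^ 2 ≤ 2 := by
        rw [← h2']
        exact Finset.single_le_sum (f := fun i => n i ^ 2) (fun j _ => sq_nonneg _)
          (Finset.mem_univ i)
      have h4 : -1 ≤ n i := by nlinarith
      have h5 : n i ≤ 1 := by nlinarith
      rw [hn]
      interval_cases n i <;> simp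

/-! ### The packing with kissing configuration `Q₅` -/

theorem mem_translatesOf {m : ℕ} {b : Fin 5 → E5} {x : Fin m → E5} {v : E5} :
    v ∈ translatesOf b x ↔ ∃ i, ∃ c : Fin 5 → ℤ, v = x i + ∑ j, c j • b j := by
  simp only [translatesOf, Set.mem_ofPred_eq, Submodule.mem_span_range_iff_exists_fun]
  refine exists_congr fun i => exists_congr fun c => ?_
  rw [eq_comm, sub_eq_iff_eq_add']

/-- The vectors `z + (4 m / 5) (1, 1, 1, 1, 1)` with `z` integral and with coordinate sum `s`. -/
def IsQ5 (s : ℤ) (v : E5) : Prop :=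
  ∃ z0 z1 z2 z3 z4 m : ℤ, z0 + z1 + z2 + z3 + z4 = s ∧ v 0 = z0 + 4 / 5 * m ∧
    v 1 = z1 + 4 / 5 * m ∧ v 2 = z2 + 4 / 5 * m ∧ v 3 = z3 + 4 / 5 * m ∧ v 4 = z4 + 4 / 5 * m

theorem mem_packingQ5 {v : E5} : v ∈ packingQ5 ↔ IsQ5 0 v ∨ IsQ5 (-2) v := by
  rw [packingQ5, mem_translatesOf]
  constructor
  · rintro ⟨i, c, rfl⟩
    have key : ∀ y3 y4 : ℤ,
        IsQ5 (y3 + y4) (!₂[0, 0, 0, (y3 : ℝ), (y4 : ℝ)] + ∑ j, c j •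
          (![!₂[1, -1, 0, 0, 0], !₂[0, 1, -1, 0, 0], !₂[0, 0, 1, -1, 0], !₂[0, 0, 0, 1, -1],
            !₂[4 / 5, 4 / 5, 4 / 5, 4 / 5, 4 / 5]] j : E5)) := by
      intro y3 y4
      refine ⟨c 0, c 1 - c 0, c 2 - c 1, y3 + c 3 - c 2, y4 - c 3, c 4, by ring, ?_, ?_, ?_, ?_, ?_⟩
      all_goals simp [Fin.sum_univ_five]; ring
    fin_cases i
    · left
      simpa using key 0 0
    · right
      simpa using key (-1) (-1)
  · have key : ∀ y3 y4 : ℤ, IsQ5 (y3 + y4) v → ∃ c : Fin 5 → ℤ,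
        v = !₂[0, 0, 0, (y3 : ℝ), (y4 : ℝ)] + ∑ j, c j •
          (![!₂[1, -1, 0, 0, 0], !₂[0, 1, -1, 0, 0], !₂[0, 0, 1, -1, 0], !₂[0, 0, 0, 1, -1],
            !₂[4 / 5, 4 / 5, 4 / 5, 4 / 5, 4 / 5]] j : E5) := by
      rintro y3 y4 ⟨z0, z1, z2, z3, z4, m, hs, h0, h1, h2, h3, h4⟩
      have hs' : (z4 : ℝ) = y3 + y4 - z0 - z1 - z2 - z3 := by
        rw [eq_sub_iff_add_eq, eq_sub_iff_add_eq, eq_sub_iff_add_eq, eq_sub_iff_add_eq]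
        norm_cast
        linarith
      -- Partial sums of `z`, corrected by the offset, are its coordinates in the simple roots of
      -- `A₄`.
      refine ⟨![z0, z0 + z1, z0 + z1 + z2, z0 + z1 + z2 + z3 - y3, m], ?_⟩
      apply ext_five <;> simp [Fin.sum_univ_five, *] <;> ring
    rintro (h | h)
    · obtain ⟨c, hc⟩ := key 0 0 h
      exact ⟨0, c, by simpa using hc⟩
    · obtain ⟨c, hc⟩ := key (-1) (-1) (by simpa using h)
      exact ⟨1, c, by simpa using hc⟩

theorem IsQ5.add {s t : ℤ} {v w : E5} (hv : IsQ5 s v) (hw : IsQ5 t w) : IsQ5 (s + t) (v + w) := by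
  obtain ⟨z0, z1, z2, z3, z4, m, hs, h0, h1, h2, h3, h4⟩ := hv
  obtain ⟨y0, y1, y2, y3, y4, n, ht, e0, e1, e2, e3, e4⟩ := hw
  refine ⟨z0 + y0, z1 + y1, z2 + y2, z3 + y3, z4 + y4, m + n, by linarith, ?_⟩
  simp only [PiLp.add_apply, *]
  push_cast
  refine ⟨?_, ?_, ?_, ?_, ?_⟩ <;> ring

theorem IsQ5.neg {s : ℤ} {v : E5} (hv : IsQ5 s v) : IsQ5 (-s) (-v) := by
  obtain ⟨z0, z1, z2, z3, z4, m, hs, h0, h1, h2, h3, h4⟩ := hv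
  refine ⟨-z0, -z1, -z2, -z3, -z4, -m, by linarith, ?_⟩
  simp only [PiLp.neg_apply, *]
  push_cast
  refine ⟨?_, ?_, ?_, ?_, ?_⟩ <;> ring

theorem inner_self_eq_of_eq {v : E5} {z0 z1 z2 z3 z4 m : ℤ} (h0 : v 0 = z0 + 4 / 5 * m)
    (h1 : v 1 = z1 + 4 / 5 * m) (h2 : v 2 = z2 + 4 / 5 * m) (h3 : v 3 = z3 + 4 / 5 * m)
    (h4 : v 4 = z4 + 4 / 5 * m) :
    ⟪v, v⟫ = ((5 * (z0 ^ 2 + z1 ^ 2 + z2 ^ 2 + z3 ^ 2 + z4 ^ 2) +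
      8 * m * (z0 + z1 + z2 + z3 + z4) + 16 * m ^ 2 : ℤ) : ℝ) / 5 := by
  rw [inner_eq, h0, h1, h2, h3, h4]
  push_cast
  ring

theorem div_five_eq_two {n : ℤ} : (n : ℝ) / 5 = 2 ↔ n = 10 := by
  rw [div_eq_iff (by norm_num), show (2 : ℝ) * 5 = ((10 : ℤ) : ℝ) by norm_num, Int.cast_inj]

theorem two_le_div_five {n : ℤ} : 2 ≤ (n : ℝ) / 5 ↔ 10 ≤ n := by
  rw [le_div_iff₀ (by norm_num), show (2 : ℝ) * 5 = ((10 : ℤ) : ℝ) by norm_num, Int.cast_le]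

theorem two_dvd_sq_sub_self (z : ℤ) : 2 ∣ z ^ 2 - z := by
  obtain ⟨c, hc⟩ := Int.even_mul_pred_self z
  exact ⟨c, by linarith [sq z]⟩

/-- Five times the squared norm is `5q + 16m²` for `s = 0` and `5q + 16m(m - 1)` for `s = -2`, with
`q` even. In the second case the minima `m = 0` and `m = 1` are the layers of coordinate sum `-2`
and `2`, mirror images of each other. -/
theorem Q5_form_bound {q s m : ℤ} (hq : 0 ≤ q) (hqs : 2 ∣ q - s)
    (h : s = 0 ∨ s = -2 ∧ 0 < q) : (q = 0 ∧ m = 0 ∧ s = 0) ∨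
    10 ≤ 5 * q + 8 * m * s + 16 * m ^ 2 ∧
      (5 * q + 8 * m * s + 16 * m ^ 2 = 10 → q = 2 ∧ (m = 0 ∨ m = 1 ∧ s = -2)) := by
  rcases h with rfl | ⟨rfl, hq0⟩
  · rcases eq_or_ne m 0 with rfl | hm
    · omega
    · have : 0 < m ^ 2 := by positivity
      omega
  · have h1 : 0 ≤ m ^ 2 - m := by nlinarith [mul_self_nonneg (2 * m - 1)]
    refine Or.inr ⟨by omega, fun h => ⟨by omega, ?_⟩⟩
    have h2 : m * (m - 1) = 0 := by nlinarith [show m ^ 2 - m = 0 by omega]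
    rcases mul_eq_zero.1 h2 with h | h
    · exact Or.inl h
    · exact Or.inr ⟨by omega, rfl⟩

theorem int_eq_neg_one_or {z : ℤ} (h : z ^ 2 ≤ 2) : z ∈ [(-1 : ℤ), 0, 1] := by
  have h4 : -1 ≤ z := by nlinarith
  have h5 : z ≤ 1 := by nlinarith
  interval_cases z <;> simp

theorem Q5_form (z0 z1 z2 z3 z4 m : ℤ)
    (hs : z0 + z1 + z2 + z3 + z4 = 0 ∨ z0 + z1 + z2 + z3 + z4 = -2) :
    (z0 = 0 ∧ z1 = 0 ∧ z2 = 0 ∧ z3 = 0 ∧ z4 = 0 ∧ m = 0) ∨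
    10 ≤ 5 * (z0 ^ 2 + z1 ^ 2 + z2 ^ 2 + z3 ^ 2 + z4 ^ 2) +
        8 * m * (z0 + z1 + z2 + z3 + z4) + 16 * m ^ 2 ∧
      (5 * (z0 ^ 2 + z1 ^ 2 + z2 ^ 2 + z3 ^ 2 + z4 ^ 2) +
        8 * m * (z0 + z1 + z2 + z3 + z4) + 16 * m ^ 2 = 10 →
        z0 ^ 2 + z1 ^ 2 + z2 ^ 2 + z3 ^ 2 + z4 ^ 2 = 2 ∧
        (m = 0 ∨ m = 1 ∧ z0 + z1 + z2 + z3 + z4 = -2)) := by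
  have q0 := sq_nonneg z0
  have q1 := sq_nonneg z1
  have q2 := sq_nonneg z2
  have q3 := sq_nonneg z3
  have q4 := sq_nonneg z4
  have p0 := two_dvd_sq_sub_self z0
  have p1 := two_dvd_sq_sub_self z1
  have p2 := two_dvd_sq_sub_self z2
  have p3 := two_dvd_sq_sub_self z3
  have p4 := two_dvd_sq_sub_self z4
  have hzero : z0 ^ 2 + z1 ^ 2 + z2 ^ 2 + z3 ^ 2 + z4 ^ 2 = 0 →
      z0 = 0 ∧ z1 = 0 ∧ z2 = 0 ∧ z3 = 0 ∧ z4 = 0 := by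
    intro h
    refine ⟨?_, ?_, ?_, ?_, ?_⟩ <;> refine (pow_eq_zero_iff two_ne_zero).1 ?_ <;> omega
  have hs' : z0 + z1 + z2 + z3 + z4 = 0 ∨ z0 + z1 + z2 + z3 + z4 = -2 ∧
      0 < z0 ^ 2 + z1 ^ 2 + z2 ^ 2 + z3 ^ 2 + z4 ^ 2 := by
    rcases hs with h | h
    · exact Or.inl h
    · refine Or.inr ⟨h, lt_of_le_of_ne (by omega) fun h0 => ?_⟩
      have := hzero h0.symm
      omega
  rcases Q5_form_bound (m := m) (by omega) (by omega) hs' with ⟨h1, h2, -⟩ | h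
  · have := hzero h1
    exact Or.inl ⟨this.1, this.2.1, this.2.2.1, this.2.2.2.1, this.2.2.2.2, h2⟩
  · exact Or.inr h

theorem mem_kissQ5_iff {v : E5} : v ∈ kissQ5 ↔ v ∈ packingQ5 ∧ ⟪v, v⟫ = 2 := by
  rw [kissQ5_eq, mem_packingQ5]
  constructor
  · rintro ⟨p, hp, rfl⟩
    have hp : p ∈ intQ5 := hp
    have key : ∀ p ∈ intQ5, idot p p = 200 ∧ ∃ m ∈ [(0 : ℤ), 1], ∃ s ∈ [(0 : ℤ), -2],
        isum p - 40 * m = 10 * s ∧ 10 ∣ p.1 - 8 * m ∧ 10 ∣ p.2.1 - 8 * m ∧ 10 ∣ p.2.2.1 - 8 * m ∧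
        10 ∣ p.2.2.2.1 - 8 * m ∧ 10 ∣ p.2.2.2.2 - 8 * m := by decide +kernel
    obtain ⟨h, m, -, s, hs, hsum, ⟨z0, h0⟩, ⟨z1, h1⟩, ⟨z2, h2⟩, ⟨z3, h3⟩, ⟨z4, h4⟩⟩ := key p hp
    have hQ : IsQ5 s (toE p) := by
      refine ⟨z0, z1, z2, z3, z4, m, ?_, ?_⟩
      · simp only [isum] at hsum
        omega
      · rify at h0 h1 h2 h3 h4
        simp only [toE_zero_coord, toE_one_coord, toE_two_coord, toE_three_coord, toE_four_coord]
        refine ⟨?_, ?_, ?_, ?_, ?_⟩ <;> linarith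
    refine ⟨?_, by rw [inner_toE, h]; norm_num⟩
    simp only [List.mem_cons, List.not_mem_nil, or_false] at hs
    rcases hs with rfl | rfl
    exacts [Or.inl hQ, Or.inr hQ]
  · have key : ∀ m ∈ [(0 : ℤ), 1], ∀ z0 ∈ [(-1 : ℤ), 0, 1], ∀ z1 ∈ [(-1 : ℤ), 0, 1],
        ∀ z2 ∈ [(-1 : ℤ), 0, 1], ∀ z3 ∈ [(-1 : ℤ), 0, 1], ∀ z4 ∈ [(-1 : ℤ), 0, 1],
        z0 ^ 2 + z1 ^ 2 + z2 ^ 2 + z3 ^ 2 + z4 ^ 2 = 2 →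
        (z0 + z1 + z2 + z3 + z4 = 0 ∧ m = 0 ∨ z0 + z1 + z2 + z3 + z4 = -2) →
        (10 * z0 + 8 * m, 10 * z1 + 8 * m, 10 * z2 + 8 * m, 10 * z3 + 8 * m, 10 * z4 + 8 * m) ∈
          intQ5 := by decide +kernel
    rintro ⟨hv, h⟩
    have main : ∀ s, IsQ5 s v → (s = 0 ∨ s = -2) → v ∈ realize intQ5 := by
      rintro s ⟨z0, z1, z2, z3, z4, m, rfl, h0, h1, h2, h3, h4⟩ hs
      rcases Q5_form z0 z1 z2 z3 z4 m hs with ⟨rfl, rfl, rfl, rfl, rfl, rfl⟩ | ⟨-, hmin⟩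
      · rw [inner_self_eq_of_eq h0 h1 h2 h3 h4] at h
        norm_num at h
      rw [inner_self_eq_of_eq h0 h1 h2 h3 h4, div_five_eq_two] at h
      obtain ⟨hsq, hm⟩ := hmin h
      have q0 := sq_nonneg z0
      have q1 := sq_nonneg z1
      have q2 := sq_nonneg z2
      have q3 := sq_nonneg z3
      have q4 := sq_nonneg z4
      refine ⟨_, key m ?_ z0 (int_eq_neg_one_or (by omega)) z1 (int_eq_neg_one_or (by omega))
        z2 (int_eq_neg_one_or (by omega)) z3 (int_eq_neg_one_or (by omega))
        z4 (int_eq_neg_one_or (by omega)) hsq ?_, ?_⟩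
      · rcases hm with rfl | ⟨rfl, -⟩ <;> simp
      · rcases hm with rfl | ⟨-, h⟩
        · rcases hs with h | h
          exacts [Or.inl ⟨h, rfl⟩, Or.inr h]
        · exact Or.inr h
      · apply ext_five <;> simp [h0, h1, h2, h3, h4] <;> ring
    rcases hv with hv | hv
    exacts [main _ hv (Or.inl rfl), main _ hv (Or.inr rfl)]

theorem two_le_of_mem_packingQ5 {v : E5} (hv : v ∈ packingQ5) (hv0 : v ≠ 0) : 2 ≤ ⟪v, v⟫ := by
  have main : ∀ s, IsQ5 s v → (s = 0 ∨ s = -2) → 2 ≤ ⟪v, v⟫ := by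
    rintro s ⟨z0, z1, z2, z3, z4, m, rfl, h0, h1, h2, h3, h4⟩ hs
    rcases Q5_form z0 z1 z2 z3 z4 m hs with ⟨rfl, rfl, rfl, rfl, rfl, rfl⟩ | ⟨h, -⟩
    · exact absurd (ext_five (by simp [h0]) (by simp [h1]) (by simp [h2]) (by simp [h3])
        (by simp [h4])) hv0
    · rwa [inner_self_eq_of_eq h0 h1 h2 h3 h4, two_le_div_five]
  rcases mem_packingQ5.1 hv with hv | hv
  exacts [main _ hv (Or.inl rfl), main _ hv (Or.inr rfl)]

/-- The class `s = 0` acts by translations; for `x` in the class `s = -2`, the point inversion `v ↦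
x - v` exchanges the two classes. -/
theorem packingQ5_mem_uniformPackings : packingQ5 ∈ uniformPackings kissQ5 := by
  refine mem_uniformPackings_of_origin ?_ ?_ (fun v => two_le_of_mem_packingQ5)
    fun v => mem_kissQ5_iff
  · exact mem_packingQ5.2 (Or.inl ⟨0, 0, 0, 0, 0, 0, by simp⟩)
  · intro x hx
    rcases mem_packingQ5.1 hx with hx | hx
    · refine ⟨moveIsometry (LinearIsometryEquiv.refl ℝ E5) 0 x, image_eq_of_forall ?_ ?_, ?_⟩
      · intro v hv
        rw [mem_packingQ5] at hv ⊢
        rw [moveIsometry_apply]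
        simpa using hv.imp (fun h => h.add hx) fun h => h.add hx
      · intro v hv
        rw [mem_packingQ5] at hv
        refine ⟨v + -x, ?_, by simp [moveIsometry_apply]⟩
        rw [mem_packingQ5]
        simpa using hv.imp (fun h => h.add hx.neg) fun h => h.add hx.neg
      · simp [moveIsometry_apply]
    · have key : ∀ v ∈ packingQ5, -v + x ∈ packingQ5 := by
        intro v hv
        rw [mem_packingQ5] at hv ⊢
        rcases hv with h | h
        · exact Or.inr (by simpa using h.neg.add hx)
        · exact Or.inl (by simpa using h.neg.add hx)
      refine ⟨moveIsometry (LinearIsometryEquiv.neg ℝ) 0 x, image_eq_of_forall ?_ ?_, ?_⟩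
      · intro v hv
        rw [moveIsometry_apply]
        simpa using key v hv
      · intro v hv
        exact ⟨-v + x, key v hv, by simp [moveIsometry_apply]⟩
      · simp [moveIsometry_apply]

/-! ### The packing with kissing configuration `R₅` -/

/-- The linear isometry given by an involution that preserves inner squares. -/
noncomputable def involutiveIsometry (f : E5 →ₗ[ℝ] E5) (hf : Function.Involutive f)
    (hn : ∀ v, ⟪f v, f v⟫ = ⟪v, v⟫) : E5 ≃ₗᵢ[ℝ] E5 where
  toLinearEquiv := LinearEquiv.ofInvolutive f hf
  norm_map' v := by
    have h := hn v
    rw [real_inner_self_eq_norm_sq, real_inner_self_eq_norm_sq] at h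
    exact (sq_eq_sq₀ (norm_nonneg _) (norm_nonneg _)).1 h

theorem involutiveIsometry_apply (f : E5 →ₗ[ℝ] E5) (hf : Function.Involutive f)
    (hn : ∀ v, ⟪f v, f v⟫ = ⟪v, v⟫) (v : E5) : involutiveIsometry f hf hn v = f v := rfl

/-- The linear map that is `-1` on the vectors `(x, 0)` with `x` of coordinate sum `0` and is `1`
on their orthogonal complement. -/
noncomputable def sigmaMap : E5 →ₗ[ℝ] E5 where
  toFun v := !₂[(v 0 + v 1 + v 2 + v 3) / 2 - v 0, (v 0 + v 1 + v 2 + v 3) / 2 - v 1,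
    (v 0 + v 1 + v 2 + v 3) / 2 - v 2, (v 0 + v 1 + v 2 + v 3) / 2 - v 3, v 4]
  map_add' v w := by apply ext_five <;> simp <;> ring
  map_smul' c v := by apply ext_five <;> simp <;> ring

theorem sigmaMap_involutive : Function.Involutive sigmaMap := by
  intro v
  apply ext_five <;> simp [sigmaMap] <;> ring

/-- The isometry given by `sigmaMap`. -/
noncomputable def sigma : E5 ≃ₗᵢ[ℝ] E5 :=
  involutiveIsometry sigmaMap sigmaMap_involutive fun v => by
    rw [inner_eq, inner_eq]
    simp [sigmaMap]
    ring

theorem sigma_sigma (v : E5) : sigma (sigma v) = v := sigmaMap_involutive v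

/-- The vectors `(z - n / 2, -e + 2 n) + (4 m / 5) (1, 1, 1, 1, 1)` with `z` integral and with
coordinate sum `s`. -/
def IsR5 (e s : ℤ) (v : E5) : Prop :=
  ∃ z0 z1 z2 z3 n m : ℤ, z0 + z1 + z2 + z3 = s ∧ v 0 = z0 - n / 2 + 4 / 5 * m ∧
    v 1 = z1 - n / 2 + 4 / 5 * m ∧ v 2 = z2 - n / 2 + 4 / 5 * m ∧ v 3 = z3 - n / 2 + 4 / 5 * m ∧
    v 4 = -e + 2 * n + 4 / 5 * m

theorem mem_packingR5 {v : E5} :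
    v ∈ packingR5 ↔ IsR5 0 0 v ∨ IsR5 1 1 v ∨ IsR5 0 (-2) v ∨ IsR5 1 (-1) v := by
  rw [packingR5, mem_translatesOf]
  constructor
  · rintro ⟨i, c, rfl⟩
    have key : ∀ y2 y3 e : ℤ,
        IsR5 e (y2 + y3) (!₂[0, 0, (y2 : ℝ), (y3 : ℝ), -(e : ℝ)] + ∑ j, c j •
          (![!₂[1, -1, 0, 0, 0], !₂[0, 1, -1, 0, 0], !₂[0, 0, 1, -1, 0],
            !₂[-(1 / 2), -(1 / 2), -(1 / 2), -(1 / 2), 2],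
            !₂[4 / 5, 4 / 5, 4 / 5, 4 / 5, 4 / 5]] j : E5)) := by
      intro y2 y3 e
      refine ⟨c 0, c 1 - c 0, y2 + c 2 - c 1, y3 - c 2, c 3, c 4, by ring, ?_, ?_, ?_, ?_, ?_⟩
      all_goals simp [Fin.sum_univ_five]; ring
    fin_cases i
    · left
      simpa using key 0 0 0
    · right; left
      simpa using key 0 1 1
    · right; right; left
      simpa using key (-1) (-1) 0
    · right; right; right
      simpa using key 0 (-1) 1
  · have key : ∀ y2 y3 e : ℤ, IsR5 e (y2 + y3) v → ∃ c : Fin 5 → ℤ,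
        v = !₂[0, 0, (y2 : ℝ), (y3 : ℝ), -(e : ℝ)] + ∑ j, c j •
          (![!₂[1, -1, 0, 0, 0], !₂[0, 1, -1, 0, 0], !₂[0, 0, 1, -1, 0],
            !₂[-(1 / 2), -(1 / 2), -(1 / 2), -(1 / 2), 2],
            !₂[4 / 5, 4 / 5, 4 / 5, 4 / 5, 4 / 5]] j : E5) := by
      rintro y2 y3 e ⟨z0, z1, z2, z3, n, m, hs, h0, h1, h2, h3, h4⟩
      have hs' : (z3 : ℝ) = y2 + y3 - z0 - z1 - z2 := by
        rw [eq_sub_iff_add_eq, eq_sub_iff_add_eq, eq_sub_iff_add_eq]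
        norm_cast
        linarith
      refine ⟨![z0, z0 + z1, z0 + z1 + z2 - y2, n, m], ?_⟩
      apply ext_five <;> simp [Fin.sum_univ_five, *] <;> ring
    rintro (h | h | h | h)
    · obtain ⟨c, hc⟩ := key 0 0 0 h
      exact ⟨0, c, by simpa using hc⟩
    · obtain ⟨c, hc⟩ := key 0 1 1 h
      exact ⟨1, c, by simpa using hc⟩
    · obtain ⟨c, hc⟩ := key (-1) (-1) 0 (by simpa using h)
      exact ⟨2, c, by simpa using hc⟩
    · obtain ⟨c, hc⟩ := key 0 (-1) 1 (by simpa using h)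
      exact ⟨3, c, by simpa using hc⟩

theorem IsR5.add {e s e' s' : ℤ} {v w : E5} (hv : IsR5 e s v) (hw : IsR5 e' s' w) :
    IsR5 (e + e') (s + s') (v + w) := by
  obtain ⟨z0, z1, z2, z3, n, m, hs, h0, h1, h2, h3, h4⟩ := hv
  obtain ⟨y0, y1, y2, y3, k, l, ht, e0, e1, e2, e3, e4⟩ := hw
  refine ⟨z0 + y0, z1 + y1, z2 + y2, z3 + y3, n + k, m + l, by linarith, ?_⟩
  simp only [PiLp.add_apply, *]
  push_cast
  refine ⟨?_, ?_, ?_, ?_, ?_⟩ <;> ring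

theorem IsR5.neg {e s : ℤ} {v : E5} (hv : IsR5 e s v) : IsR5 (-e) (-s) (-v) := by
  obtain ⟨z0, z1, z2, z3, n, m, hs, h0, h1, h2, h3, h4⟩ := hv
  refine ⟨-z0, -z1, -z2, -z3, -n, -m, by linarith, ?_⟩
  simp only [PiLp.neg_apply, *]
  push_cast
  refine ⟨?_, ?_, ?_, ?_, ?_⟩ <;> ring

theorem IsR5.sigma_even {e k : ℤ} {v : E5} (hv : IsR5 e (2 * k) v) :
    IsR5 e (2 * k) (sigma v) := by
  obtain ⟨z0, z1, z2, z3, n, m, hs, h0, h1, h2, h3, h4⟩ := hv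
  refine ⟨k - z0, k - z1, k - z2, k - z3, n, m, by linarith, ?_⟩
  rify at hs
  simp only [sigma, involutiveIsometry_apply, sigmaMap]
  push_cast
  simp [*]
  refine ⟨?_, ?_, ?_, ?_⟩ <;> linarith

/-- The half-sum now contributes an extra `1/2`, absorbed by raising `n` by one; this raises `2 * n`
by two, so `e` must grow by two. -/
theorem IsR5.sigma_odd {e k : ℤ} {v : E5} (hv : IsR5 e (2 * k + 1) v) :
    IsR5 (e + 2) (2 * k + 3) (sigma v) := by
  obtain ⟨z0, z1, z2, z3, n, m, hs, h0, h1, h2, h3, h4⟩ := hv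
  refine ⟨k + 1 - z0, k + 1 - z1, k + 1 - z2, k + 1 - z3, n + 1, m, by linarith, ?_⟩
  rify at hs
  simp only [sigma, involutiveIsometry_apply, sigmaMap]
  push_cast
  simp [*]
  refine ⟨?_, ?_, ?_, ?_, ?_⟩ <;> linarith

/-- The labels `e`, `s` are not unique: raising `n` by `2 * j` is compensated by adding `j` to each
`z` and `4 * j` to `e`. -/
theorem IsR5.shift {e s : ℤ} {v : E5} (hv : IsR5 e s v) (j : ℤ) :
    IsR5 (e + 4 * j) (s + 4 * j) v := by
  obtain ⟨z0, z1, z2, z3, n, m, hs, h0, h1, h2, h3, h4⟩ := hv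
  refine ⟨z0 + j, z1 + j, z2 + j, z3 + j, n + 2 * j, m, by linarith, ?_⟩
  simp only [*]
  push_cast
  refine ⟨?_, ?_, ?_, ?_, ?_⟩ <;> ring

theorem inner_self_eq_of_R5 {v : E5} {z0 z1 z2 z3 n m e : ℤ} (h0 : v 0 = z0 - n / 2 + 4 / 5 * m)
    (h1 : v 1 = z1 - n / 2 + 4 / 5 * m) (h2 : v 2 = z2 - n / 2 + 4 / 5 * m)
    (h3 : v 3 = z3 - n / 2 + 4 / 5 * m) (h4 : v 4 = -e + 2 * n + 4 / 5 * m) :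
    ⟪v, v⟫ = ((5 * (z0 ^ 2 + z1 ^ 2 + z2 ^ 2 + z3 ^ 2) + 5 * e ^ 2 + 25 * n ^ 2 -
      5 * (n * (z0 + z1 + z2 + z3 + 4 * e)) + 8 * (m * (z0 + z1 + z2 + z3 - e)) +
      16 * m ^ 2 : ℤ) : ℝ) / 5 := by
  rw [inner_eq, h0, h1, h2, h3, h4]
  push_cast
  ring

theorem sq_sub_self_nonneg (m : ℤ) : 0 ≤ m ^ 2 - m ∧ (m ^ 2 - m = 0 → m = 0 ∨ m = 1) := by
  refine ⟨by nlinarith [mul_self_nonneg (2 * m - 1)], fun h => ?_⟩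
  have h2 : m * (m - 1) = 0 := by linarith
  rcases mul_eq_zero.1 h2 with h | h
  · exact Or.inl h
  · exact Or.inr (by omega)

set_option maxHeartbeats 1000000 in
-- In the four classes the form is `5q + 25n² + 16m²`, `5q + 5 + 25n(n - 1) + 16m²`, `5q + 25n² +
-- 10n + 16m(m - 1)` and `5q + 5 + 25n² - 15n + 16m(m - 1)`. The parity of `q`, and its positivity
-- when `s ≠ 0`, make `10` the least nonzero value.
theorem R5_form_bound {q e s n m : ℤ} (hq : 0 ≤ q) (hqs : 2 ∣ q - s) (hq0 : s ≠ 0 → 0 < q)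
    (h : e = 0 ∧ s = 0 ∨ e = 1 ∧ s = 1 ∨ e = 0 ∧ s = -2 ∨ e = 1 ∧ s = -1) :
    (q = 0 ∧ n = 0 ∧ m = 0 ∧ e = 0) ∨
    10 ≤ 5 * q + 5 * e ^ 2 + 25 * n ^ 2 - 5 * (n * (s + 4 * e)) + 8 * (m * (s - e)) + 16 * m ^ 2 ∧
      (5 * q + 5 * e ^ 2 + 25 * n ^ 2 - 5 * (n * (s + 4 * e)) + 8 * (m * (s - e)) +
        16 * m ^ 2 = 10 →
        (e = 0 ∧ s = 0 ∧ q = 2 ∧ n = 0 ∧ m = 0) ∨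
        (e = 1 ∧ s = 1 ∧ q = 1 ∧ (n = 0 ∨ n = 1) ∧ m = 0) ∨
        (e = 0 ∧ s = -2 ∧ q = 2 ∧ n = 0 ∧ (m = 0 ∨ m = 1)) ∨
        (e = 1 ∧ s = -1 ∧ q = 1 ∧ n = 0 ∧ (m = 0 ∨ m = 1))) := by
  have hn : n = 0 ∨ 0 < n ^ 2 := by
    rcases eq_or_ne n 0 with h | h
    · exact Or.inl h
    · exact Or.inr (by positivity)
  have hm : m = 0 ∨ 0 < m ^ 2 := by
    rcases eq_or_ne m 0 with h | h
    · exact Or.inl h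
    · exact Or.inr (by positivity)
  have hn2 : n ≤ n ^ 2 ∧ -n ≤ n ^ 2 := by
    constructor <;> nlinarith [mul_self_nonneg (2 * n - 1), mul_self_nonneg (2 * n + 1)]
  have hn1 := sq_sub_self_nonneg n
  have hm1 := sq_sub_self_nonneg m
  rcases h with ⟨rfl, rfl⟩ | ⟨rfl, rfl⟩ | ⟨rfl, rfl⟩ | ⟨rfl, rfl⟩
  · have hf : 5 * q + 5 * 0 ^ 2 + 25 * n ^ 2 - 5 * (n * (0 + 4 * 0)) + 8 * (m * (0 - 0)) +
        16 * m ^ 2 = 5 * q + 25 * n ^ 2 + 16 * m ^ 2 := by ring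
    rw [hf]
    have hn' : n = 0 → n ^ 2 = 0 := by rintro rfl; norm_num
    have hm' : m = 0 → m ^ 2 = 0 := by rintro rfl; norm_num
    by_cases h0 : q = 0 ∧ n = 0 ∧ m = 0
    · exact Or.inl ⟨h0.1, h0.2.1, h0.2.2, rfl⟩
    · refine Or.inr ⟨by omega, fun h => Or.inl ⟨rfl, rfl, ?_, ?_, ?_⟩⟩ <;> omega
  · have := hq0 (by norm_num)
    refine Or.inr ⟨by ring_nf; omega, fun h => ?_⟩
    ring_nf at h
    have hm0 : m = 0 := by
      rcases hm with h | h
      · exact h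
      · omega
    refine Or.inr (Or.inl ⟨rfl, rfl, by omega, hn1.2 (by omega), hm0⟩)
  · have := hq0 (by norm_num)
    refine Or.inr ⟨by ring_nf; omega, fun h => ?_⟩
    ring_nf at h
    have hn0 : n = 0 := by
      rcases hn with h | h
      · exact h
      · omega
    refine Or.inr (Or.inr (Or.inl ⟨rfl, rfl, by omega, hn0, hm1.2 (by omega)⟩))
  · have := hq0 (by norm_num)
    refine Or.inr ⟨by ring_nf; omega, fun h => ?_⟩
    ring_nf at h
    have hn0 : n = 0 := by
      rcases hn with h | h
      · exact h
      · omega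
    refine Or.inr (Or.inr (Or.inr ⟨rfl, rfl, by omega, hn0, hm1.2 (by omega)⟩))

/-- The four classes of `packingR5` modulo its lattice of translations. -/
def IsClassR5 (e s : ℤ) : Prop := e = 0 ∧ s = 0 ∨ e = 1 ∧ s = 1 ∨ e = 0 ∧ s = -2 ∨ e = 1 ∧ s = -1

theorem mem_packingR5_iff_exists {v : E5} :
    v ∈ packingR5 ↔ ∃ e s, IsClassR5 e s ∧ IsR5 e s v := by
  rw [mem_packingR5]
  constructor
  · rintro (h | h | h | h)
    exacts [⟨0, 0, by simp [IsClassR5], h⟩, ⟨1, 1, by simp [IsClassR5], h⟩,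
      ⟨0, -2, by simp [IsClassR5], h⟩, ⟨1, -1, by simp [IsClassR5], h⟩]
  · rintro ⟨e, s, ⟨rfl, rfl⟩ | ⟨rfl, rfl⟩ | ⟨rfl, rfl⟩ | ⟨rfl, rfl⟩, h⟩ <;> simp [h]

theorem R5_form (z0 z1 z2 z3 : ℤ) {e n m : ℤ} (h : IsClassR5 e (z0 + z1 + z2 + z3)) :
    (z0 = 0 ∧ z1 = 0 ∧ z2 = 0 ∧ z3 = 0 ∧ n = 0 ∧ m = 0 ∧ e = 0) ∨
    10 ≤ 5 * (z0 ^ 2 + z1 ^ 2 + z2 ^ 2 + z3 ^ 2) + 5 * e ^ 2 + 25 * n ^ 2 -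
        5 * (n * (z0 + z1 + z2 + z3 + 4 * e)) + 8 * (m * (z0 + z1 + z2 + z3 - e)) + 16 * m ^ 2 ∧
      (5 * (z0 ^ 2 + z1 ^ 2 + z2 ^ 2 + z3 ^ 2) + 5 * e ^ 2 + 25 * n ^ 2 -
        5 * (n * (z0 + z1 + z2 + z3 + 4 * e)) + 8 * (m * (z0 + z1 + z2 + z3 - e)) +
        16 * m ^ 2 = 10 →
        (e = 0 ∧ z0 + z1 + z2 + z3 = 0 ∧ z0 ^ 2 + z1 ^ 2 + z2 ^ 2 + z3 ^ 2 = 2 ∧ n = 0 ∧ m = 0) ∨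
        (e = 1 ∧ z0 + z1 + z2 + z3 = 1 ∧ z0 ^ 2 + z1 ^ 2 + z2 ^ 2 + z3 ^ 2 = 1 ∧
          (n = 0 ∨ n = 1) ∧ m = 0) ∨
        (e = 0 ∧ z0 + z1 + z2 + z3 = -2 ∧ z0 ^ 2 + z1 ^ 2 + z2 ^ 2 + z3 ^ 2 = 2 ∧ n = 0 ∧
          (m = 0 ∨ m = 1)) ∨
        (e = 1 ∧ z0 + z1 + z2 + z3 = -1 ∧ z0 ^ 2 + z1 ^ 2 + z2 ^ 2 + z3 ^ 2 = 1 ∧ n = 0 ∧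
          (m = 0 ∨ m = 1))) := by
  have q0 := sq_nonneg z0
  have q1 := sq_nonneg z1
  have q2 := sq_nonneg z2
  have q3 := sq_nonneg z3
  have p0 := two_dvd_sq_sub_self z0
  have p1 := two_dvd_sq_sub_self z1
  have p2 := two_dvd_sq_sub_self z2
  have p3 := two_dvd_sq_sub_self z3
  have hzero : z0 ^ 2 + z1 ^ 2 + z2 ^ 2 + z3 ^ 2 = 0 → z0 = 0 ∧ z1 = 0 ∧ z2 = 0 ∧ z3 = 0 := by
    intro h
    refine ⟨?_, ?_, ?_, ?_⟩ <;> refine (pow_eq_zero_iff two_ne_zero).1 ?_ <;> omega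
  have hpos : z0 + z1 + z2 + z3 ≠ 0 → 0 < z0 ^ 2 + z1 ^ 2 + z2 ^ 2 + z3 ^ 2 := by
    intro hne
    refine lt_of_le_of_ne (by omega) fun h0 => hne ?_
    have := hzero h0.symm
    omega
  rcases R5_form_bound (n := n) (m := m) (by omega) (by omega) hpos h with ⟨h1, h2⟩ | h
  · have := hzero h1
    exact Or.inl ⟨this.1, this.2.1, this.2.2.1, this.2.2.2, h2⟩
  · exact Or.inr h

set_option synthInstance.maxHeartbeats 400000 in
set_option synthInstance.maxSize 2000 in
theorem mem_kissR5_iff {v : E5} : v ∈ kissR5 ↔ v ∈ packingR5 ∧ ⟪v, v⟫ = 2 := by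
  rw [kissR5_eq]
  constructor
  · rintro ⟨p, hp, rfl⟩
    have hp : p ∈ intR5 := hp
    have key : ∀ p ∈ intR5, idot p p = 200 ∧ ∃ m ∈ [(0 : ℤ), 1], ∃ n ∈ [(0 : ℤ), 1],
        ∃ es ∈ [((0 : ℤ), (0 : ℤ)), (1, 1), (0, -2), (1, -1)],
        p.1 + p.2.1 + p.2.2.1 + p.2.2.2.1 = 10 * es.2 - 20 * n + 32 * m ∧
        p.2.2.2.2 = -10 * es.1 + 20 * n + 8 * m ∧
        10 ∣ p.1 + 5 * n - 8 * m ∧ 10 ∣ p.2.1 + 5 * n - 8 * m ∧ 10 ∣ p.2.2.1 + 5 * n - 8 * m ∧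
        10 ∣ p.2.2.2.1 + 5 * n - 8 * m := by decide +kernel
    obtain ⟨h, m, -, n, -, ⟨e, s⟩, hes, hsum, h4, ⟨z0, h0⟩, ⟨z1, h1⟩, ⟨z2, h2⟩, ⟨z3, h3⟩⟩ :=
      key p hp
    have hR : IsR5 e s (toE p) := by
      refine ⟨z0, z1, z2, z3, n, m, by dsimp only at hsum; omega, ?_⟩
      rify at h0 h1 h2 h3 h4
      simp only [toE_zero_coord, toE_one_coord, toE_two_coord, toE_three_coord, toE_four_coord]
      refine ⟨?_, ?_, ?_, ?_, ?_⟩ <;> linarith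
    refine ⟨mem_packingR5_iff_exists.2 ⟨e, s, ?_, hR⟩, by rw [inner_toE, h]; norm_num⟩
    simpa [IsClassR5] using hes
  · have key : ∀ mn ∈ [((0 : ℤ), (0 : ℤ)), (0, 1), (1, 0)], ∀ e ∈ [(0 : ℤ), 1],
        ∀ z0 ∈ [(-1 : ℤ), 0, 1], ∀ z1 ∈ [(-1 : ℤ), 0, 1],
        ∀ z2 ∈ [(-1 : ℤ), 0, 1], ∀ z3 ∈ [(-1 : ℤ), 0, 1],
        (e = 0 ∧ z0 + z1 + z2 + z3 = 0 ∧ z0 ^ 2 + z1 ^ 2 + z2 ^ 2 + z3 ^ 2 = 2 ∧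
          mn.2 = 0 ∧ mn.1 = 0) ∨
        (e = 1 ∧ z0 + z1 + z2 + z3 = 1 ∧ z0 ^ 2 + z1 ^ 2 + z2 ^ 2 + z3 ^ 2 = 1 ∧
          (mn.2 = 0 ∨ mn.2 = 1) ∧ mn.1 = 0) ∨
        (e = 0 ∧ z0 + z1 + z2 + z3 = -2 ∧ z0 ^ 2 + z1 ^ 2 + z2 ^ 2 + z3 ^ 2 = 2 ∧ mn.2 = 0 ∧
          (mn.1 = 0 ∨ mn.1 = 1)) ∨
        (e = 1 ∧ z0 + z1 + z2 + z3 = -1 ∧ z0 ^ 2 + z1 ^ 2 + z2 ^ 2 + z3 ^ 2 = 1 ∧ mn.2 = 0 ∧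
          (mn.1 = 0 ∨ mn.1 = 1)) →
        (10 * z0 - 5 * mn.2 + 8 * mn.1, 10 * z1 - 5 * mn.2 + 8 * mn.1,
          10 * z2 - 5 * mn.2 + 8 * mn.1, 10 * z3 - 5 * mn.2 + 8 * mn.1,
          -10 * e + 20 * mn.2 + 8 * mn.1) ∈ intR5 := by decide +kernel
    rintro ⟨hv, h⟩
    obtain ⟨e, s, hes, z0, z1, z2, z3, n, m, rfl, h0, h1, h2, h3, h4⟩ :=
      mem_packingR5_iff_exists.1 hv
    rcases R5_form z0 z1 z2 z3 (n := n) (m := m) hes with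
      ⟨rfl, rfl, rfl, rfl, rfl, rfl, rfl⟩ | ⟨-, hmin⟩
    · rw [inner_self_eq_of_R5 h0 h1 h2 h3 h4] at h
      norm_num at h
    rw [inner_self_eq_of_R5 h0 h1 h2 h3 h4, div_five_eq_two] at h
    have hc := hmin h
    have q0 := sq_nonneg z0
    have q1 := sq_nonneg z1
    have q2 := sq_nonneg z2
    have q3 := sq_nonneg z3
    refine ⟨_, key (m, n) ?_ e ?_ z0 (int_eq_neg_one_or (by omega)) z1
      (int_eq_neg_one_or (by omega)) z2 (int_eq_neg_one_or (by omega)) z3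
      (int_eq_neg_one_or (by omega)) hc, ?_⟩
    · simp only [List.mem_cons, Prod.mk.injEq, List.not_mem_nil, or_false]
      omega
    · simp only [List.mem_cons, List.not_mem_nil, or_false]
      omega
    · apply ext_five <;> simp [h0, h1, h2, h3, h4] <;> ring

theorem two_le_of_mem_packingR5 {v : E5} (hv : v ∈ packingR5) (hv0 : v ≠ 0) : 2 ≤ ⟪v, v⟫ := by
  obtain ⟨e, s, hes, z0, z1, z2, z3, n, m, rfl, h0, h1, h2, h3, h4⟩ :=
    mem_packingR5_iff_exists.1 hv
  rcases R5_form z0 z1 z2 z3 (n := n) (m := m) hes with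
    ⟨rfl, rfl, rfl, rfl, rfl, rfl, rfl⟩ | ⟨h, -⟩
  · exact absurd (ext_five (by simp [h0]) (by simp [h1]) (by simp [h2]) (by simp [h3])
      (by simp [h4])) hv0
  · rwa [inner_self_eq_of_R5 h0 h1 h2 h3 h4, two_le_div_five]

theorem exists_isometry_of_involutive {P : Set E5} {x : E5} {L : E5 ≃ₗᵢ[ℝ] E5}
    (hL : ∀ v, L (L v) = v) (h : ∀ v ∈ P, ∀ y, y = x ∨ y = -L x → L v + y ∈ P) :
    ∃ g : E5 ≃ᵢ E5, g '' P = P ∧ g 0 = x := by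
  refine ⟨moveIsometry L 0 x, image_eq_of_forall ?_ ?_, by simp [moveIsometry_apply]⟩
  · intro v hv
    simpa [moveIsometry_apply] using h v hv x (Or.inl rfl)
  · intro v hv
    exact ⟨L v + -L x, h v hv _ (Or.inr rfl), by simp [moveIsometry_apply, hL]⟩

/-- The linear parts `1`, `sigma`, `-sigma`, `-1`, each followed by a translation, carry the origin
to the classes `(0, 0)`, `(1, 1)`, `(0, -2)`, `(1, -1)` and permute the four classes, after
relabelling by `IsR5.shift`. -/
theorem packingR5_mem_uniformPackings : packingR5 ∈ uniformPackings kissR5 := by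
  refine mem_uniformPackings_of_origin ?_ ?_ (fun v => two_le_of_mem_packingR5)
    fun v => mem_kissR5_iff
  · exact mem_packingR5.2 (Or.inl ⟨0, 0, 0, 0, 0, 0, by simp⟩)
  · intro x hx
    rcases mem_packingR5.1 hx with hx | hx | hx | hx
    · refine exists_isometry_of_involutive (L := LinearIsometryEquiv.refl ℝ E5) (fun v => rfl) ?_
      intro v hv y hy
      have hy : IsR5 0 0 y := by
        rcases hy with rfl | rfl
        · exact hx
        · exact hx.neg
      rw [mem_packingR5] at hv ⊢
      simpa using hv.imp (fun h => h.add hy) (Or.imp (fun h => h.add hy)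
        (Or.imp (fun h => h.add hy) fun h => h.add hy))
    · refine exists_isometry_of_involutive sigma_sigma ?_
      intro v hv y hy
      have hy : IsR5 1 1 y := by
        rcases hy with rfl | rfl
        · exact hx
        · exact ((IsR5.sigma_odd (k := 0) hx).neg).shift 1
      rw [mem_packingR5] at hv ⊢
      rcases hv with h | h | h | h
      · exact Or.inr (Or.inl ((IsR5.sigma_even (k := 0) h).add hy))
      · exact Or.inl (by simpa using ((IsR5.sigma_odd (k := 0) h).add hy).shift (-1))
      · exact Or.inr (Or.inr (Or.inr ((IsR5.sigma_even (k := -1) h).add hy)))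
      · have := ((IsR5.sigma_odd (k := -1) h).add hy).shift (-1)
        norm_num at this
        exact Or.inr (Or.inr (Or.inl this))
    · refine exists_isometry_of_involutive (L := sigma.trans (LinearIsometryEquiv.neg ℝ))
        (fun v => by simp [sigma_sigma]) ?_
      intro v hv y hy
      have hy : IsR5 0 (-2) y := by
        rcases hy with rfl | rfl
        · exact hx
        · simpa using IsR5.sigma_even (k := -1) hx
      have hL : (sigma.trans (LinearIsometryEquiv.neg ℝ)) v = -sigma v := by simp
      rw [hL]
      rw [mem_packingR5] at hv ⊢
      rcases hv with h | h | h | h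
      · exact Or.inr (Or.inr (Or.inl ((IsR5.sigma_even (k := 0) h).neg.add hy)))
      · exact Or.inr (Or.inr (Or.inr (((IsR5.sigma_odd (k := 0) h).neg.add hy).shift 1)))
      · exact Or.inl ((IsR5.sigma_even (k := -1) h).neg.add hy)
      · exact Or.inr (Or.inl (((IsR5.sigma_odd (k := -1) h).neg.add hy).shift 1))
    · refine exists_isometry_of_involutive (L := LinearIsometryEquiv.neg ℝ) (fun v => by simp) ?_
      intro v hv y hy
      have hy : IsR5 1 (-1) y := by
        rcases hy with rfl | rfl
        · exact hx
        · simpa using hx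
      rw [mem_packingR5] at hv ⊢
      rcases hv with h | h | h | h
      · exact Or.inr (Or.inr (Or.inr (h.neg.add hy)))
      · exact Or.inr (Or.inr (Or.inl (h.neg.add hy)))
      · exact Or.inr (Or.inl (h.neg.add hy))
      · exact Or.inl (h.neg.add hy)

/-! ### Cosets of `D₄` in its dual lattice -/

/-- The vectors `(z + (h / 2) (1, 1, 1, 1), k)` with `z` integral of coordinate sum congruent to
`s` modulo `2`. -/
def IsGlue (h s k : ℤ) (v : E5) : Prop :=
  ∃ z0 z1 z2 z3 m : ℤ, z0 + z1 + z2 + z3 = s + 2 * m ∧ v 0 = z0 + h / 2 ∧ v 1 = z1 + h / 2 ∧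
    v 2 = z2 + h / 2 ∧ v 3 = z3 + h / 2 ∧ v 4 = k

theorem IsGlue.add {h s k h' s' k' : ℤ} {v w : E5} (hv : IsGlue h s k v) (hw : IsGlue h' s' k' w) :
    IsGlue (h + h') (s + s') (k + k') (v + w) := by
  obtain ⟨z0, z1, z2, z3, m, hs, h0, h1, h2, h3, h4⟩ := hv
  obtain ⟨y0, y1, y2, y3, n, ht, e0, e1, e2, e3, e4⟩ := hw
  refine ⟨z0 + y0, z1 + y1, z2 + y2, z3 + y3, m + n, by linarith, ?_⟩
  simp only [PiLp.add_apply, *]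
  push_cast
  refine ⟨?_, ?_, ?_, ?_, ?_⟩ <;> ring

theorem IsGlue.neg {h s k : ℤ} {v : E5} (hv : IsGlue h s k v) : IsGlue (-h) (-s) (-k) (-v) := by
  obtain ⟨z0, z1, z2, z3, m, hs, h0, h1, h2, h3, h4⟩ := hv
  refine ⟨-z0, -z1, -z2, -z3, -m, by linarith, ?_⟩
  simp only [PiLp.neg_apply, *]
  push_cast
  refine ⟨?_, ?_, ?_, ?_, ?_⟩ <;> ring

theorem IsGlue.sub {h s k h' s' k' : ℤ} {v w : E5} (hv : IsGlue h s k v) (hw : IsGlue h' s' k' w) :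
    IsGlue (h - h') (s - s') (k - k') (v - w) := by
  simpa only [sub_eq_add_neg] using hv.add hw.neg

theorem IsGlue.congr {h s k h' s' : ℤ} {v : E5} (hv : IsGlue h s k v) (hh : 2 ∣ h' - h)
    (hs : 2 ∣ s' - s) : IsGlue h' s' k v := by
  obtain ⟨z0, z1, z2, z3, m, hm, h0, h1, h2, h3, h4⟩ := hv
  obtain ⟨a, ha⟩ := hh
  obtain ⟨b, hb⟩ := hs
  obtain rfl : h' = h + 2 * a := by omega
  refine ⟨z0 - a, z1 - a, z2 - a, z3 - a, m - 2 * a - b, by linarith, ?_⟩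
  simp only [*]
  push_cast
  refine ⟨?_, ?_, ?_, ?_, trivial⟩ <;> ring

theorem IsGlue.eq_height {h s k h' s' k' : ℤ} {v : E5} (hv : IsGlue h s k v)
    (hv' : IsGlue h' s' k' v) : k = k' := by
  obtain ⟨_, _, _, _, _, _, _, _, _, _, h4⟩ := hv
  obtain ⟨_, _, _, _, _, _, _, _, _, _, h4'⟩ := hv'
  exact Int.cast_injective (α := ℝ) (h4.symm.trans h4')

theorem IsGlue.two_dvd {h s k h' s' k' : ℤ} {v : E5} (hv : IsGlue h s k v)
    (hv' : IsGlue h' s' k' v) : 2 ∣ h' - h ∧ 2 ∣ s' - s := by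
  obtain ⟨z0, z1, z2, z3, m, hm, h0, h1, h2, h3, -⟩ := hv
  obtain ⟨y0, y1, y2, y3, n, hn, e0, e1, e2, e3, -⟩ := hv'
  have key : ∀ {a b : ℤ} {x : ℝ}, x = a + h / 2 → x = b + h' / 2 → 2 * a + h = 2 * b + h' := by
    intro a b x ha hb
    have : (2 * a + h : ℝ) = 2 * b + h' := by linarith
    exact_mod_cast this
  have k0 := key h0 e0
  have k1 := key h1 e1
  have k2 := key h2 e2
  have k3 := key h3 e3
  constructor <;> omega

/-- The first label of a coset of `D₄` in its dual lattice. -/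
def glueHalf : Fin 4 → ℤ := ![0, 0, 1, 1]

/-- The second label of a coset of `D₄` in its dual lattice. -/
def glueParity : Fin 4 → ℤ := ![0, 1, 0, 1]

/-- The coset with representative `glueD4 i`, placed at height `k`. -/
def InCoset (i : Fin 4) (k : ℤ) (v : E5) : Prop := IsGlue (glueHalf i) (glueParity i) k v

theorem exists_inCoset {h s k : ℤ} {v : E5} (hv : IsGlue h s k v) :
    ∃ i, 2 ∣ glueHalf i - h ∧ 2 ∣ glueParity i - s ∧ InCoset i k v := by
  have key : ∃ i, 2 ∣ glueHalf i - h ∧ 2 ∣ glueParity i - s := by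
    rcases Int.emod_two_eq h with hh | hh <;> rcases Int.emod_two_eq s with hs | hs
    · exact ⟨0, by simp [glueHalf, glueParity]; omega⟩
    · exact ⟨1, by simp [glueHalf, glueParity]; omega⟩
    · exact ⟨2, by simp [glueHalf, glueParity]; omega⟩
    · exact ⟨3, by simp [glueHalf, glueParity]; omega⟩
  obtain ⟨i, h1, h2⟩ := key
  exact ⟨i, h1, h2, hv.congr h1 h2⟩

theorem eq_of_two_dvd {i j : Fin 4} (h : 2 ∣ glueHalf j - glueHalf i)
    (h' : 2 ∣ glueParity j - glueParity i) : i = j := by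
  revert i j
  decide

theorem InCoset.eq_height {i j : Fin 4} {k l : ℤ} {v : E5} (hv : InCoset i k v)
    (hv' : InCoset j l v) : k = l :=
  IsGlue.eq_height hv hv'

theorem InCoset.eq {i j : Fin 4} {k l : ℤ} {v : E5} (hv : InCoset i k v) (hv' : InCoset j l v) :
    i = j :=
  eq_of_two_dvd (IsGlue.two_dvd hv hv').1 (IsGlue.two_dvd hv hv').2

theorem InCoset.sub_of_eq {i : Fin 4} {k l : ℤ} {v w : E5} (hv : InCoset i k v)
    (hw : InCoset i l w) : InCoset 0 (k - l) (v - w) := by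
  have := IsGlue.sub hv hw
  rwa [sub_self, sub_self] at this

theorem InCoset.add_zero {i : Fin 4} {k l : ℤ} {v w : E5} (hv : InCoset i k v)
    (hw : InCoset 0 l w) : InCoset i (k + l) (v + w) := by
  simpa [InCoset, glueHalf, glueParity] using IsGlue.add hv hw

theorem inCoset_add_zero_iff {i : Fin 4} {k l : ℤ} {v w : E5} (hw : InCoset 0 l w) :
    InCoset i (k + l) (v + w) ↔ InCoset i k v := by
  refine ⟨fun h => ?_, fun h => h.add_zero hw⟩
  simpa [InCoset, glueHalf, glueParity] using IsGlue.sub h hw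

theorem inCoset_zero_single (k : ℤ) : InCoset 0 k (EuclideanSpace.single 4 (k : ℝ)) :=
  ⟨0, 0, 0, 0, 0, by simp [glueParity], by simp [glueHalf]⟩

theorem mem_layerD4 {v : E5} : v ∈ layerD4 ↔ InCoset 0 0 v := by
  constructor
  · rintro ⟨⟨hv, k, hk⟩, h4⟩
    choose z hz using hv
    rw [sum_five, h4] at hk
    refine ⟨z 0, z 1, z 2, z 3, k, ?_, by simp [hz, glueHalf], by simp [hz, glueHalf],
      by simp [hz, glueHalf], by simp [hz, glueHalf], by simp [h4]⟩
    simp only [hz, glueParity] at hk ⊢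
    norm_cast at hk
    simpa using hk
  · rintro ⟨z0, z1, z2, z3, m, hm, h0, h1, h2, h3, h4⟩
    simp only [glueHalf, glueParity, Matrix.cons_val_zero, Int.cast_zero, zero_div,
      _root_.add_zero, zero_add] at *
    refine ⟨⟨?_, m, ?_⟩, h4⟩
    · intro i
      fin_cases i
      exacts [⟨z0, h0⟩, ⟨z1, h1⟩, ⟨z2, h2⟩, ⟨z3, h3⟩, ⟨0, by simpa using h4⟩]
    · rw [sum_five, h0, h1, h2, h3, h4]
      rify at hm
      linarith

theorem inCoset_glueD4 (i : Fin 4) : InCoset i 0 (glueD4 i) := by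
  fin_cases i
  · exact ⟨0, 0, 0, 0, 0, by simp [glueD4, glueHalf, glueParity]⟩
  · exact ⟨1, 0, 0, 0, 0, by simp [glueD4, glueHalf, glueParity]⟩
  · exact ⟨0, 0, 0, 0, 0, by simp [glueD4, glueHalf, glueParity]⟩
  · exact ⟨0, 0, 0, -1, -1, by simp [glueD4, glueHalf, glueParity]; norm_num⟩

theorem sub_mem_layerD4_iff {i : Fin 4} {k : ℤ} {v : E5} :
    v - glueD4 i - EuclideanSpace.single 4 (k : ℝ) ∈ layerD4 ↔ InCoset i k v := by
  rw [mem_layerD4, sub_sub]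
  have h := (inCoset_glueD4 i).add_zero (inCoset_zero_single k)
  rw [zero_add] at h
  constructor
  · intro h'
    have := IsGlue.add h h'
    simpa [InCoset, glueHalf, glueParity] using this
  · intro h'
    simpa using h'.sub_of_eq h

/-! ### Stackings -/

/-- The stacking with the coset labelled by `c k` at height `k`. -/
def stack (c : ℤ → Fin 4) : Set E5 := {v | ∃ k, InCoset (c k) k v}

theorem mem_stack_iff {c : ℤ → Fin 4} {i : Fin 4} {k : ℤ} {v : E5} (hv : InCoset i k v) :
    v ∈ stack c ↔ c k = i := by
  constructor
  · rintro ⟨l, hl⟩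
    obtain rfl := hl.eq_height hv
    exact hl.eq hv
  · rintro rfl
    exact ⟨k, hv⟩

/-- `ZMod (n + 1)` unfolds to `Fin (n + 1)`, so the pattern is itself a function of the height
modulo its length; division with remainder supplies the witnesses. -/
theorem stackingD4_eq {n : ℕ} (c : ZMod (n + 1) → Fin 4) :
    stackingD4 (n := n + 1) c = stack fun k => c k := by
  ext v
  constructor
  · rintro ⟨k, j, h⟩
    have hj : ((((n + 1 : ℕ) : ℤ) * k + ((ZMod.val (n := n + 1) j : ℕ) : ℤ) : ℤ) :
        ZMod (n + 1)) = j := by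
      rw [Int.cast_add, Int.cast_mul, Int.cast_natCast, ZMod.natCast_self, zero_mul, zero_add,
        Int.cast_natCast]
      exact ZMod.natCast_zmod_val (n := n + 1) j
    have h' := sub_mem_layerD4_iff.1 h
    refine ⟨((n + 1 : ℕ) : ℤ) * k + ((ZMod.val (n := n + 1) j : ℕ) : ℤ), ?_⟩
    beta_reduce
    rw [hj]
    exact h'
  · rintro ⟨k, h⟩
    have hk : ((n + 1 : ℕ) : ℤ) * (k / ((n + 1 : ℕ) : ℤ)) +
        ((ZMod.val (k : ZMod (n + 1)) : ℕ) : ℤ) = k := by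
      rw [ZMod.val_intCast]
      exact Int.mul_ediv_add_emod k _
    refine ⟨k / ((n + 1 : ℕ) : ℤ), (k : ZMod (n + 1)), sub_mem_layerD4_iff.2 ?_⟩
    have h' : InCoset (c k) (((n + 1 : ℕ) : ℤ) * (k / ((n + 1 : ℕ) : ℤ)) +
        ((ZMod.val (k : ZMod (n + 1)) : ℕ) : ℤ)) v := by
      rw [hk]; exact h
    exact h'

/-! ### Isometries that permute the cosets -/

/-- The linear map that changes the sign of the fourth coordinate. -/
noncomputable def reflectFourthMap : E5 →ₗ[ℝ] E5 where
  toFun v := !₂[v 0, v 1, v 2, -v 3, v 4]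
  map_add' v w := by apply ext_five <;> simp [add_comm]
  map_smul' c v := by apply ext_five <;> simp

/-- The isometry given by `reflectFourthMap`. -/
noncomputable def reflectFourth : E5 ≃ₗᵢ[ℝ] E5 :=
  involutiveIsometry reflectFourthMap (fun v => by apply ext_five <;> simp [reflectFourthMap])
    fun v => by
      rw [inner_eq, inner_eq]
      simp [reflectFourthMap]

/-- The linear map that changes the sign of the height. -/
noncomputable def reflectHeightMap : E5 →ₗ[ℝ] E5 where
  toFun v := !₂[v 0, v 1, v 2, v 3, -v 4]
  map_add' v w := by apply ext_five <;> simp [add_comm]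
  map_smul' c v := by apply ext_five <;> simp

/-- The isometry given by `reflectHeightMap`. -/
noncomputable def reflectHeight : E5 ≃ₗᵢ[ℝ] E5 :=
  involutiveIsometry reflectHeightMap (fun v => by apply ext_five <;> simp [reflectHeightMap])
    fun v => by
      rw [inner_eq, inner_eq]
      simp [reflectHeightMap]

/-- The linear map given by a Hadamard matrix on the first four coordinates. -/
noncomputable def hadamardMap : E5 →ₗ[ℝ] E5 where
  toFun v := !₂[(v 0 + v 1 + v 2 + v 3) / 2, (v 0 + v 1 - v 2 - v 3) / 2,
    (v 0 - v 1 + v 2 - v 3) / 2, (v 0 - v 1 - v 2 + v 3) / 2, v 4]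
  map_add' v w := by apply ext_five <;> simp <;> ring
  map_smul' c v := by apply ext_five <;> simp <;> ring

/-- The isometry given by `hadamardMap`. -/
noncomputable def hadamard : E5 ≃ₗᵢ[ℝ] E5 :=
  involutiveIsometry hadamardMap (fun v => by apply ext_five <;> simp [hadamardMap] <;> ring)
    fun v => by
      rw [inner_eq, inner_eq]
      simp [hadamardMap]
      ring

theorem IsGlue.reflectFourth {h s k : ℤ} {v : E5} (hv : IsGlue h s k v) :
    IsGlue h (s + h) k (reflectFourth v) := by
  obtain ⟨z0, z1, z2, z3, m, hm, h0, h1, h2, h3, h4⟩ := hv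
  refine ⟨z0, z1, z2, -z3 - h, m - z3 - h, by linarith, ?_⟩
  simp [FiveDim.reflectFourth, involutiveIsometry_apply, reflectFourthMap, *]
  ring

theorem IsGlue.hadamard {h s k : ℤ} {v : E5} (hv : IsGlue h s k v) :
    IsGlue s h k (hadamard v) := by
  obtain ⟨z0, z1, z2, z3, m, hm, h0, h1, h2, h3, h4⟩ := hv
  refine ⟨m + h, m - z2 - z3, m - z1 - z3, m - z1 - z2, 2 * m - z1 - z2 - z3, by linarith, ?_⟩
  rify at hm
  simp [FiveDim.hadamard, involutiveIsometry_apply, hadamardMap, *]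
  refine ⟨?_, ?_, ?_, ?_⟩ <;> linarith

theorem IsGlue.reflectHeight {h s k : ℤ} {v : E5} (hv : IsGlue h s k v) :
    IsGlue h s (-k) (reflectHeight v) := by
  obtain ⟨z0, z1, z2, z3, m, hm, h0, h1, h2, h3, h4⟩ := hv
  exact ⟨z0, z1, z2, z3, m, hm,
    by simp [FiveDim.reflectHeight, involutiveIsometry_apply, reflectHeightMap, *]⟩

/-- The permutations of the cosets that are induced by isometries preserving the heights. -/
def inducedPerms : Submonoid (Equiv.Perm (Fin 4)) where
  carrier := {π | ∃ g : E5 ≃ᵢ E5, ∀ i k v, InCoset (π i) k (g v) ↔ InCoset i k v}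
  one_mem' := ⟨IsometryEquiv.refl E5, fun i k v => Iff.rfl⟩
  mul_mem' := by
    rintro π τ ⟨g, hg⟩ ⟨f, hf⟩
    exact ⟨f.trans g, fun i k v => (hg (τ i) k (f v)).trans (hf i k v)⟩

theorem mem_inducedPerms_of_involutive {L : E5 ≃ₗᵢ[ℝ] E5} (hL : ∀ v, L (L v) = v)
    {π : Equiv.Perm (Fin 4)} (hπ : ∀ i, π (π i) = i)
    (h : ∀ i k v, InCoset i k v → InCoset (π i) k (L v)) : π ∈ inducedPerms :=
  ⟨L.toIsometryEquiv, fun i k v => ⟨fun h' => by simpa [hL, hπ] using h _ _ _ h', h i k v⟩⟩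

/-- Changing the sign of the fourth coordinate swaps cosets `2` and `3`, the Hadamard isometry swaps
`1` and `2`, and translation by `glueD4 1` acts as `(0 1)(2 3)`. Together these yield the adjacent
transpositions, which generate the symmetric group. -/
theorem inducedPerms_eq_top : inducedPerms = ⊤ := by
  have h23 : Equiv.swap 2 3 ∈ inducedPerms := by
    refine mem_inducedPerms_of_involutive (L := reflectFourth)
      (fun v => by
        apply ext_five <;> simp [reflectFourth, involutiveIsometry_apply, reflectFourthMap])
      (by decide) ?_
    intro i k v hv
    refine (IsGlue.reflectFourth hv).congr ?_ ?_ <;> clear hv <;> revert i <;> decide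
  have h12 : Equiv.swap 1 2 ∈ inducedPerms := by
    refine mem_inducedPerms_of_involutive (L := hadamard)
      (fun v => by
        apply ext_five <;> simp [hadamard, involutiveIsometry_apply, hadamardMap] <;> ring)
      (by decide) ?_
    intro i k v hv
    refine (IsGlue.hadamard hv).congr ?_ ?_ <;> clear hv <;> revert i <;> decide
  have h01 : Equiv.swap 0 1 * Equiv.swap 2 3 ∈ inducedPerms := by
    refine ⟨IsometryEquiv.addRight (glueD4 1), fun i k v => ⟨fun h => ?_, fun h => ?_⟩⟩
    · have := IsGlue.sub h (inCoset_glueD4 1)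
      simp only [IsometryEquiv.addRight_apply, add_sub_cancel_right, sub_zero] at this
      refine this.congr ?_ ?_ <;> clear this h <;> revert i <;> decide
    · have := IsGlue.add h (inCoset_glueD4 1)
      rw [_root_.add_zero] at this
      refine this.congr ?_ ?_ <;> clear this h <;> revert i <;> decide
  rw [eq_top_iff, ← Equiv.Perm.mclosure_swap_castSucc_succ 3, Submonoid.closure_le]
  rintro _ ⟨i, rfl⟩
  fin_cases i
  · have := mul_mem h01 h23
    rwa [mul_assoc, Equiv.swap_mul_self, mul_one] at this
  · exact h12
  · exact h23

theorem exists_isometry_perm (π : Equiv.Perm (Fin 4)) {ε : ℤ} (hε : ε = 1 ∨ ε = -1) (m : ℤ) :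
    ∃ g : E5 ≃ᵢ E5, ∀ i k v, InCoset (π i) (ε * k + m) (g v) ↔ InCoset i k v := by
  obtain ⟨f, hf⟩ : π ∈ inducedPerms := inducedPerms_eq_top ▸ Submonoid.mem_top π
  obtain ⟨L, hL⟩ : ∃ L : E5 ≃ᵢ E5, ∀ i k v, InCoset i (ε * k) (L v) ↔ InCoset i k v := by
    rcases hε with rfl | rfl
    · exact ⟨IsometryEquiv.refl E5, fun i k v => by rw [one_mul]; rfl⟩
    · refine ⟨reflectHeight.toIsometryEquiv, fun i k v => ⟨fun h => ?_, fun h => ?_⟩⟩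
      · have h2 : reflectHeight (reflectHeight v) = v := by
          apply ext_five <;> simp [reflectHeight, involutiveIsometry_apply, reflectHeightMap]
        have := IsGlue.reflectHeight h
        rw [neg_one_mul, neg_neg] at this
        exact h2 ▸ this
      · rw [neg_one_mul]
        exact IsGlue.reflectHeight h
  refine ⟨(f.trans L).trans (IsometryEquiv.addRight (EuclideanSpace.single 4 (m : ℝ))),
    fun i k v => ?_⟩
  exact (inCoset_add_zero_iff (inCoset_zero_single m)).trans ((hL (π i) k (f v)).trans (hf i k v))

theorem image_stack {c c' : ℤ → Fin 4} {π : Equiv.Perm (Fin 4)} {ε m : ℤ} (hε : ε = 1 ∨ ε = -1)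
    {g : E5 ≃ᵢ E5} (hg : ∀ i k v, InCoset (π i) (ε * k + m) (g v) ↔ InCoset i k v)
    (h : ∀ k, c' (ε * k + m) = π (c k)) : g '' stack c = stack c' := by
  ext v
  obtain ⟨v, rfl⟩ := g.surjective v
  rw [mem_isometry_image]
  constructor
  · rintro ⟨k, hk⟩
    exact ⟨ε * k + m, by rw [h, hg]; exact hk⟩
  · rintro ⟨l, hl⟩
    obtain ⟨k, rfl⟩ : ∃ k, l = ε * k + m := by
      rcases hε with rfl | rfl
      · exact ⟨l - m, by ring⟩
      · exact ⟨m - l, by ring⟩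
    rw [h, hg] at hl
    exact ⟨k, hl⟩

theorem isometryClass_stack_eq {c c' : ℤ → Fin 4} (π : Equiv.Perm (Fin 4)) (m : ℤ)
    (h : ∀ k, c' (k + m) = π (c k)) : isometryClass (stack c) = isometryClass (stack c') := by
  obtain ⟨g, hg⟩ := exists_isometry_perm π (Or.inl rfl) m
  exact isometryClass_eq_iff.2 ⟨g, image_stack (Or.inl rfl) hg fun k => by rw [one_mul, h]⟩

/-- An isometry inducing `π` on cosets and `k ↦ ε * k + m` on heights sends the origin into the
layer of `x`; a translation by an element of `D₄` then moves it onto `x` without changing any coset.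
-/
theorem exists_isometry_stack {c : ℤ → Fin 4} {π : Equiv.Perm (Fin 4)} {ε m : ℤ}
    (hε : ε = 1 ∨ ε = -1) (h : ∀ k, c (ε * k + m) = π (c k)) (h0 : c 0 = 0) {x : E5}
    (hx : InCoset (c m) m x) : ∃ g : E5 ≃ᵢ E5, g '' stack c = stack c ∧ g 0 = x := by
  obtain ⟨g, hg⟩ := exists_isometry_perm π hε m
  have h00 : InCoset 0 0 0 := ⟨0, 0, 0, 0, 0, by simp [glueHalf, glueParity]⟩
  have hg0 : InCoset (c m) m (g 0) := by
    have h1 := (hg 0 0 0).2 h00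
    have h2 := h 0
    rw [mul_zero, zero_add] at h1 h2
    rwa [h2, h0]
  have hd : InCoset 0 0 (x - g 0) := by simpa using hx.sub_of_eq hg0
  refine ⟨g.trans (IsometryEquiv.addRight (x - g 0)), image_stack hε (π := π) (m := m) ?_ h,
    by simp⟩
  intro i k v
  have := inCoset_add_zero_iff (i := π i) (k := ε * k + m) (v := g v) hd
  rw [_root_.add_zero] at this
  exact this.trans (hg i k v)

/-! ### Uniform stackings -/

theorem inner_self_eq_of_glue {v : E5} {z0 z1 z2 z3 h k : ℤ} (h0 : v 0 = z0 + h / 2)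
    (h1 : v 1 = z1 + h / 2) (h2 : v 2 = z2 + h / 2) (h3 : v 3 = z3 + h / 2) (h4 : v 4 = k) :
    ⟪v, v⟫ = (((2 * z0 + h) ^ 2 + (2 * z1 + h) ^ 2 + (2 * z2 + h) ^ 2 + (2 * z3 + h) ^ 2 +
      4 * k ^ 2 : ℤ) : ℝ) / 4 := by
  rw [inner_eq, h0, h1, h2, h3, h4]
  push_cast
  ring

theorem two_le_div_four {n : ℤ} : (2 : ℝ) ≤ (n : ℝ) / 4 ↔ 8 ≤ n := by
  rw [le_div_iff₀ (by norm_num), show (2 : ℝ) * 4 = ((8 : ℤ) : ℝ) by norm_num, Int.cast_le]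

theorem div_four_eq_two {n : ℤ} : (n : ℝ) / 4 = 2 ↔ n = 8 := by
  rw [div_eq_iff (by norm_num), show (2 : ℝ) * 4 = ((8 : ℤ) : ℝ) by norm_num, Int.cast_inj]

theorem sq_le_one_of_sq_lt_four {k : ℤ} (h : k ^ 2 < 4) : k = -1 ∨ k = 0 ∨ k = 1 := by
  have h1 : k < 2 := by nlinarith
  have h2 : -2 < k := by nlinarith
  omega

theorem eq_zero_or_two_le {z0 z1 z2 z3 m : ℤ} (hm : z0 + z1 + z2 + z3 = 0 + 2 * m) :
    (z0 = 0 ∧ z1 = 0 ∧ z2 = 0 ∧ z3 = 0) ∨ 2 ≤ z0 ^ 2 + z1 ^ 2 + z2 ^ 2 + z3 ^ 2 := by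
  have q0 := sq_nonneg z0
  have q1 := sq_nonneg z1
  have q2 := sq_nonneg z2
  have q3 := sq_nonneg z3
  have p0 := two_dvd_sq_sub_self z0
  have p1 := two_dvd_sq_sub_self z1
  have p2 := two_dvd_sq_sub_self z2
  have p3 := two_dvd_sq_sub_self z3
  by_cases h : z0 ^ 2 + z1 ^ 2 + z2 ^ 2 + z3 ^ 2 = 0
  · left
    refine ⟨?_, ?_, ?_, ?_⟩ <;> refine (pow_eq_zero_iff two_ne_zero).1 ?_ <;> omega
  · right
    omega

/-- The labels `1, 0, 3` at heights `-1, 0, 1` are the layers of `L₅`: the bottom one contains the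
`±eᵢ`, the top one the half-integral points with an odd number of minus signs. Other heights already
contribute at least `4`. -/
theorem two_le_of_mem_stack {c : ℤ → Fin 4} (hneg : c (-1) = 1) (h0 : c 0 = 0) (h1 : c 1 = 3)
    {v : E5} (hv : v ∈ stack c) (hv0 : v ≠ 0) : 2 ≤ ⟪v, v⟫ := by
  obtain ⟨k, z0, z1, z2, z3, m, hm, e0, e1, e2, e3, e4⟩ := hv
  rw [inner_self_eq_of_glue e0 e1 e2 e3 e4, two_le_div_four]
  by_cases hk : 4 ≤ k ^ 2
  · have := sq_nonneg (2 * z0 + glueHalf (c k))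
    have := sq_nonneg (2 * z1 + glueHalf (c k))
    have := sq_nonneg (2 * z2 + glueHalf (c k))
    have := sq_nonneg (2 * z3 + glueHalf (c k))
    linarith
  rcases sq_le_one_of_sq_lt_four (not_le.1 hk) with rfl | rfl | rfl
  · rw [hneg] at hm ⊢
    simp only [glueHalf, glueParity, Matrix.cons_val_one, Matrix.cons_val_zero] at hm ⊢
    have p0 := two_dvd_sq_sub_self z0
    have p1 := two_dvd_sq_sub_self z1
    have p2 := two_dvd_sq_sub_self z2
    have p3 := two_dvd_sq_sub_self z3
    have : 0 ≤ z0 ^ 2 + z1 ^ 2 + z2 ^ 2 + z3 ^ 2 := by positivity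
    have : 1 ≤ z0 ^ 2 + z1 ^ 2 + z2 ^ 2 + z3 ^ 2 := by omega
    nlinarith
  · rw [h0] at hm e0 e1 e2 e3 ⊢
    simp only [glueHalf, glueParity, Matrix.cons_val_zero] at hm e0 e1 e2 e3 ⊢
    rcases eq_zero_or_two_le hm with ⟨rfl, rfl, rfl, rfl⟩ | h
    · exact absurd (ext_five (by simp [e0]) (by simp [e1]) (by simp [e2]) (by simp [e3])
        (by simp [e4])) hv0
    · nlinarith
  · rw [h1]
    have hodd : ∀ z : ℤ, 1 ≤ (2 * z + glueHalf 3) ^ 2 := by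
      intro z
      have : 2 * z + glueHalf 3 ≠ 0 := by simp [glueHalf]; omega
      have := sq_pos_of_ne_zero this
      omega
    have := hodd z0
    have := hodd z1
    have := hodd z2
    have := hodd z3
    linarith

set_option synthInstance.maxHeartbeats 400000 in
set_option synthInstance.maxSize 2000 in
theorem mem_kissL5_iff {c : ℤ → Fin 4} (hneg : c (-1) = 1) (h0 : c 0 = 0) (h1 : c 1 = 3)
    {v : E5} : v ∈ kissL5 ↔ v ∈ stack c ∧ ⟪v, v⟫ = 2 := by
  rw [kissL5_eq]
  constructor
  · rintro ⟨p, hp, rfl⟩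
    have hp : p ∈ intL5 := hp
    have key : ∀ p ∈ intL5, idot p p = 200 ∧ ∃ t ∈ [((0 : ℤ), (0 : Fin 4)), (-1, 1), (1, 3)],
        p.2.2.2.2 = 10 * t.1 ∧ 10 ∣ p.1 - 5 * glueHalf t.2 ∧ 10 ∣ p.2.1 - 5 * glueHalf t.2 ∧
        10 ∣ p.2.2.1 - 5 * glueHalf t.2 ∧ 10 ∣ p.2.2.2.1 - 5 * glueHalf t.2 ∧
        20 ∣ p.1 + p.2.1 + p.2.2.1 + p.2.2.2.1 - 20 * glueHalf t.2 - 10 * glueParity t.2 := by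
      decide +kernel
    obtain ⟨h, ⟨k, i⟩, ht, h4, ⟨z0, e0⟩, ⟨z1, e1⟩, ⟨z2, e2⟩, ⟨z3, e3⟩, m, hm⟩ := key p hp
    have hi : InCoset i k (toE p) := by
      refine ⟨z0, z1, z2, z3, m, by dsimp only at *; omega, ?_⟩
      rify at e0 e1 e2 e3 h4
      simp only [toE_zero_coord, toE_one_coord, toE_two_coord, toE_three_coord, toE_four_coord]
      refine ⟨?_, ?_, ?_, ?_, ?_⟩ <;> linarith
    refine ⟨(mem_stack_iff hi).2 ?_, by rw [inner_toE, h]; norm_num⟩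
    simp only [List.mem_cons, Prod.mk.injEq, List.not_mem_nil, or_false] at ht
    rcases ht with ⟨rfl, rfl⟩ | ⟨rfl, rfl⟩ | ⟨rfl, rfl⟩ <;> assumption
  · have key0 : ∀ z0 ∈ [(-1 : ℤ), 0, 1], ∀ z1 ∈ [(-1 : ℤ), 0, 1], ∀ z2 ∈ [(-1 : ℤ), 0, 1],
        ∀ z3 ∈ [(-1 : ℤ), 0, 1], z0 ^ 2 + z1 ^ 2 + z2 ^ 2 + z3 ^ 2 = 2 →
          (10 * z0, 10 * z1, 10 * z2, 10 * z3, (0 : ℤ)) ∈ intL5 := by decide +kernel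
    have key0' : ∀ z0 ∈ [(-1 : ℤ), 0, 1], ∀ z1 ∈ [(-1 : ℤ), 0, 1], ∀ z2 ∈ [(-1 : ℤ), 0, 1],
        ∀ z3 ∈ [(-1 : ℤ), 0, 1], z0 ^ 2 + z1 ^ 2 + z2 ^ 2 + z3 ^ 2 = 1 →
          (10 * z0, 10 * z1, 10 * z2, 10 * z3, (-10 : ℤ)) ∈ intL5 := by decide +kernel
    have key1 : ∀ z0 ∈ [(-1 : ℤ), 0], ∀ z1 ∈ [(-1 : ℤ), 0], ∀ z2 ∈ [(-1 : ℤ), 0],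
        ∀ z3 ∈ [(-1 : ℤ), 0], 2 ∣ z0 + z1 + z2 + z3 - 1 →
          (10 * z0 + 5, 10 * z1 + 5, 10 * z2 + 5, 10 * z3 + 5, (10 : ℤ)) ∈ intL5 := by
      decide +kernel
    rintro ⟨⟨k, z0, z1, z2, z3, m, hm, e0, e1, e2, e3, e4⟩, h⟩
    rw [inner_self_eq_of_glue e0 e1 e2 e3 e4, div_four_eq_two] at h
    have q0 := sq_nonneg z0
    have q1 := sq_nonneg z1
    have q2 := sq_nonneg z2
    have q3 := sq_nonneg z3
    have hk : k ^ 2 < 4 := by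
      have := sq_nonneg (2 * z0 + glueHalf (c k))
      have := sq_nonneg (2 * z1 + glueHalf (c k))
      have := sq_nonneg (2 * z2 + glueHalf (c k))
      have := sq_nonneg (2 * z3 + glueHalf (c k))
      linarith
    rcases sq_le_one_of_sq_lt_four hk with rfl | rfl | rfl
    · rw [hneg] at hm h e0 e1 e2 e3
      simp only [glueHalf, glueParity, Matrix.cons_val_one, Matrix.cons_val_zero]
        at hm h e0 e1 e2 e3
      have h' : z0 ^ 2 + z1 ^ 2 + z2 ^ 2 + z3 ^ 2 = 1 := by linarith
      refine ⟨_, key0' z0 (int_eq_neg_one_or (by omega)) z1 (int_eq_neg_one_or (by omega)) z2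
        (int_eq_neg_one_or (by omega)) z3 (int_eq_neg_one_or (by omega)) h', ?_⟩
      apply ext_five <;> simp [*]
    · rw [h0] at hm h e0 e1 e2 e3
      simp only [glueHalf, glueParity, Matrix.cons_val_zero] at hm h e0 e1 e2 e3
      have h' : z0 ^ 2 + z1 ^ 2 + z2 ^ 2 + z3 ^ 2 = 2 := by linarith
      refine ⟨_, key0 z0 (int_eq_neg_one_or (by omega)) z1 (int_eq_neg_one_or (by omega)) z2
        (int_eq_neg_one_or (by omega)) z3 (int_eq_neg_one_or (by omega)) h', ?_⟩
      apply ext_five <;> simp [*]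
    · rw [h1] at hm h e0 e1 e2 e3
      have g3 : glueHalf 3 = 1 := rfl
      have s3 : glueParity 3 = 1 := rfl
      rw [g3] at h e0 e1 e2 e3
      rw [s3] at hm
      have hodd : ∀ z : ℤ, 0 ≤ z ^ 2 + z := by
        intro z
        have := (sq_sub_self_nonneg (-z)).1
        linarith
      have hz : ∀ z : ℤ, z ^ 2 + z = 0 → z ∈ [(-1 : ℤ), 0] := by
        intro z h
        have := (sq_sub_self_nonneg (-z)).2 (by linarith)
        simp only [List.mem_cons, List.not_mem_nil, or_false]
        omega
      have := hodd z0
      have := hodd z1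
      have := hodd z2
      have := hodd z3
      refine ⟨_, key1 z0 (hz _ (by linarith)) z1 (hz _ (by linarith)) z2 (hz _ (by linarith)) z3
        (hz _ (by linarith)) (by omega), ?_⟩
      apply ext_five <;> simp [*] <;> ring

theorem stack_mem_uniformPackings {c : ℤ → Fin 4} (hneg : c (-1) = 1) (h0 : c 0 = 0)
    (h1 : c 1 = 3) (hsym : ∀ m : ℤ, ∃ ε : ℤ, ∃ π : Equiv.Perm (Fin 4), (ε = 1 ∨ ε = -1) ∧
      ∀ k, c (ε * k + m) = π (c k)) : stack c ∈ uniformPackings kissL5 := by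
  refine mem_uniformPackings_of_origin ?_ ?_ (fun v => two_le_of_mem_stack hneg h0 h1)
    fun v => mem_kissL5_iff hneg h0 h1
  · exact ⟨0, by rw [h0]; exact mem_layerD4.1 ⟨⟨fun i => ⟨0, by simp⟩, 0, by simp⟩, by simp⟩⟩
  · rintro x ⟨m, hx⟩
    obtain ⟨ε, π, hε, h⟩ := hsym m
    exact exists_isometry_stack hε h h0 hx

/-- A cyclic sequence of labels, with period `4`. -/
def cycle4 : ZMod 4 → Fin 4 := ![0, 3, 2, 1]

/-- A cyclic sequence of labels, with period `3`. -/
def cycle3 : ZMod 3 → Fin 4 := ![0, 3, 1]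

/-- A cyclic sequence of labels, with period `8`. -/
def cycle8 : ZMod 8 → Fin 4 := ![0, 3, 2, 0, 1, 2, 3, 1]

/-- The sequences of labels of Leech's packings, permuted in such a way that the kissing
configuration at the origin is `L₅`. -/
def leechSeq : Fin 3 → ℤ → Fin 4 :=
  ![fun k => cycle4 (k : ZMod 4), fun k => cycle3 (k : ZMod 3), fun k => cycle8 (k : ZMod 8)]

theorem apply_add_eq_zpow {c : ℤ → Fin 4} {σ : Equiv.Perm (Fin 4)} {d : ℤ}
    (h : ∀ k, c (k + d) = σ (c k)) (m k : ℤ) : c (k + d * m) = (σ ^ m) (c k) := by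
  induction m with
  | zero => simp
  | succ n ih => rw [mul_add, mul_one, ← add_assoc, h, ih, add_comm, zpow_one_add]; rfl
  | pred n ih =>
    have h1 := h (k + d * (-n - 1))
    rw [show k + d * (-(n : ℤ) - 1) + d = k + d * -n by ring, ih] at h1
    apply σ.injective
    rw [← h1, ← Equiv.Perm.mul_apply, ← zpow_one_add]
    congr 2
    ring

theorem exists_symm_of_shift {c : ℤ → Fin 4} {σ : Equiv.Perm (Fin 4)}
    (h : ∀ k, c (k + 1) = σ (c k)) (m : ℤ) : ∃ ε : ℤ, ∃ π : Equiv.Perm (Fin 4),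
      (ε = 1 ∨ ε = -1) ∧ ∀ k, c (ε * k + m) = π (c k) :=
  ⟨1, σ ^ m, Or.inl rfl, fun k => by simpa using apply_add_eq_zpow h m k⟩

/-- Shifts by two carry height `0` to the even heights; the reflection `k ↦ 1 - k` followed by such
shifts carries it to the odd ones. -/
theorem exists_symm_of_reflection {c : ℤ → Fin 4} {σ τ : Equiv.Perm (Fin 4)}
    (h : ∀ k, c (k + 2) = σ (c k)) (h' : ∀ k, c (-k + 1) = τ (c k)) (m : ℤ) :
    ∃ ε : ℤ, ∃ π : Equiv.Perm (Fin 4), (ε = 1 ∨ ε = -1) ∧ ∀ k, c (ε * k + m) = π (c k) := by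
  obtain ⟨j, rfl | rfl⟩ := Int.even_or_odd' m
  · exact ⟨1, σ ^ j, Or.inl rfl, fun k => by simpa using apply_add_eq_zpow h j k⟩
  · refine ⟨-1, σ ^ j * τ, Or.inr rfl, fun k => ?_⟩
    rw [Equiv.Perm.mul_apply, ← h', ← apply_add_eq_zpow h j]
    congr 1
    ring

theorem stack_leechSeq_mem_uniformPackings (i : Fin 3) :
    stack (leechSeq i) ∈ uniformPackings kissL5 := by
  fin_cases i
  · refine stack_mem_uniformPackings (by decide +kernel) (by decide +kernel) (by decide +kernel)
      (exists_symm_of_shift (σ := c[0, 3, 2, 1]) fun k => ?_)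
    have : ∀ x, cycle4 (x + 1) = (c[0, 3, 2, 1] : Equiv.Perm (Fin 4)) (cycle4 x) := by
      decide +kernel
    simpa [leechSeq] using this k
  · refine stack_mem_uniformPackings (by decide +kernel) (by decide +kernel) (by decide +kernel)
      (exists_symm_of_shift (σ := c[0, 3, 1]) fun k => ?_)
    have : ∀ x, cycle3 (x + 1) = (c[0, 3, 1] : Equiv.Perm (Fin 4)) (cycle3 x) := by
      decide +kernel
    simpa [leechSeq] using this k
  · refine stack_mem_uniformPackings (by decide +kernel) (by decide +kernel) (by decide +kernel)
      (exists_symm_of_reflection (σ := c[0, 2, 1, 3]) (τ := c[0, 3] * c[1, 2])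
        (fun k => ?_) fun k => ?_)
    · have : ∀ x, cycle8 (x + 2) = (c[0, 2, 1, 3] : Equiv.Perm (Fin 4)) (cycle8 x) := by
        decide +kernel
      simpa [leechSeq] using this k
    · have : ∀ x, cycle8 (-x + 1) = (c[0, 3] * c[1, 2] : Equiv.Perm (Fin 4)) (cycle8 x) := by
        decide +kernel
      simpa [leechSeq] using this k

theorem isometryClass_stack_comp {n : ℕ} {c c' : ZMod n → Fin 4} (π : Equiv.Perm (Fin 4))
    (h : ∀ x, c' x = π (c x)) :
    isometryClass (stack fun k => c k) = isometryClass (stack fun k => c' k) :=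
  isometryClass_stack_eq π 0 fun k => by rw [add_zero, h]

theorem isometryClass_packingL5 (i : Fin 3) :
    isometryClass (packingL5 i) = isometryClass (stack (leechSeq i)) := by
  fin_cases i
  · exact (congrArg isometryClass (stackingD4_eq (n := 3) ![0, 1, 2, 3])).trans
      (isometryClass_stack_comp (c' := cycle4) (Equiv.swap 1 3) (by decide +kernel))
  · exact (congrArg isometryClass (stackingD4_eq (n := 2) ![0, 1, 2])).trans
      (isometryClass_stack_comp (c' := cycle3) c[1, 3, 2] (by decide +kernel))
  · exact (congrArg isometryClass (stackingD4_eq (n := 7) ![0, 1, 2, 0, 3, 2, 1, 3])).trans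
      (isometryClass_stack_comp (c' := cycle8) (Equiv.swap 1 3) (by decide +kernel))

/-! ### Packings with kissing configuration `L₅` are stackings -/

theorem IsSpherePacking.two_le_inner {P : Set E5} (hP : IsSpherePacking P) {x w : E5} (hx : x ∈ P)
    (hxw : x + w ∈ P) (hw : w ≠ 0) : 2 ≤ ⟪w, w⟫ := by
  have h : √2 ≤ dist (x + w) x := hP hxw hx (by simpa using hw)
  rwa [dist_eq_norm, add_sub_cancel_left, sqrt_two_le_norm] at h

/-- The vertical unit vector. -/
noncomputable def vertical : E5 := EuclideanSpace.single 4 1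

theorem inner_vertical (v : E5) : ⟪vertical, v⟫ = v 4 := by
  simp [vertical, EuclideanSpace.inner_single_left]

theorem vertical_ne_zero : vertical ≠ 0 := by simp [vertical]

theorem inCoset_smul_vertical (k : ℤ) : InCoset 0 k ((k : ℝ) • vertical) := by
  have := inCoset_zero_single k
  rwa [show EuclideanSpace.single 4 (k : ℝ) = (k : ℝ) • vertical by
    apply ext_five <;> simp [vertical]] at this

theorem map_vertical {L : E5 ≃ₗᵢ[ℝ] E5}
    (hL : L '' realize (iantipodal intL5) = realize (iantipodal intL5)) :
    L vertical = vertical ∨ L vertical = -vertical := by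
  have hflat : ∀ p ∈ iantipodal intL5, p.2.2.2.2 = 0 := by decide +kernel
  have key := fun p hp => inner_map_eq_zero_of_image_eq hL (n := vertical) (p := p)
    (fun q hq => by rw [real_inner_comm, inner_vertical, toE_four_coord, hflat q hq]; simp) hp
  have h0 := key (10, -10, 0, 0, 0) (by decide +kernel)
  have h1 := key (0, 10, -10, 0, 0) (by decide +kernel)
  have h2 := key (0, 0, 10, -10, 0) (by decide +kernel)
  have h3 := key (0, 0, 10, 10, 0) (by decide +kernel)
  refine eq_or_eq_neg_of_eq_smul (c := L vertical 4) vertical_ne_zero ?_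
  rw [inner_eq] at h0 h1 h2 h3
  simp at h0 h1 h2 h3
  apply ext_five <;> simp [vertical] at * <;> linarith

theorem map_apply_four {L : E5 ≃ₗᵢ[ℝ] E5}
    (hL : L '' realize (iantipodal intL5) = realize (iantipodal intL5)) :
    ∃ ε : ℤ, (ε = 1 ∨ ε = -1) ∧ L vertical = (ε : ℝ) • vertical ∧ ∀ v, L v 4 = ε * v 4 := by
  rcases map_vertical hL with h | h
  · refine ⟨1, Or.inl rfl, by simp [h], fun v => ?_⟩
    rw [← inner_vertical, ← inner_vertical v, ← L.inner_map_map vertical v, h]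
    simp
  · refine ⟨-1, Or.inr rfl, by simp [h], fun v => ?_⟩
    rw [← inner_vertical, ← inner_vertical v, ← L.inner_map_map vertical v, h]
    simp

/-- Two different cosets at the same height contain points at distance `1`. -/
theorem exists_unit_glue {i j : Fin 4} (hij : i ≠ j) : ∃ w : E5,
    IsGlue (glueHalf j - glueHalf i) (glueParity j - glueParity i) 0 w ∧ w 4 = 0 ∧ ⟪w, w⟫ = 1 := by
  have h10 : IsGlue 0 1 0 (!₂[1, 0, 0, 0, 0] : E5) := ⟨1, 0, 0, 0, 0, by simp⟩
  have h20 : IsGlue 1 0 0 (!₂[1 / 2, 1 / 2, 1 / 2, 1 / 2, 0] : E5) := ⟨0, 0, 0, 0, 0, by simp⟩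
  have h30 : IsGlue 1 1 0 (!₂[1 / 2, 1 / 2, 1 / 2, -(1 / 2), 0] : E5) :=
    ⟨0, 0, 0, -1, -1, by simp; norm_num⟩
  have n10 : ⟪(!₂[1, 0, 0, 0, 0] : E5), !₂[1, 0, 0, 0, 0]⟫ = 1 := by rw [inner_eq]; simp
  have n20 : ⟪(!₂[1 / 2, 1 / 2, 1 / 2, 1 / 2, 0] : E5), !₂[1 / 2, 1 / 2, 1 / 2, 1 / 2, 0]⟫ = 1 := by
    rw [inner_eq]; simp; norm_num
  have n30 : ⟪(!₂[1 / 2, 1 / 2, 1 / 2, -(1 / 2), 0] : E5),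
      !₂[1 / 2, 1 / 2, 1 / 2, -(1 / 2), 0]⟫ = 1 := by rw [inner_eq]; simp; norm_num
  have key : ∀ i j : Fin 4, i ≠ j →
      (2 ∣ glueHalf j - glueHalf i - 0 ∧ 2 ∣ glueParity j - glueParity i - 1) ∨
      (2 ∣ glueHalf j - glueHalf i - 1 ∧ 2 ∣ glueParity j - glueParity i - 0) ∨
      (2 ∣ glueHalf j - glueHalf i - 1 ∧ 2 ∣ glueParity j - glueParity i - 1) := by
    decide
  rcases key i j hij with ⟨h, h'⟩ | ⟨h, h'⟩ | ⟨h, h'⟩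
  · exact ⟨_, h10.congr h h', by simp, n10⟩
  · exact ⟨_, h20.congr h h', by simp, n20⟩
  · exact ⟨_, h30.congr h h', by simp, n30⟩

/-- Integral products with the `D₄` roots place the first four coordinates in the dual lattice. The
four simple roots give `v 3 = (d - c) / 2` and recover the other coordinates from it by adding
integers. -/
theorem exists_inCoset_of_inner {v : E5} {k : ℤ} (h4 : v 4 = k)
    (h : ∀ p ∈ iantipodal intL5, ∃ n : ℤ, ⟪toE p, v⟫ = n) : ∃ i, InCoset i k v := by
  obtain ⟨a, ha⟩ := h (10, -10, 0, 0, 0) (by decide +kernel)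
  obtain ⟨b, hb⟩ := h (0, 10, -10, 0, 0) (by decide +kernel)
  obtain ⟨c, hc⟩ := h (0, 0, 10, -10, 0) (by decide +kernel)
  obtain ⟨d, hd⟩ := h (0, 0, 10, 10, 0) (by decide +kernel)
  rw [inner_eq] at ha hb hc hd
  simp at ha hb hc hd
  have hv : IsGlue (d - c) (a + b + c + (b + c) + c) k v := by
    refine ⟨a + b + c, b + c, c, 0, 0, by ring, ?_⟩
    push_cast
    refine ⟨?_, ?_, ?_, ?_, h4⟩ <;> linarith
  obtain ⟨i, -, -, hi⟩ := exists_inCoset hv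
  exact ⟨i, hi⟩

theorem kissingData_intL5 : KissingData (realize intL5) (innerSet [-50]) :=
  kissL5_eq ▸ kissingData_L5

/-- A packing with kissing configuration `L₅` is normalized when it contains the origin and has
kissing configuration `L₅` there. -/
structure IsNormalizedL5 (P : Set E5) : Prop where
  kissing : IsKissingPacking P (realize intL5)
  zero_mem : 0 ∈ P
  config : kissingConfig P 0 = realize intL5

namespace IsNormalizedL5

variable {P : Set E5}

theorem antipodalPart_eq (h : IsNormalizedL5 P) {x : E5} (hx : x ∈ P) :
    antipodalPart (kissingConfig P x) = realize (iantipodal intL5) :=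
  h.kissing.antipodalPart_eq kissingData_intL5 h.zero_mem h.config hx

theorem exists_inCoset_of_mem_kissingConfig (h : IsNormalizedL5 P) {x v : E5} (hx : x ∈ P)
    (hv : v ∈ kissingConfig P x) : ∃ i k, InCoset i k v := by
  obtain ⟨L, hL, hLA⟩ := h.kissing.exists_linearIsometryEquiv kissingData_intL5 h.zero_mem h.config hx
  obtain ⟨ε, -, -, h4⟩ := map_apply_four hLA
  rw [hL] at hv
  obtain ⟨_, ⟨p, hp, rfl⟩, rfl⟩ := hv
  have hp : p ∈ intL5 := hp
  have hint : ∀ p ∈ intL5, (∀ a ∈ iantipodal intL5, 100 ∣ idot a p) ∧ 10 ∣ p.2.2.2.2 := by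
    decide +kernel
  obtain ⟨k, hk⟩ := (hint p hp).2
  -- `L` permutes the `D₄` roots, so the products of `L (toE p)` with them are products of `toE p`
  -- with roots, hence integers.
  obtain ⟨i, hi⟩ := exists_inCoset_of_inner (v := L (toE p)) (k := ε * k)
    (by rw [h4, toE_four_coord, hk]; push_cast; ring) fun a ha => by
      have : toE a ∈ L '' realize (iantipodal intL5) := hLA.symm ▸ ⟨a, ha, rfl⟩
      obtain ⟨_, ⟨b, hb, rfl⟩, hab⟩ := this
      obtain ⟨n, hn⟩ := (hint p hp).1 b hb
      refine ⟨n, ?_⟩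
      rw [← hab, L.inner_map_map, inner_toE, hn]
      push_cast
      ring
  exact ⟨i, _, hi⟩

theorem exists_mem_kissingConfig_height (h : IsNormalizedL5 P) {x : E5} (hx : x ∈ P) {η : ℤ}
    (hη : η = 1 ∨ η = -1) : ∃ v ∈ kissingConfig P x, v 4 = η := by
  obtain ⟨L, hL, hLA⟩ := h.kissing.exists_linearIsometryEquiv kissingData_intL5 h.zero_mem h.config hx
  obtain ⟨ε, hε, -, h4⟩ := map_apply_four hLA
  have key : ∀ η ∈ [(1 : ℤ), -1], ∃ p ∈ intL5, p.2.2.2.2 = 10 * η := by decide +kernel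
  obtain ⟨p, hp, hp4⟩ := key (ε * η) (by rcases hε with rfl | rfl <;> rcases hη with rfl | rfl <;>
    simp)
  refine ⟨L (toE p), hL ▸ ⟨_, ⟨p, hp, rfl⟩, rfl⟩, ?_⟩
  rw [h4, toE_four_coord, hp4]
  rcases hε with rfl | rfl <;> push_cast <;> ring

theorem add_mem_of_layer (h : IsNormalizedL5 P) {x d : E5} (hx : x ∈ P) (hd : InCoset 0 0 d) :
    x + d ∈ P := by
  refine IsKissingPacking.add_mem_of_mem_translationLattice ?_ hx
  have hroot : ∀ p ∈ iantipodal intL5, toE p ∈ translationLattice P := fun p hp =>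
    h.kissing.antipodal_mem_translationLattice kissingData_intL5 h.zero_mem
      (h.antipodalPart_eq h.zero_mem ▸ ⟨p, hp, rfl⟩)
  obtain ⟨z0, z1, z2, z3, m, hm, h0, h1, h2, h3, h4⟩ := hd
  -- Coordinates in the simple roots `e₁ - e₂`, `e₂ - e₃`, `e₃ - e₄`, `e₃ + e₄`, using that the
  -- coordinate sum is `2 * m`.
  have h5 := add_mem (add_mem (add_mem
    (zsmul_mem (hroot (10, -10, 0, 0, 0) (by decide +kernel)) z0)
    (zsmul_mem (hroot (0, 10, -10, 0, 0) (by decide +kernel)) (z0 + z1)))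
    (zsmul_mem (hroot (0, 0, 10, -10, 0) (by decide +kernel)) (z0 + z1 + z2 - m)))
    (zsmul_mem (hroot (0, 0, 10, 10, 0) (by decide +kernel)) m)
  convert h5 using 1
  simp only [glueHalf, glueParity, Matrix.cons_val_zero, Int.cast_zero, zero_div, add_zero,
    zero_add] at *
  rify at hm
  apply ext_five <;> simp [*] <;> linarith

theorem exists_inCoset_of_mem (h : IsNormalizedL5 P) {x : E5} (hx : x ∈ P) :
    ∃ i k, InCoset i k x := by
  have h1 := h.kissing.eq_of_subset_of_closed kissingData_intL5
    (X := {x | x ∈ P ∧ ∃ i k, InCoset i k x}) (fun _ h => h.1)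
    ⟨0, h.zero_mem, 0, 0, 0, 0, 0, 0, 0, by simp [glueHalf, glueParity]⟩ ?_
  · rw [← h1] at hx
    exact hx.2
  · rintro y ⟨hy, i, k, hi⟩ v hv
    obtain ⟨j, l, hj⟩ := h.exists_inCoset_of_mem_kissingConfig hy hv
    obtain ⟨t, -, -, ht⟩ := exists_inCoset (IsGlue.add hi hj)
    exact ⟨hv.1, t, _, ht⟩

/-- Each center brings its whole `D₄` coset, so two different cosets at one height would produce
centers at distance `1 < √2`. -/
theorem eq_of_height_eq (h : IsNormalizedL5 P) {x y : E5} (hx : x ∈ P) (hy : y ∈ P) {i j : Fin 4}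
    {k : ℤ} (hi : InCoset i k x) (hj : InCoset j k y) : i = j := by
  by_contra hij
  obtain ⟨w, hw, -, hww⟩ := exists_unit_glue hij
  have h1 : IsGlue 0 0 0 (x + w - y) := by
    have := (IsGlue.add hi hw).sub hj
    simpa using this
  have h2 := h.add_mem_of_layer hy (d := x + w - y) h1
  rw [add_sub_cancel] at h2
  have := h.kissing.packing.two_le_inner hx h2 (by rintro rfl; simp at hww)
  linarith

theorem exists_mem_height (h : IsNormalizedL5 P) (k : ℤ) : ∃ i, ∃ x ∈ P, InCoset i k x := by
  have key : ∃ x ∈ P, x 4 = k := by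
    induction k with
    | zero => exact ⟨0, h.zero_mem, by simp⟩
    | succ n ih =>
      obtain ⟨x, hx, h4⟩ := ih
      obtain ⟨v, hv, hv4⟩ := h.exists_mem_kissingConfig_height hx (Or.inl rfl)
      exact ⟨x + v, hv.1, by simp [h4, hv4]⟩
    | pred n ih =>
      obtain ⟨x, hx, h4⟩ := ih
      obtain ⟨v, hv, hv4⟩ := h.exists_mem_kissingConfig_height hx (Or.inr rfl)
      exact ⟨x + v, hv.1, by simp [h4, hv4]; ring⟩
  obtain ⟨x, hx, h4⟩ := key
  obtain ⟨i, l, hi⟩ := h.exists_inCoset_of_mem hx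
  have : l = k := by
    obtain ⟨_, _, _, _, _, _, _, _, _, _, h4'⟩ := hi
    exact Int.cast_injective (α := ℝ) (h4'.symm.trans h4)
  exact ⟨i, x, hx, this ▸ hi⟩

theorem exists_eq_stack (h : IsNormalizedL5 P) : ∃ c, P = stack c := by
  choose c x hx hc using h.exists_mem_height
  refine ⟨c, Set.Subset.antisymm (fun y hy => ?_) ?_⟩
  · obtain ⟨i, k, hi⟩ := h.exists_inCoset_of_mem hy
    exact (mem_stack_iff hi).2 (h.eq_of_height_eq (hx k) hy (hc k) hi)
  · rintro y ⟨k, hk⟩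
    have h1 := hk.sub_of_eq (hc k)
    rw [sub_self] at h1
    have := h.add_mem_of_layer (hx k) h1
    rwa [add_sub_cancel] at this

variable {c c' : ℤ → Fin 4}

theorem exists_inCoset_point (i : Fin 4) (k : ℤ) : ∃ x, InCoset i k x :=
  ⟨_, by simpa using (inCoset_glueD4 i).add_zero (inCoset_zero_single k)⟩

theorem ne_succ (h : IsNormalizedL5 (stack c)) (k : ℤ) : c k ≠ c (k + 1) := by
  intro heq
  obtain ⟨x, hx⟩ := exists_inCoset_point (c k) k
  have h1 := hx.add_zero (inCoset_smul_vertical 1)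
  rw [Int.cast_one, one_smul] at h1
  have := h.kissing.packing.two_le_inner ((mem_stack_iff hx).2 rfl)
    ((mem_stack_iff h1).2 heq.symm) vertical_ne_zero
  rw [inner_vertical] at this
  simp [vertical] at this

/-- If layers `k` and `k + 2` carried the same coset, a center of the layer between them would have
contacts in opposite directions `±(w + vertical)`, because differences of cosets have order two. But
the antipodal part is horizontal. -/
theorem ne_succ_succ (h : IsNormalizedL5 (stack c)) (k : ℤ) : c k ≠ c (k + 2) := by
  intro heq
  obtain ⟨x, hx⟩ := exists_inCoset_point (c (k + 1)) (k + 1)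
  obtain ⟨w, hw, hw4, hww⟩ := exists_unit_glue (h.ne_succ k).symm
  have hv : IsGlue (glueHalf (c k) - glueHalf (c (k + 1)))
      (glueParity (c k) - glueParity (c (k + 1))) 1 (w + vertical) := by
    have := IsGlue.add hw (inCoset_smul_vertical 1)
    simpa [glueHalf, glueParity] using this
  have h1 : InCoset (c k) (k + 2) (x + (w + vertical)) := by
    have := (IsGlue.add hx hv).congr (h' := glueHalf (c k)) (s' := glueParity (c k)) (by omega)
      (by omega)
    rwa [add_assoc] at this
  have h2 : InCoset (c k) k (x - (w + vertical)) := by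
    have := (IsGlue.sub hx hv).congr (h' := glueHalf (c k)) (s' := glueParity (c k)) (by omega)
      (by omega)
    rwa [add_sub_cancel_right] at this
  have hn : ⟪w + vertical, w + vertical⟫ = 2 := by
    rw [real_inner_add_add_self, hww, inner_vertical, real_inner_comm, inner_vertical, hw4]
    simp [vertical]
    norm_num
  have hn' : ‖w + vertical‖ = √2 := norm_eq_sqrt_two.2 hn
  have h3 : w + vertical ∈ antipodalPart (kissingConfig (stack c) x) :=
    ⟨⟨(mem_stack_iff h1).2 heq.symm, hn'⟩, by
      rw [← sub_eq_add_neg]; exact (mem_stack_iff h2).2 rfl, by rwa [norm_neg]⟩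
  rw [h.antipodalPart_eq ((mem_stack_iff hx).2 rfl)] at h3
  obtain ⟨p, hp, hpw⟩ := h3
  have hflat : ∀ p ∈ iantipodal intL5, p.2.2.2.2 = 0 := by decide +kernel
  have h4 := congrArg (fun v : E5 => v 4) hpw
  simp [hflat p hp, hw4, vertical] at h4

/-- An isometry between stackings preserves the coincidences of cosets at heights that differ
by `3`. -/
theorem coincidence_iff (h : IsNormalizedL5 (stack c)) (h' : IsNormalizedL5 (stack c'))
    {g : E5 ≃ᵢ E5} (hg : g '' stack c = stack c') {m : ℤ} (hm : g 0 4 = m) :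
    (∀ j, c j = c (j + 3) ↔ c' (j + m) = c' (j + m + 3)) ∨
      ∀ j, c j = c (j + 3) ↔ c' (m - j - 3) = c' (m - j) := by
  have hg0 : g 0 ∈ stack c' := hg ▸ ⟨0, h.zero_mem, rfl⟩
  have hL : linPart g '' realize (iantipodal intL5) = realize (iantipodal intL5) := by
    have h1 := kissingConfig_image g (stack c) 0
    rw [hg] at h1
    have h2 := congrArg antipodalPart h1
    rwa [antipodalPart_image, h.antipodalPart_eq h.zero_mem, h'.antipodalPart_eq hg0, eq_comm] at h2
  obtain ⟨ε, hε, hv, h4⟩ := map_apply_four hL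
  -- The equality `c j = c (j + 3)` says that a center at height `j`, raised by `3 • vertical`, is
  -- again a center; `g` transports this with `vertical` replaced by `ε • vertical`.
  have key : ∀ j, c j = c (j + 3) ↔ c' (m + ε * j) = c' (m + ε * j + ε * 3) := by
    intro j
    obtain ⟨x, hx⟩ := exists_inCoset_point (c j) j
    have hx3 := hx.add_zero (inCoset_smul_vertical 3)
    obtain ⟨l, hl⟩ : g x ∈ stack c' := hg ▸ ⟨x, (mem_stack_iff hx).2 rfl, rfl⟩
    have hlm : l = m + ε * j := by
      have h5 := isometry_add g 0 x
      rw [zero_add] at h5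
      have h6 : g x 4 = ((m + ε * j : ℤ) : ℝ) := by
        obtain ⟨_, _, _, _, _, _, _, _, _, _, hx4⟩ := hx
        rw [h5, PiLp.add_apply, hm, h4, hx4]
        push_cast
        ring
      obtain ⟨_, _, _, _, _, _, _, _, _, _, hl4⟩ := hl
      exact Int.cast_injective (α := ℝ) (hl4.symm.trans h6)
    subst hlm
    have hl3 := hl.add_zero (inCoset_smul_vertical (ε * 3))
    have h7 : g (x + ((3 : ℤ) : ℝ) • vertical) = g x + ((ε * 3 : ℤ) : ℝ) • vertical := by
      rw [isometry_add, map_smul, hv, smul_smul]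
      congr 2
      push_cast
      ring
    rw [eq_comm, ← mem_stack_iff hx3, ← mem_isometry_image (g := g), hg, h7, mem_stack_iff hl3,
      eq_comm]
  rcases hε with rfl | rfl
  · refine Or.inl fun j => (key j).trans ?_
    rw [one_mul, one_mul, add_comm m j]
  · refine Or.inr fun j => (key j).trans ?_
    rw [eq_comm, show m + -1 * j + -1 * 3 = m - j - 3 by ring, show m + -1 * j = m - j by ring]

end IsNormalizedL5

/-! ### Classification of the uniform stackings -/

/-- Any three consecutive terms of the sequence are distinct. -/
structure IsTripleDistinct (c : ℤ → Fin 4) : Prop where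
  ne_succ : ∀ k, c k ≠ c (k + 1)
  ne_succ_succ : ∀ k, c k ≠ c (k + 2)

/-- The predicate has period two: a shift by `1` or `-1` gives this at once, and otherwise the
reflections for `m = 1` and `m = -1` compose to a shift by two. -/
theorem constant_or_alternating {a : ℤ → Prop}
    (h : ∀ m, (∀ j, a j ↔ a (j + m)) ∨ ∀ j, a j ↔ a (m - j - 3)) :
    (∀ j, a j) ∨ (∀ j, ¬a j) ∨ ∃ m, ∀ j, a (j + m) ↔ Even j := by
  have h2 : ∀ j, a j ↔ a (j + 2) := by
    intro j
    rcases h 1 with h1 | h1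
    · rw [h1, h1 (j + 1), add_assoc]; rfl
    · rcases h (-1) with h3 | h3
      · rw [h3 (j + 2), h3 (j + 2 + -1), show j + 2 + -1 + -1 = j by ring]
      · rw [h3 j, h1 (-1 - j - 3), show 1 - (-1 - j - 3) - 3 = j + 2 by ring]
  have hmul : ∀ n j, a (j + 2 * n) ↔ a j := by
    intro n j
    induction n with
    | zero => simp
    | succ n ih => rw [← ih, h2 (j + 2 * n), show j + 2 * ((n : ℤ) + 1) = j + 2 * n + 2 by ring]
    | pred n ih => rw [← ih, h2, show j + 2 * (-(n : ℤ) - 1) + 2 = j + 2 * -n by ring]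
  have heven : ∀ n, a (2 * n) ↔ a 0 := fun n => by simpa using hmul n 0
  have hodd : ∀ n, a (2 * n + 1) ↔ a 1 := fun n => by rw [add_comm, hmul]
  have hne : ∀ n : ℤ, ¬Even (2 * n + 1) := fun n => by simp
  by_cases h0 : a 0 <;> by_cases h1 : a 1
  · left
    intro j
    obtain ⟨n, rfl | rfl⟩ := Int.even_or_odd' j
    · exact (heven n).2 h0
    · exact (hodd n).2 h1
  · refine Or.inr (Or.inr ⟨0, fun j => ?_⟩)
    rw [add_zero]
    obtain ⟨n, rfl | rfl⟩ := Int.even_or_odd' j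
    · simp [heven, h0]
    · simp [hodd, h1]
  · refine Or.inr (Or.inr ⟨1, fun j => ?_⟩)
    obtain ⟨n, rfl | rfl⟩ := Int.even_or_odd' j
    · simp [hodd, h1]
    · rw [show 2 * n + 1 + 1 = 2 * (n + 1) by ring]
      simp [heven, h0]
  · refine Or.inr (Or.inl fun j => ?_)
    obtain ⟨n, rfl | rfl⟩ := Int.even_or_odd' j
    · rwa [heven]
    · rwa [hodd]

/-- Excluding `y` and `z` leaves only `x` and one other label, so one bit decides the next term. -/
theorem eq_of_coincidence {x y z u v : Fin 4} (hxy : x ≠ y) (hyz : y ≠ z) (hxz : x ≠ z)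
    (huy : u ≠ y) (huz : u ≠ z) (hvy : v ≠ y) (hvz : v ≠ z) (h : u = x ↔ v = x) : u = v := by
  omega

theorem IsTripleDistinct.eq_of_coincidence {c d : ℤ → Fin 4} (hc : IsTripleDistinct c)
    (hd : IsTripleDistinct d) (h0 : c 0 = d 0) (h1 : c 1 = d 1) (h2 : c 2 = d 2)
    (h : ∀ j, c j = c (j + 3) ↔ d j = d (j + 3)) (j : ℤ) : c j = d j := by
  suffices ∀ j, c j = d j ∧ c (j + 1) = d (j + 1) ∧ c (j + 2) = d (j + 2) from (this j).1
  intro j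
  induction j with
  | zero => exact ⟨h0, h1, h2⟩
  | succ n ih =>
    obtain ⟨i0, i1, i2⟩ := ih
    have e1 : (n : ℤ) + 1 + 1 = n + 2 := by ring
    have e2 : (n : ℤ) + 1 + 2 = n + 3 := by ring
    rw [e1, e2]
    refine ⟨i1, i2, ?_⟩
    have a1 := hc.ne_succ n
    have a2 := hc.ne_succ_succ n
    have a3 := hc.ne_succ (n + 1)
    have a4 := hc.ne_succ_succ (n + 1)
    have a5 := hc.ne_succ (n + 2)
    have b4 := hd.ne_succ_succ (n + 1)
    have b5 := hd.ne_succ (n + 2)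
    have e3 : (n : ℤ) + 2 + 1 = n + 3 := by ring
    rw [e1] at a3
    rw [e2] at a4 b4
    rw [e3] at a5 b5
    have := h n
    rw [← i1] at b4
    rw [← i2] at b5
    rw [← i0] at this
    exact FiveDim.eq_of_coincidence a1 a3 a2 a4.symm a5.symm b4.symm b5.symm
      ⟨fun h => (this.1 h.symm).symm, fun h => (this.2 h.symm).symm⟩
  | pred n ih =>
    obtain ⟨i0, i1, i2⟩ := ih
    have e1 : -(n : ℤ) - 1 + 1 = -n := by ring
    have e2 : -(n : ℤ) - 1 + 2 = -n + 1 := by ring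
    have e3 : -(n : ℤ) - 1 + 3 = -n + 2 := by ring
    have e4 : -(n : ℤ) + 1 + 1 = -n + 2 := by ring
    rw [e1, e2]
    refine ⟨?_, i0, i1⟩
    have a1 := hc.ne_succ (-n - 1)
    have a2 := hc.ne_succ_succ (-n - 1)
    have b1 := hd.ne_succ (-n - 1)
    have b2 := hd.ne_succ_succ (-n - 1)
    have a3 := hc.ne_succ (-n)
    have a4 := hc.ne_succ_succ (-n)
    have a5 := hc.ne_succ (-n + 1)
    have := h (-n - 1)
    rw [e1] at a1 b1
    rw [e2] at a2 b2
    rw [e3] at this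
    rw [e4] at a5
    rw [← i0] at b1
    rw [← i1] at b2
    rw [← i2] at this
    exact FiveDim.eq_of_coincidence a5.symm a3.symm a4.symm a2 a1 b2 b1 this

theorem exists_perm_eq : ∀ x y z : Fin 4, x ≠ y → x ≠ z → y ≠ z →
    ∃ π : Equiv.Perm (Fin 4), π 0 = x ∧ π 1 = y ∧ π 2 = z := by
  decide +kernel

/-- A permutation of the labels aligns three consecutive distinct terms. From there the coincidence
pattern determines both sequences in both directions, and permutations and shifts come from
isometries. -/
theorem IsTripleDistinct.isometryClass_eq {c d : ℤ → Fin 4} (hc : IsTripleDistinct c)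
    (hd : IsTripleDistinct d) (m : ℤ)
    (h : ∀ j, c (j + m) = c (j + m + 3) ↔ d j = d (j + 3)) :
    isometryClass (stack c) = isometryClass (stack d) := by
  have e0 := hc.ne_succ m
  have e1 := hc.ne_succ_succ m
  have e2 := hc.ne_succ (m + 1)
  rw [show m + 1 + 1 = m + 2 by ring] at e2
  obtain ⟨π, p0, p1, p2⟩ := exists_perm_eq _ _ _ e0 e1 e2
  obtain ⟨τ, t0, t1, t2⟩ := exists_perm_eq _ _ _ (hd.ne_succ 0) (hd.ne_succ_succ 0) (hd.ne_succ 1)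
  have key : ∀ x y : Fin 4, (τ * π⁻¹) x = (τ * π⁻¹) y ↔ x = y := fun x y =>
    (τ * π⁻¹).injective.eq_iff
  have hmap : ∀ i, (τ * π⁻¹) (π i) = τ i := fun i => by simp
  have heq := IsTripleDistinct.eq_of_coincidence (c := fun k => (τ * π⁻¹) (c (k + m))) (d := d)
    ⟨fun k => by
        rw [Ne, key, add_right_comm]; exact hc.ne_succ _,
      fun k => by
        rw [Ne, key, add_right_comm]; exact hc.ne_succ_succ _⟩ hd
    (by rw [zero_add, ← p0, hmap, t0])
    (by rw [add_comm 1 m, ← p1, hmap, t1]; rfl)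
    (by rw [add_comm 2 m, ← p2, hmap, t2]; rfl)
    (fun j => by rw [key, add_right_comm, h])
  refine isometryClass_stack_eq (τ * π⁻¹) (-m) fun k => ?_
  rw [← heq]
  simp

theorem isTripleDistinct_leechSeq (i : Fin 3) : IsTripleDistinct (leechSeq i) := by
  have h41 : ∀ x, cycle4 x ≠ cycle4 (x + 1) := by decide +kernel
  have h42 : ∀ x, cycle4 x ≠ cycle4 (x + 2) := by decide +kernel
  have h31 : ∀ x, cycle3 x ≠ cycle3 (x + 1) := by decide +kernel
  have h32 : ∀ x, cycle3 x ≠ cycle3 (x + 2) := by decide +kernel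
  have h81 : ∀ x, cycle8 x ≠ cycle8 (x + 1) := by decide +kernel
  have h82 : ∀ x, cycle8 x ≠ cycle8 (x + 2) := by decide +kernel
  fin_cases i
  · exact ⟨fun k => by simpa [leechSeq] using h41 k, fun k => by simpa [leechSeq] using h42 k⟩
  · exact ⟨fun k => by simpa [leechSeq] using h31 k, fun k => by simpa [leechSeq] using h32 k⟩
  · exact ⟨fun k => by simpa [leechSeq] using h81 k, fun k => by simpa [leechSeq] using h82 k⟩

theorem leechSeq_zero_ne (j : ℤ) : leechSeq 0 j ≠ leechSeq 0 (j + 3) := by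
  have : ∀ x, cycle4 x ≠ cycle4 (x + 3) := by decide +kernel
  simpa [leechSeq] using this j

theorem leechSeq_one_eq (j : ℤ) : leechSeq 1 j = leechSeq 1 (j + 3) := by
  have : ∀ x, cycle3 x = cycle3 (x + 3) := by decide +kernel
  simpa [leechSeq] using this j

theorem leechSeq_two_eq_iff (j : ℤ) : leechSeq 2 j = leechSeq 2 (j + 3) ↔ Even j := by
  have h0 : ∀ x, cycle8 (2 * x) = cycle8 (2 * x + 3) := by decide +kernel
  have h1 : ∀ x, cycle8 (2 * x + 1) ≠ cycle8 (2 * x + 1 + 3) := by decide +kernel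
  obtain ⟨n, rfl | rfl⟩ := Int.even_or_odd' j
  · simpa [leechSeq] using h0 n
  · refine iff_of_false ?_ (by simp)
    simpa [leechSeq] using h1 n

theorem IsNormalizedL5.isTripleDistinct {c : ℤ → Fin 4} (h : IsNormalizedL5 (stack c)) :
    IsTripleDistinct c := ⟨h.ne_succ, h.ne_succ_succ⟩

/-- Uniformity gives, for every `m`, a symmetry taking the origin to height `m`, hence a shift or
reflection of the coincidence pattern. -/
theorem isometryClass_stack_mem {c : ℤ → Fin 4} (h : IsNormalizedL5 (stack c))
    (hu : IsUniform (stack c)) :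
    ∃ i, isometryClass (stack c) = isometryClass (stack (leechSeq i)) := by
  have hsym : ∀ m, (∀ j, c j = c (j + 3) ↔ c (j + m) = c (j + m + 3)) ∨
      ∀ j, c j = c (j + 3) ↔ c (m - j - 3) = c (m - j - 3 + 3) := by
    intro m
    obtain ⟨x, hx⟩ := IsNormalizedL5.exists_inCoset_point (c m) m
    obtain ⟨g, hg, hgx⟩ := hu 0 h.zero_mem x ((mem_stack_iff hx).2 rfl)
    simp only [sub_add_cancel]
    refine h.coincidence_iff h hg ?_
    obtain ⟨_, _, _, _, _, _, _, _, _, _, h4⟩ := hx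
    rw [hgx, h4]
  rcases constant_or_alternating (a := fun j => c j = c (j + 3)) hsym with ha | ha | ⟨m, ha⟩
  · exact ⟨1, h.isTripleDistinct.isometryClass_eq (isTripleDistinct_leechSeq 1) 0
      fun j => iff_of_true (ha _) (leechSeq_one_eq j)⟩
  · exact ⟨0, h.isTripleDistinct.isometryClass_eq (isTripleDistinct_leechSeq 0) 0
      fun j => iff_of_false (ha _) (leechSeq_zero_ne j)⟩
  · exact ⟨2, h.isTripleDistinct.isometryClass_eq (isTripleDistinct_leechSeq 2) m
      fun j => (ha j).trans (leechSeq_two_eq_iff j).symm⟩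

/-! ### The three classes with kissing configuration `L₅` -/

theorem isNormalizedL5_leechSeq (i : Fin 3) : IsNormalizedL5 (stack (leechSeq i)) := by
  obtain ⟨h1, -, h3⟩ := stack_leechSeq_mem_uniformPackings i
  have hval : ∀ i, leechSeq i (-1) = 1 ∧ leechSeq i 0 = 0 ∧ leechSeq i 1 = 3 := by decide +kernel
  obtain ⟨hneg, h0, hpos⟩ := hval i
  refine ⟨⟨h1, kissL5_eq ▸ h3⟩, ⟨0, ?_⟩, ?_⟩
  · rw [h0]
    exact ⟨0, 0, 0, 0, 0, by simp [glueHalf, glueParity]⟩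
  · ext v
    rw [← kissL5_eq, mem_kissL5_iff hneg h0 hpos, mem_kissingConfig, zero_add, norm_eq_sqrt_two]

theorem isometryClass_image_uniformPackings_L5 :
    isometryClass '' uniformPackings kissL5 =
      Set.range fun j : Fin 3 => isometryClass (packingL5 j) := by
  ext C
  constructor
  · rintro ⟨P, hP, rfl⟩
    obtain ⟨x, hx⟩ := hP.2.2.1
    have hP' : IsKissingPacking P (realize intL5) := ⟨hP.1, kissL5_eq ▸ hP.2.2⟩
    obtain ⟨g, -, h0, hK⟩ := hP'.exists_normalized hx
    have hN : IsNormalizedL5 (g '' P) := ⟨hP'.image g, h0, hK⟩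
    obtain ⟨c, hc⟩ := hN.exists_eq_stack
    have hu := hP.2.1.image g
    rw [hc] at hN hu
    obtain ⟨i, hi⟩ := isometryClass_stack_mem hN hu
    refine ⟨i, ?_⟩
    change isometryClass (packingL5 i) = isometryClass P
    rw [isometryClass_packingL5, ← hi, ← hc]
    exact (isometryClass_eq_iff.2 ⟨g, rfl⟩).symm
  · rintro ⟨i, rfl⟩
    exact ⟨_, stack_leechSeq_mem_uniformPackings i, (isometryClass_packingL5 i).symm⟩

/-- An isometry matches coincidences along a map of heights, while the three patterns are empty,
full, and the even heights. -/
theorem isometryClass_packingL5_injective :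
    Function.Injective fun j : Fin 3 => isometryClass (packingL5 j) := by
  have key : ∀ i j, isometryClass (stack (leechSeq i)) = isometryClass (stack (leechSeq j)) →
      ∃ f : ℤ → ℤ, ∀ k, leechSeq i k = leechSeq i (k + 3) ↔
        leechSeq j (f k) = leechSeq j (f k + 3) := by
    intro i j h
    obtain ⟨g, hg⟩ := isometryClass_eq_iff.1 h
    have hN := isNormalizedL5_leechSeq i
    obtain ⟨m, hm⟩ : g 0 ∈ stack (leechSeq j) := hg ▸ ⟨0, hN.zero_mem, rfl⟩
    have h4 : g 0 4 = m := by
      obtain ⟨_, _, _, _, _, _, _, _, _, _, h4⟩ := hm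
      exact h4
    rcases hN.coincidence_iff (isNormalizedL5_leechSeq j) hg h4 with h | h
    · exact ⟨fun k => k + m, h⟩
    · exact ⟨fun k => m - k - 3, fun k => by rw [h k, sub_add_cancel]⟩
  have h01 : isometryClass (stack (leechSeq 0)) ≠ isometryClass (stack (leechSeq 1)) := fun h => by
    obtain ⟨f, hf⟩ := key _ _ h
    exact leechSeq_zero_ne 0 ((hf 0).2 (leechSeq_one_eq _))
  have h02 : isometryClass (stack (leechSeq 0)) ≠ isometryClass (stack (leechSeq 2)) := fun h => by
    obtain ⟨f, hf⟩ := key _ _ h.symm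
    exact leechSeq_zero_ne _ ((hf 0).1 ((leechSeq_two_eq_iff 0).2 (by simp)))
  have h12 : isometryClass (stack (leechSeq 1)) ≠ isometryClass (stack (leechSeq 2)) := fun h => by
    obtain ⟨f, hf⟩ := key _ _ h.symm
    have := (leechSeq_two_eq_iff 1).1 ((hf 1).2 (leechSeq_one_eq _))
    simp at this
  intro i j h
  simp only [isometryClass_packingL5] at h
  fin_cases i <;> fin_cases j
  exacts [rfl, (h01 h).elim, (h02 h).elim, (h01 h.symm).elim, rfl, (h12 h).elim,
    (h02 h.symm).elim, (h12 h.symm).elim, rfl]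

/-! ### Periodicity -/

theorem mem_translationLattice_iff_forall {P : Set E5} {y : E5} :
    y ∈ translationLattice P ↔ ∀ x, x + y ∈ P ↔ x ∈ P := by
  constructor
  · intro hy x
    refine ⟨fun hx => ?_, fun hx => IsKissingPacking.add_mem_of_mem_translationLattice hy hx⟩
    simpa using IsKissingPacking.add_mem_of_mem_translationLattice (neg_mem hy) hx
  · intro h
    refine IsKissingPacking.mem_translationLattice_of_forall (fun x hx => (h x).2 hx) fun x hx => ?_
    rwa [← h, sub_add_cancel]

theorem linPart_mem_translationLattice_image {P : Set E5} {g : E5 ≃ᵢ E5} {y : E5} :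
    linPart g y ∈ translationLattice (g '' P) ↔ y ∈ translationLattice P := by
  simp only [mem_translationLattice_iff_forall]
  refine ⟨fun h x => ?_, fun h x => ?_⟩
  · have := h (g x)
    rwa [← isometry_add, mem_isometry_image, mem_isometry_image] at this
  · obtain ⟨x, rfl⟩ := g.surjective x
    rw [← isometry_add, mem_isometry_image, mem_isometry_image, h]

theorem IsSpherePacking.discreteTopology {P : Set E5} (hP : IsSpherePacking P)
    (hne : P.Nonempty) : DiscreteTopology (translationLattice P) := by
  obtain ⟨x, hx⟩ := hne
  refine DiscreteTopology.of_forall_le_dist (r := √2) (by positivity) ?_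
  intro y z hyz
  have hy := IsKissingPacking.add_mem_of_mem_translationLattice y.2 hx
  have hz := IsKissingPacking.add_mem_of_mem_translationLattice z.2 hx
  have : √2 ≤ dist (x + (y : E5)) (x + z) :=
    hP hy hz fun h => hyz (Subtype.ext (add_left_cancel h))
  rwa [dist_add_left] at this

theorem isPeriodicPacking_image {P : Set E5} (hP : IsSpherePacking P) {m : ℕ} [NeZero m]
    {t : Fin m → E5} (hspan : Submodule.span ℝ (translationLattice P : Set E5) = ⊤)
    (ht : ∀ i, t i ∈ P) (hcover : ∀ x ∈ P, ∃ i, x - t i ∈ translationLattice P)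
    (hinj : ∀ i j, t i - t j ∈ translationLattice P → i = j) (g : E5 ≃ᵢ E5) :
    IsPeriodicPacking m (g '' P) := by
  have hsub : ∀ x y, g x - g y ∈ translationLattice (g '' P) ↔ x - y ∈ translationLattice P :=
    fun x y => by rw [← linPart_sub, linPart_mem_translationLattice_image]
  refine ⟨(hP.image g).discreteTopology ⟨_, _, ht 0, rfl⟩, ?_, ?_⟩
  · have h1 : (linPart g).toLinearEquiv.toLinearMap '' (translationLattice P : Set E5) ⊆
        translationLattice (g '' P) := by
      rintro _ ⟨y, hy, rfl⟩
      exact linPart_mem_translationLattice_image.2 hy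
    refine eq_top_iff.2 (le_trans ?_ (Submodule.span_mono h1))
    rw [Submodule.span_image, hspan, Submodule.map_top]
    exact (LinearMap.range_eq_top.2 (linPart g).surjective).ge
  · have h1 : (QuotientAddGroup.mk : E5 → E5 ⧸ translationLattice (g '' P)) '' (g '' P) =
        Set.range fun i => (QuotientAddGroup.mk (g (t i)) : E5 ⧸ translationLattice (g '' P)) := by
      ext c
      constructor
      · rintro ⟨_, ⟨x, hx, rfl⟩, rfl⟩
        obtain ⟨i, hi⟩ := hcover x hx
        refine ⟨i, QuotientAddGroup.eq_iff_sub_mem.2 ?_⟩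
        rw [hsub, ← neg_sub]
        exact neg_mem hi
      · rintro ⟨i, rfl⟩
        exact ⟨_, ⟨_, ht i, rfl⟩, rfl⟩
    have h2 : Function.Injective fun i =>
        (QuotientAddGroup.mk (g (t i)) : E5 ⧸ translationLattice (g '' P)) := by
      intro i j hij
      exact hinj i j ((hsub _ _).1 (QuotientAddGroup.eq_iff_sub_mem.1 hij))
    rw [h1, ← Set.image_univ, h2.encard_image, Set.encard_univ]
    simp

theorem span_eq_top_of_forall {S : Set E5} {b : Fin 5 → E5} (hb : ∀ i, b i ∈ S)
    (h : ∀ v : E5, ∃ c : Fin 5 → ℝ, v = ∑ i, c i • b i) : Submodule.span ℝ S = ⊤ := by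
  refine eq_top_iff.2 fun v _ => ?_
  obtain ⟨c, rfl⟩ := h v
  exact Submodule.sum_mem _ fun i _ => Submodule.smul_mem _ _ (Submodule.subset_span (hb i))

/-- Lowering `m` by `5` raises every `z` by `4`, so the label `s` is determined only modulo `20`. -/
theorem IsQ5.dvd {s s' : ℤ} {v : E5} (h : IsQ5 s v) (h' : IsQ5 s' v) : 20 ∣ s' - s := by
  obtain ⟨z0, z1, z2, z3, z4, m, hs, h0, h1, h2, h3, h4⟩ := h
  obtain ⟨y0, y1, y2, y3, y4, n, ht, e0, e1, e2, e3, e4⟩ := h'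
  have key : ∀ {a b : ℤ} {x : ℝ}, x = a + 4 / 5 * m → x = b + 4 / 5 * n →
      5 * a + 4 * m = 5 * b + 4 * n := by
    intro a b x ha hb
    have : (5 * a + 4 * m : ℝ) = 5 * b + 4 * n := by linarith
    exact_mod_cast this
  have k0 := key h0 e0
  have k1 := key h1 e1
  have k2 := key h2 e2
  have k3 := key h3 e3
  have k4 := key h4 e4
  omega

theorem IsQ5.mem_translationLattice {v : E5} (h : IsQ5 0 v) : v ∈ translationLattice packingQ5 := by
  refine IsKissingPacking.mem_translationLattice_of_forall (fun x hx => ?_) fun x hx => ?_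
  · rw [mem_packingQ5] at hx ⊢
    exact hx.imp (fun hx => by simpa using hx.add h) fun hx => by simpa using hx.add h
  · rw [mem_packingQ5, sub_eq_add_neg] at *
    exact hx.imp (fun hx => by simpa using hx.add h.neg) fun hx => by simpa using hx.add h.neg

/-- Representatives of the classes of `packingQ5` modulo translations. -/
noncomputable def repQ5 : Fin 2 → E5 := ![!₂[0, 0, 0, 0, 0], !₂[0, 0, 0, -1, -1]]

theorem isQ5_repQ5 (i : Fin 2) : IsQ5 (![0, -2] i) (repQ5 i) := by
  fin_cases i
  · exact ⟨0, 0, 0, 0, 0, 0, by simp [repQ5]⟩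
  · exact ⟨0, 0, 0, -1, -1, 0, by simp [repQ5]⟩

theorem isPeriodicPacking_packingQ5 (g : E5 ≃ᵢ E5) : IsPeriodicPacking 2 (g '' packingQ5) := by
  have hrep : ∀ i, repQ5 i ∈ packingQ5 := by
    intro i
    rw [mem_packingQ5]
    have := isQ5_repQ5 i
    fin_cases i
    exacts [Or.inl this, Or.inr this]
  refine isPeriodicPacking_image packingQ5_mem_uniformPackings.1 (t := repQ5) ?_ hrep ?_ ?_ g
  · refine span_eq_top_of_forall (b := ![!₂[1, -1, 0, 0, 0], !₂[0, 1, -1, 0, 0],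
      !₂[0, 0, 1, -1, 0], !₂[0, 0, 0, 1, -1], !₂[4 / 5, 4 / 5, 4 / 5, 4 / 5, 4 / 5]]) ?_ ?_
    · intro i
      refine IsQ5.mem_translationLattice ?_
      fin_cases i
      · exact ⟨1, -1, 0, 0, 0, 0, by simp⟩
      · exact ⟨0, 1, -1, 0, 0, 0, by simp⟩
      · exact ⟨0, 0, 1, -1, 0, 0, by simp⟩
      · exact ⟨0, 0, 0, 1, -1, 0, by simp⟩
      · exact ⟨0, 0, 0, 0, 0, 1, by simp⟩
    · intro v
      refine ⟨![v 0 - (v 0 + v 1 + v 2 + v 3 + v 4) / 5,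
        v 0 + v 1 - 2 * (v 0 + v 1 + v 2 + v 3 + v 4) / 5,
        v 0 + v 1 + v 2 - 3 * (v 0 + v 1 + v 2 + v 3 + v 4) / 5,
        v 0 + v 1 + v 2 + v 3 - 4 * (v 0 + v 1 + v 2 + v 3 + v 4) / 5,
        (v 0 + v 1 + v 2 + v 3 + v 4) / 4], ?_⟩
      apply ext_five <;> simp [Fin.sum_univ_five] <;> ring
  · intro x hx
    rcases mem_packingQ5.1 hx with hx | hx
    · exact ⟨0, IsQ5.mem_translationLattice (hx.add (isQ5_repQ5 0).neg)⟩
    · exact ⟨1, IsQ5.mem_translationLattice (hx.add (isQ5_repQ5 1).neg)⟩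
  -- A translation of label `-2` would move a point of that class to label `-4`, which is neither
  -- `0` nor `-2` modulo `20`.
  · have key : ∀ v, IsQ5 (-2) v → v ∉ translationLattice packingQ5 := by
      intro v hv hvt
      have h1 : v ∈ packingQ5 := mem_packingQ5.2 (Or.inr hv)
      have h2 := IsKissingPacking.add_mem_of_mem_translationLattice hvt h1
      rcases mem_packingQ5.1 h2 with h2 | h2
      · have := (hv.add hv).dvd h2; omega
      · have := (hv.add hv).dvd h2; omega
    intro i j hij
    have h1 := (isQ5_repQ5 1).add (isQ5_repQ5 0).neg
    fin_cases i <;> fin_cases j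
    · rfl
    · exact (key _ h1 (by rw [← sub_eq_add_neg, ← neg_sub]; exact neg_mem hij)).elim
    · exact (key _ h1 hij).elim
    · rfl

theorem IsR5.dvd {e s e' s' : ℤ} {v : E5} (h : IsR5 e s v) (h' : IsR5 e' s' v) :
    4 ∣ e' - e ∧ 20 ∣ (s' - e') - (s - e) := by
  obtain ⟨z0, z1, z2, z3, n, m, hs, h0, h1, h2, h3, h4⟩ := h
  obtain ⟨y0, y1, y2, y3, k, l, ht, e0, e1, e2, e3, e4⟩ := h'
  have key : ∀ {a b : ℤ} {x : ℝ}, x = a - n / 2 + 4 / 5 * m → x = b - k / 2 + 4 / 5 * l →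
      10 * a - 5 * n + 8 * m = 10 * b - 5 * k + 8 * l := by
    intro a b x ha hb
    have : (10 * a - 5 * n + 8 * m : ℝ) = 10 * b - 5 * k + 8 * l := by linarith
    exact_mod_cast this
  have k0 := key h0 e0
  have k1 := key h1 e1
  have k2 := key h2 e2
  have k3 := key h3 e3
  have k4 : 5 * (-e + 2 * n) + 4 * m = 5 * (-e' + 2 * k) + 4 * l := by
    have : (5 * (-e + 2 * n) + 4 * m : ℝ) = 5 * (-e' + 2 * k) + 4 * l := by linarith
    exact_mod_cast this
  constructor <;> omega

theorem IsR5.mem_translationLattice {v : E5} (h : IsR5 0 0 v) :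
    v ∈ translationLattice packingR5 := by
  refine IsKissingPacking.mem_translationLattice_of_forall (fun x hx => ?_) fun x hx => ?_
  · obtain ⟨e, s, hes, hx⟩ := mem_packingR5_iff_exists.1 hx
    exact mem_packingR5_iff_exists.2 ⟨e, s, hes, by simpa using hx.add h⟩
  · obtain ⟨e, s, hes, hx⟩ := mem_packingR5_iff_exists.1 hx
    exact mem_packingR5_iff_exists.2 ⟨e, s, hes, by simpa [sub_eq_add_neg] using hx.add h.neg⟩

/-- Representatives of the classes of `packingR5` modulo translations. -/
noncomputable def repR5 : Fin 4 → E5 :=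
  ![!₂[0, 0, 0, 0, 0], !₂[0, 0, 0, 1, -1], !₂[0, 0, -1, -1, 0], !₂[0, 0, 0, -1, -1]]

theorem isR5_repR5 (i : Fin 4) : IsR5 (![0, 1, 0, 1] i) (![0, 1, -2, -1] i) (repR5 i) := by
  fin_cases i
  · exact ⟨0, 0, 0, 0, 0, 0, by simp [repR5]⟩
  · exact ⟨0, 0, 0, 1, 0, 0, by simp [repR5]⟩
  · exact ⟨0, 0, -1, -1, 0, 0, by simp [repR5]⟩
  · exact ⟨0, 0, 0, -1, 0, 0, by simp [repR5]⟩

theorem repR5_mem (i : Fin 4) : repR5 i ∈ packingR5 := by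
  refine mem_packingR5_iff_exists.2 ⟨_, _, ?_, isR5_repR5 i⟩
  fin_cases i <;> simp [IsClassR5]

theorem isPeriodicPacking_packingR5 (g : E5 ≃ᵢ E5) : IsPeriodicPacking 4 (g '' packingR5) := by
  refine isPeriodicPacking_image packingR5_mem_uniformPackings.1 (t := repR5) ?_ repR5_mem ?_ ?_ g
  · refine span_eq_top_of_forall (b := ![!₂[1, -1, 0, 0, 0], !₂[0, 1, -1, 0, 0],
      !₂[0, 0, 1, -1, 0], !₂[-(1 / 2), -(1 / 2), -(1 / 2), -(1 / 2), 2],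
      !₂[4 / 5, 4 / 5, 4 / 5, 4 / 5, 4 / 5]]) ?_ ?_
    · intro i
      refine IsR5.mem_translationLattice ?_
      fin_cases i
      · exact ⟨1, -1, 0, 0, 0, 0, by simp⟩
      · exact ⟨0, 1, -1, 0, 0, 0, by simp⟩
      · exact ⟨0, 0, 1, -1, 0, 0, by simp⟩
      · exact ⟨0, 0, 0, 0, 1, 0, by simp⟩
      · exact ⟨0, 0, 0, 0, 0, 1, by simp⟩
    · intro v
      obtain ⟨r, hr⟩ : ∃ r, r = (v 0 + v 1 + v 2 + v 3 + v 4) / 5 := ⟨_, rfl⟩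
      refine ⟨![v 0 - r + (v 4 - r) / 4, v 0 + v 1 - 2 * r + (v 4 - r) / 2,
        v 0 + v 1 + v 2 - 3 * r + 3 * (v 4 - r) / 4, (v 4 - r) / 2, 5 * r / 4], ?_⟩
      apply ext_five <;> simp [Fin.sum_univ_five] <;> linarith
  · intro x hx
    rcases mem_packingR5.1 hx with hx | hx | hx | hx
    · exact ⟨0, IsR5.mem_translationLattice (hx.add (isR5_repR5 0).neg)⟩
    · exact ⟨1, IsR5.mem_translationLattice (hx.add (isR5_repR5 1).neg)⟩
    · exact ⟨2, IsR5.mem_translationLattice (hx.add (isR5_repR5 2).neg)⟩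
    · exact ⟨3, IsR5.mem_translationLattice (hx.add (isR5_repR5 3).neg)⟩
  · intro i j hij
    have h := (isR5_repR5 i).add (isR5_repR5 j).neg
    have key : ∀ k, ∃ e s, IsClassR5 e s ∧
        4 ∣ e - (![0, 1, 0, 1] k + (![0, 1, 0, 1] i + -![0, 1, 0, 1] j)) ∧
        20 ∣ (s - e) - ((![0, 1, -2, -1] k + (![0, 1, -2, -1] i + -![0, 1, -2, -1] j)) -
          (![0, 1, 0, 1] k + (![0, 1, 0, 1] i + -![0, 1, 0, 1] j))) := by
      intro k
      have h1 := IsKissingPacking.add_mem_of_mem_translationLattice hij (repR5_mem k)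
      obtain ⟨e, s, hes, h2⟩ := mem_packingR5_iff_exists.1 h1
      exact ⟨e, s, hes, ((isR5_repR5 k).add h).dvd h2⟩
    -- The effect of the alleged translation on two representatives already rules out every pair `i
    -- ≠ j`.
    obtain ⟨e, s, hes, h1, h2⟩ := key 0
    obtain ⟨e', s', hes', h1', h2'⟩ := key 3
    unfold IsClassR5 at hes hes'
    clear key h hij
    fin_cases i <;> fin_cases j <;> first | rfl | (exfalso; simp at h1 h2 h1' h2'; omega)

/-! ### The classification -/

/-- Inner products within kissing configurations are isometry invariants, and the value `n` occurs
in only one of the two. -/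
theorem disjoint_isometryClass {l l' : List IVec} {n : ℤ} (h : ∃ p ∈ l, ∃ q ∈ l, idot p q = n)
    (h' : ∀ p ∈ l', ∀ q ∈ l', idot p q ≠ n) :
    Disjoint (isometryClass '' uniformPackings (realize l))
      (isometryClass '' uniformPackings (realize l')) := by
  rw [Set.disjoint_left]
  rintro _ ⟨P, hP, rfl⟩ ⟨Q, hQ, hPQ⟩
  obtain ⟨g, rfl⟩ := isometryClass_eq_iff.1 hPQ
  have hQ' := uniformPackings_image hQ g
  obtain ⟨x, hx⟩ := hP.2.2.1
  obtain ⟨L, hL⟩ := hP.2.2.2 x hx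
  obtain ⟨M, hM⟩ := hQ'.2.2.2 x hx
  obtain ⟨p, hp, q, hq, hpq⟩ := h
  have key : ∀ p ∈ l, ∃ p' ∈ l', M (toE p') = L (toE p) := by
    intro p hp
    have : L (toE p) ∈ M '' realize l' := by rw [hM, ← hL]; exact ⟨_, ⟨p, hp, rfl⟩, rfl⟩
    obtain ⟨_, ⟨p', hp', rfl⟩, h⟩ := this
    exact ⟨p', hp', h⟩
  obtain ⟨p', hp', h1⟩ := key p hp
  obtain ⟨q', hq', h2⟩ := key q hq
  refine h' p' hp' q' hq' ?_
  rw [← inner_toE_eq_iff, ← M.inner_map_map, h1, h2, L.inner_map_map, inner_toE_eq_iff, hpq]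

theorem isometryClass_image_eq_singleton {K P : Set E5} {S : Set ℝ} (hK : KissingData K S)
    {Φ : E5 → Set E5} (hΦ : ∀ P, IsKissingPacking P K → 0 ∈ P → kissingConfig P 0 = K →
      ∀ r ∈ K, kissingConfig P r = Φ r) (hP : P ∈ uniformPackings K) :
    isometryClass '' uniformPackings K = {isometryClass P} := by
  ext C
  constructor
  · rintro ⟨Q, hQ, rfl⟩
    exact isometryClass_eq_iff.2 (IsKissingPacking.exists_isometry_of_local_rule hK hΦ
      ⟨hQ.1, hQ.2.2⟩ ⟨hP.1, hP.2.2⟩)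
  · rintro rfl
    exact ⟨P, hP, rfl⟩

theorem exists_image_eq_of_singleton {K P Q : Set E5}
    (h : isometryClass '' uniformPackings K = {isometryClass P}) (hQ : Q ∈ uniformPackings K) :
    ∃ g : E5 ≃ᵢ E5, g '' P = Q := by
  have : isometryClass Q ∈ isometryClass '' uniformPackings K := ⟨Q, hQ, rfl⟩
  rw [h] at this
  exact isometryClass_eq_iff.1 (Set.mem_singleton_iff.1 this).symm

theorem isometryClass_image_D5 :
    isometryClass '' uniformPackings kissD5 = {isometryClass packingD5} :=
  isometryClass_image_eq_singleton kissingData_D5 (Φ := fun _ => kissD5) rule_D5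
    packingD5_mem_uniformPackings

theorem isometryClass_image_Q5 :
    isometryClass '' uniformPackings kissQ5 = {isometryClass packingQ5} :=
  isometryClass_image_eq_singleton kissingData_Q5 rule_Q5 packingQ5_mem_uniformPackings

theorem isometryClass_image_R5 :
    isometryClass '' uniformPackings kissR5 = {isometryClass packingR5} :=
  isometryClass_image_eq_singleton kissingData_R5 rule_R5 packingR5_mem_uniformPackings

theorem encard_isometryClass_image_L5 :
    (isometryClass '' uniformPackings kissL5).encard = 3 := by
  rw [isometryClass_image_uniformPackings_L5, ← Set.image_univ,
    isometryClass_packingL5_injective.encard_image, Set.encard_univ]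
  simp

/-- Of the values `-1/2` and `2/5`, `D₅` has neither, `L₅` only the first, `Q₅` only the second and
`R₅` both; the classes are disjoint and number `1 + 3 + 1 + 1`. -/
theorem encard_isometryClass_image_union :
    (isometryClass '' (uniformPackings kissD5 ∪ uniformPackings kissL5 ∪
      uniformPackings kissQ5 ∪ uniformPackings kissR5)).encard = 6 := by
  have hL : ∃ p ∈ intL5, ∃ q ∈ intL5, idot p q = -50 := by decide +kernel
  have hQ : ∃ p ∈ intQ5, ∃ q ∈ intQ5, idot p q = 40 := by decide +kernel
  have hR : ∃ p ∈ intR5, ∃ q ∈ intR5, idot p q = 40 := by decide +kernel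
  have hR' : ∃ p ∈ intR5, ∃ q ∈ intR5, idot p q = -50 := by decide +kernel
  have nD : ∀ p ∈ intD5, ∀ q ∈ intD5, idot p q ≠ -50 := by decide +kernel
  have nD' : ∀ p ∈ intD5, ∀ q ∈ intD5, idot p q ≠ 40 := by decide +kernel
  have nL : ∀ p ∈ intL5, ∀ q ∈ intL5, idot p q ≠ 40 := by decide +kernel
  have nQ : ∀ p ∈ intQ5, ∀ q ∈ intQ5, idot p q ≠ -50 := by decide +kernel
  have dDL := (disjoint_isometryClass hL nD).symm
  have dDQ := (disjoint_isometryClass hQ nD').symm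
  have dDR := (disjoint_isometryClass hR nD').symm
  have dLQ := (disjoint_isometryClass hQ nL).symm
  have dLR := (disjoint_isometryClass hR nL).symm
  have dQR := (disjoint_isometryClass hR' nQ).symm
  rw [← kissD5_eq, ← kissL5_eq] at dDL
  rw [← kissD5_eq, ← kissQ5_eq] at dDQ
  rw [← kissD5_eq, ← kissR5_eq] at dDR
  rw [← kissL5_eq, ← kissQ5_eq] at dLQ
  rw [← kissL5_eq, ← kissR5_eq] at dLR
  rw [← kissQ5_eq, ← kissR5_eq] at dQR
  rw [Set.image_union, Set.image_union, Set.image_union,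
    Set.encard_union_eq (Disjoint.union_left (Disjoint.union_left dDR dLR) dQR),
    Set.encard_union_eq (Disjoint.union_left dDQ dLQ), Set.encard_union_eq dDL,
    encard_isometryClass_image_L5, isometryClass_image_D5, isometryClass_image_Q5,
    isometryClass_image_R5, Set.encard_singleton, Set.encard_singleton, Set.encard_singleton]
  norm_num

end FiveDim

open FiveDim

/-- The uniform sphere packings in five dimensions with kissing configuration `D₅`, `L₅`, `Q₅`
or `R₅`, up to isometry. -/
theorem mainTheorem2 :
    (isometryClass '' (uniformPackings kissD5 ∪ uniformPackings kissL5 ∪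
      uniformPackings kissQ5 ∪ uniformPackings kissR5)).encard = 6 ∧
    isometryClass '' uniformPackings kissD5 = {isometryClass packingD5} ∧
    isometryClass '' uniformPackings kissL5 =
      Set.range (fun j : Fin 3 => isometryClass (packingL5 j)) ∧
    (isometryClass '' uniformPackings kissL5).encard = 3 ∧
    isometryClass '' uniformPackings kissQ5 = {isometryClass packingQ5} ∧
    isometryClass '' uniformPackings kissR5 = {isometryClass packingR5} ∧
    (∀ P ∈ uniformPackings kissQ5, IsPeriodicPacking 2 P) ∧
    (∀ P ∈ uniformPackings kissR5, IsPeriodicPacking 4 P) := by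
  refine ⟨encard_isometryClass_image_union, isometryClass_image_D5,
    isometryClass_image_uniformPackings_L5, encard_isometryClass_image_L5, isometryClass_image_Q5,
    isometryClass_image_R5, fun P hP => ?_, fun P hP => ?_⟩
  · obtain ⟨g, rfl⟩ := exists_image_eq_of_singleton isometryClass_image_Q5 hP
    exact isPeriodicPacking_packingQ5 g
  · obtain ⟨g, rfl⟩ := exists_image_eq_of_singleton isometryClass_image_R5 hP
    exact isPeriodicPacking_packingR5 g
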